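/- Let $M$ be a smooth 7-manifold (Hausdorff, second countable, without boundary) with a closed $\mathrm{G}_2$-structure $\varphi$: a smooth 3-form with $d\varphi=0$ such that for each $x\in M$ there is a linear isomorphism $\iota_x:T_xM\to\mathbb R^7$ with $\varphi(x)=\iota_x^*\varphi_0$, where, with $dx_{ijk}=dx_i\wedge dx_j\wedge dx_k$, $$\varphi_0=dx_{123}+dx_{145}+dx_{167}+dx_{246}-dx_{257}-dx_{347}-dx_{356}.$$ Let $g=g(\varphi)$ be the induced metric, $g(x)=\iota_x^*g_0$, let $*\varphi(x)=\iota_x^*(*\varphi_0)$, and let $M$ be oriented by $\varphi$. Let $N\subset M$ be a compact embedded 4-dimensional submanifold with non-empty boundary which is coassociative, i.e. $\varphi|_N=0$, oriented by $*\varphi|_N$. Let $S\subset M$ be a scaffold for $N$ that is closed as a subset of $M$: an orientable embedded 6-dimensional submanifold without boundary such that (a) $\partial N\subset S$ and the inward-pointing $g$-unit normal of $\partial N$ in $N$ is $g$-normal to $S$, and (b) $S$ is symplectic, i.e. the 2-form $(\mathbf n_S\lrcorner\varphi)|_S$ is closed on $S$, where $\mathbf n_S$ is a smooth $g$-unit normal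 field along $S$. Let $\Lambda^2_+T^*N$ be the bundle of 2-forms on $N$ that are self-dual for $g|_N$. Then for every open neighbourhood $W$ of $S$ there are a tubular neighbourhood $T_S\subseteq W$ of $S$ (an open set $T_S\supset S$ with a diffeomorphism $\eta:S\times(-\varepsilon,\varepsilon)\to T_S$ for some $\varepsilon>0$ such that $\eta(x,0)=x$ and $\partial_s\eta(x,0)$ is a $g$-unit normal to $S$ for all $x\in S$) and a smooth Riemannian metric $\hat g$ on $M$ such that: 1. $\hat g=g$ on $M\setminus T_S$, and $S$ is totally geodesic with respect to $\hat g$. 2. Let $\hat\nu_M(N)$ be the normal bundle of $N$ in $M$ with respect to $\hat g$. The map $\jmath_N:\hat\nu_M(N)\to\Lambda^2_+T^*N$, $\jmath_N(\mathbf v)=(\mathbf v\lrcorner\varphi)|_{TN}$, is well defined and a linear isomorphism on each fibre. 3. There are an open subset $\mathcal V_N$ of $\hat\nu_M(N)$ containing the zero section, on which the exponential map $\widehat{\exp}_M$ of $\hat g$ is defined, and a 7-dimensional submanifold $\mathcal T_N$ of $M$ with boundary, containing $N$, such that $\widehat{\exp}_M:\mathcal V_N\to\mathcal T_N$ is a diffeomorphism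 and, for every smooth section $\mathbf v$ of $\hat\nu_M(N)$ with values in $\mathcal V_N$, $\widehat{\exp}_M(\mathbf v(x))\in S$ for all $x\in\partial N$. 4. $\mathcal U_N=\jmath_N(\mathcal V_N)$ is an open neighbourhood of the zero section in $\Lambda^2_+T^*N$, and $\delta_N=\widehat{\exp}_M\circ\jmath_N^{-1}:\mathcal U_N\to\mathcal T_N$ is a diffeomorphism. For every smooth self-dual 2-form $\alpha$ on $N$ with values in $\mathcal U_N$, $\delta_N(\alpha(x))\in S$ for all $x\in\partial N$, and $x\mapsto\delta_N(\alpha(x))$ is a smooth embedding of $N$ into $M$ with image in $\mathcal T_N$; so $N_\alpha=\delta_N(\alpha(N))\subset\mathcal T_N$ is a compact 4-dimensional submanifold of $M$ with boundary $\partial N_\alpha\subset S$. -/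

import Mathlib

open Set Filter Topology Manifold Bundle
open scoped ContDiff

noncomputable section

namespace Coassoc

/-! ### The model 3-form, 4-form and metric on `ℝ⁷` -/

/-- The value on `v₁, …, v_k` of the elementary form `dx_{s 0} ∧ … ∧ dx_{s (k-1)}` on `ℝ⁷`
(indices starting at `0`). -/
def elemForm {k : ℕ} (s : Fin k → Fin 7) (v : Fin k → EuclideanSpace ℝ (Fin 7)) : ℝ :=
  (Matrix.of fun a b : Fin k => v b (s a)).det

/-- `φ₀ = dx₁₂₃ + dx₁₄₅ + dx₁₆₇ + dx₂₄₆ - dx₂₅₇ - dx₃₄₇ - dx₃₅₆`. -/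
def modelPhi (v : Fin 3 → EuclideanSpace ℝ (Fin 7)) : ℝ :=
  elemForm ![0, 1, 2] v + elemForm ![0, 3, 4] v + elemForm ![0, 5, 6] v
    + elemForm ![1, 3, 5] v - elemForm ![1, 4, 6] v - elemForm ![2, 3, 6] v
    - elemForm ![2, 4, 5] v

/-- `*φ₀ = dx₄₅₆₇ + dx₂₃₆₇ + dx₂₃₄₅ + dx₁₃₅₇ - dx₁₃₄₆ - dx₁₂₅₆ - dx₁₂₄₇`. -/
def modelStarPhi (v : Fin 4 → EuclideanSpace ℝ (Fin 7)) : ℝ :=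
  elemForm ![3, 4, 5, 6] v + elemForm ![1, 2, 5, 6] v + elemForm ![1, 2, 3, 4] v
    + elemForm ![0, 2, 4, 6] v - elemForm ![0, 2, 3, 5] v - elemForm ![0, 1, 4, 5] v
    - elemForm ![0, 1, 3, 6] v

/-! ### Differential forms on a manifold without boundary -/

section Forms

variable {n : ℕ} {X : Type*} [TopologicalSpace X] [ChartedSpace (EuclideanSpace ℝ (Fin n)) X]

variable (n X) in
/-- Not necessarily smooth `k`-forms on `X`. -/
abbrev FormField (k : ℕ) : Type _ := ∀ x : X, TangentSpace (𝓡 n) x [⋀^Fin k]→L[ℝ] ℝ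

/-- The expression of a `k`-form in the preferred chart at `p`; meaningful on the target of the
chart. -/
def formInChart {k : ℕ} (β : FormField n X k) (p : X) (y : EuclideanSpace ℝ (Fin n)) :
    EuclideanSpace ℝ (Fin n) [⋀^Fin k]→L[ℝ] ℝ :=
  (β ((extChartAt (𝓡 n) p).symm y)).compContinuousLinearMap
    (mfderiv (𝓡 n) (𝓡 n) (extChartAt (𝓡 n) p).symm y)

/-- `β` is a smooth form. -/
def IsSmoothForm {k : ℕ} (β : FormField n X k) : Prop :=
  ∀ p : X, ContDiffOn ℝ ∞ (formInChart β p) (extChartAt (𝓡 n) p).target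

/-- `dβ = 0`. -/
def IsClosedForm {k : ℕ} (β : FormField n X k) : Prop :=
  ∀ p : X, ∀ y ∈ (extChartAt (𝓡 n) p).target, extDeriv (formInChart β p) y = 0

end Forms

/-! ### Smooth maps between subsets and codimension-zero submanifolds -/

section Maps

variable {E E' H H' A B : Type*} [NormedAddCommGroup E] [NormedSpace ℝ E]
  [NormedAddCommGroup E'] [NormedSpace ℝ E'] [TopologicalSpace H] [TopologicalSpace H']
  [TopologicalSpace A] [ChartedSpace H A] [TopologicalSpace B] [ChartedSpace H' B]

/-- `f` restricts to a diffeomorphism of the subset `V` of `A` onto the subset `T` of `B`: a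
bijection which is smooth on `V` and has an inverse which is smooth on `T`. It is used only for
subsets which are (possibly with boundary) embedded submanifolds; for these, smoothness on the
subset is smoothness on the submanifold. -/
def IsDiffeoOnto (I : ModelWithCorners ℝ E H) (I' : ModelWithCorners ℝ E' H')
    (f : A → B) (V : Set A) (T : Set B) : Prop :=
  MapsTo f V T ∧ ContMDiffOn I I' ∞ f V ∧
    ∃ h : B → A, MapsTo h T V ∧ InvOn h f V T ∧ ContMDiffOn I' I ∞ h T

/-- `f` is a smooth embedding: a smooth map which is a homeomorphism onto its image and has
injective differentials. -/
def IsEmbeddingMap (I : ModelWithCorners ℝ E H) (I' : ModelWithCorners ℝ E' H')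
    (f : A → B) : Prop :=
  ContMDiff I I' ∞ f ∧ IsEmbedding f ∧ ∀ z : A, Function.Injective (mfderiv I I' f z)

/-- `W` is an open subset of the subspace `Y` of `A`. -/
def IsOpenIn (W Y : Set A) : Prop := ∃ O : Set A, IsOpen O ∧ W = O ∩ Y

end Maps

section Ambient

variable {M : Type*} [TopologicalSpace M] [ChartedSpace (EuclideanSpace ℝ (Fin 7)) M]

/-- `T` is a 7-dimensional embedded submanifold with (possibly empty) boundary of the 7-manifold
`M`: near each of its points it is `{y | 0 ≤ y₁}` in a suitable smooth chart of `M`. -/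
def IsDomainWithBoundary (T : Set M) : Prop :=
  ∀ x ∈ T, ∃ e ∈ IsManifold.maximalAtlas (𝓡 7) ∞ M, x ∈ e.source ∧
    ∀ x' ∈ e.source, (x' ∈ T ↔ 0 ≤ (e x') 0)

/-! ### `G₂`-structures -/

/-- `ι` identifies `φ` at `x` with the model form `φ₀`. -/
def IsG2Frame (φ : FormField 7 M 3) (x : M)
    (ι : TangentSpace (𝓡 7) x ≃L[ℝ] EuclideanSpace ℝ (Fin 7)) : Prop :=
  ∀ v : Fin 3 → TangentSpace (𝓡 7) x, φ x v = modelPhi fun a => ι (v a)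

/-- `φ` is a positive 3-form. (The orientation of `M` for which it is positive is the one given by
the frames themselves, the stabilizer `G₂` of `φ₀` being contained in `SO(7)`.) -/
def IsPositiveForm (φ : FormField 7 M 3) : Prop := ∀ x : M, ∃ ι, IsG2Frame φ x ι

open Classical in
/-- A linear isomorphism `ι : T_xM → ℝ⁷` with `φ(x) = ι^* φ₀`, if there is one. -/
def g2Frame (φ : FormField 7 M 3) (x : M) :
    TangentSpace (𝓡 7) x ≃L[ℝ] EuclideanSpace ℝ (Fin 7) :=
  if h : ∃ ι, IsG2Frame φ x ι then h.choose
  else ContinuousLinearEquiv.refl ℝ (EuclideanSpace ℝ (Fin 7))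

/-- The metric `g(φ)` of a positive 3-form, `g(φ)(x) = ι^* g₀`. -/
def g2Metric (φ : FormField 7 M 3) (x : M) (u v : TangentSpace (𝓡 7) x) : ℝ :=
  inner ℝ (g2Frame φ x u) (g2Frame φ x v)

/-- The 4-form `*φ` of a positive 3-form, `*φ(x) = ι^*(*φ₀)`. -/
def g2StarForm (φ : FormField 7 M 3) (x : M) (v : Fin 4 → TangentSpace (𝓡 7) x) : ℝ :=
  modelStarPhi fun a => g2Frame φ x (v a)

/-- `φ` is a closed `G₂`-structure: a smooth closed positive 3-form. -/
structure IsClosedG2Structure (φ : FormField 7 M 3) : Prop where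
  smooth : IsSmoothForm φ
  positive : IsPositiveForm φ
  closed : IsClosedForm φ

/-- The interior product `v ⌟ φ` of a vector `v ∈ T_xM` and a 3-form at `x`. -/
def interiorProduct {x : M} (β : TangentSpace (𝓡 7) x [⋀^Fin 3]→L[ℝ] ℝ)
    (v : TangentSpace (𝓡 7) x) : TangentSpace (𝓡 7) x [⋀^Fin 2]→L[ℝ] ℝ :=
  ContinuousAlternatingMap.curryLeft (E := EuclideanSpace ℝ (Fin 7)) β v

section Contraction

variable {N : Type*} [TopologicalSpace N] [ChartedSpace (EuclideanHalfSpace 4) N]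

/-- A 2-form on `T_zN`, as a bilinear form. -/
def toBilin {z : N} (β : TangentSpace (𝓡∂ 4) z [⋀^Fin 2]→L[ℝ] ℝ) :
    TangentSpace (𝓡∂ 4) z →L[ℝ] TangentSpace (𝓡∂ 4) z →L[ℝ] ℝ :=
  ((ContinuousAlternatingMap.ofSubsingletonLIE (𝕜 := ℝ) (E := EuclideanSpace ℝ (Fin 4)) (F := ℝ)
      (0 : Fin 1)).symm : EuclideanSpace ℝ (Fin 4) [⋀^Fin 1]→L[ℝ] ℝ →L[ℝ]
        EuclideanSpace ℝ (Fin 4) →L[ℝ] ℝ).comp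
    (ContinuousAlternatingMap.curryLeft (E := EuclideanSpace ℝ (Fin 4)) β)

/-- The map `v ↦ (v ⌟ φ)|_{T_zN}`, `T_{i z}M → Λ² T_z^*N`; see `jmath_apply`. -/
def jmath (φ : FormField 7 M 3) (i : N → M) (z : N) (v : TangentSpace (𝓡 7) (i z)) :
    TangentSpace (𝓡∂ 4) z →L[ℝ] TangentSpace (𝓡∂ 4) z →L[ℝ] ℝ :=
  toBilin ((interiorProduct (φ (i z)) v).compContinuousLinearMap (mfderiv (𝓡∂ 4) (𝓡 7) i z))

theorem jmath_apply (φ : FormField 7 M 3) (i : N → M) (z : N) (v : TangentSpace (𝓡 7) (i z))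
    (u w : TangentSpace (𝓡∂ 4) z) :
    jmath φ i z v u w
      = φ (i z) ![v, mfderiv (𝓡∂ 4) (𝓡 7) i z u, mfderiv (𝓡∂ 4) (𝓡 7) i z w] := by
  change φ (i z) (Matrix.vecCons v fun a => mfderiv (𝓡∂ 4) (𝓡 7) i z
    ((Matrix.vecCons u fun _ : Fin 1 => w : Fin 2 → TangentSpace (𝓡∂ 4) z) a)) = _
  congr 1
  ext a
  fin_cases a <;> rfl

end Contraction

/-! ### Metrics, geodesics and the exponential map -/

variable [IsManifold (𝓡 7) ∞ M]

variable (M) in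
/-- Smooth Riemannian metrics on `M`. -/
abbrev Metric7 : Type _ :=
  ContMDiffRiemannianMetric (𝓡 7) ∞ (EuclideanSpace ℝ (Fin 7))
    (fun x : M => TangentSpace (𝓡 7) x)

/-- The coefficient `h(u, v)` of the metric `h` in the preferred chart at `p`, for constant
coordinate vectors `u`, `v`. -/
def metricInChart (h : Metric7 M) (p : M) (u v y : EuclideanSpace ℝ (Fin 7)) : ℝ :=
  h.inner ((extChartAt (𝓡 7) p).symm y)
    (mfderiv (𝓡 7) (𝓡 7) (extChartAt (𝓡 7) p).symm y u)
    (mfderiv (𝓡 7) (𝓡 7) (extChartAt (𝓡 7) p).symm y v)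

/-- The Christoffel symbol of the first kind
`Γ(u, v; w) = ½ (∂_u h(v, w) + ∂_v h(u, w) - ∂_w h(u, v))` in the preferred chart at `p`. -/
def christoffel (h : Metric7 M) (p : M) (u v w y : EuclideanSpace ℝ (Fin 7)) : ℝ :=
  (fderiv ℝ (metricInChart h p v w) y u + fderiv ℝ (metricInChart h p u w) y v
    - fderiv ℝ (metricInChart h p u v) y w) / 2

/-- `γ` is a geodesic of `h` on the open set `J` of times: it is smooth there, and in charts
`h(γ'', w) + Γ(γ', γ'; w) = 0` for all `w`. -/
def IsGeodesicOn (h : Metric7 M) (γ : ℝ → M) (J : Set ℝ) : Prop :=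
  ContMDiffOn 𝓘(ℝ, ℝ) (𝓡 7) ∞ γ J ∧
    ∀ t ∈ J, ∀ p : M, γ t ∈ (chartAt (EuclideanSpace ℝ (Fin 7)) p).source →
      ∀ w : EuclideanSpace ℝ (Fin 7),
        metricInChart h p (deriv (deriv fun s => extChartAt (𝓡 7) p (γ s)) t) w
            (extChartAt (𝓡 7) p (γ t))
          + christoffel h p (deriv (fun s => extChartAt (𝓡 7) p (γ s)) t)
              (deriv (fun s => extChartAt (𝓡 7) p (γ s)) t) w (extChartAt (𝓡 7) p (γ t)) = 0

/-- The velocity vector of a curve, as a point of the tangent bundle. -/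
def velocity (γ : ℝ → M) (t : ℝ) : TangentBundle (𝓡 7) M :=
  ⟨γ t, mfderiv 𝓘(ℝ, ℝ) (𝓡 7) γ t (1 : ℝ)⟩

/-- `γ` is a geodesic on an open interval around `[0, 1]` with initial velocity `p`. -/
def IsExpCurve (h : Metric7 M) (p : TangentBundle (𝓡 7) M) (γ : ℝ → M) : Prop :=
  (∃ δ : ℝ, 0 < δ ∧ IsGeodesicOn h γ (Ioo (-δ) (1 + δ))) ∧ velocity γ 0 = p

/-- The domain of the exponential map of `h`. -/
def expDomain (h : Metric7 M) : Set (TangentBundle (𝓡 7) M) := {p | ∃ γ, IsExpCurve h p γ}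

open Classical in
/-- The exponential map of `h` (a meaningless value outside `expDomain h`). -/
def expMap (h : Metric7 M) (p : TangentBundle (𝓡 7) M) : M :=
  if H : ∃ γ, IsExpCurve h p γ then H.choose 1 else p.1

/-! ### Hypersurfaces: unit normals, symplectic submanifolds, tubular neighbourhoods -/

section Hypersurface

variable {S : Type*} [TopologicalSpace S] [ChartedSpace (EuclideanSpace ℝ (Fin 6)) S]

/-- `n : T_{j y}M` is a unit normal vector to the hypersurface `j : S → M` at `y`, with respect
to `g(φ)`. -/
def IsUnitNormalAt (φ : FormField 7 M 3) (j : S → M) (y : S) (n : TangentSpace (𝓡 7) (j y)) :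
    Prop :=
  g2Metric φ (j y) n n = 1 ∧
    ∀ w : TangentSpace (𝓡 6) y, g2Metric φ (j y) n (mfderiv (𝓡 6) (𝓡 7) j y w) = 0

/-- The 2-form `ω₀ = (n ⌟ φ)|_S`. -/
def hypersurfaceForm (φ : FormField 7 M 3) (j : S → M) (n : ∀ y : S, TangentSpace (𝓡 7) (j y)) :
    FormField 6 S 2 :=
  fun y => (interiorProduct (φ (j y)) (n y)).compContinuousLinearMap (mfderiv (𝓡 6) (𝓡 7) j y)

/-- The hypersurface `j : S → M` is orientable and symplectic: there is a smooth unit normal field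
`n` along `S` (this is orientability, `M` being oriented) and `ω₀ = (n ⌟ φ)|_S` is closed.
Closedness does not depend on the choice of `n`, which is unique up to a locally constant sign. -/
def IsSymplecticHypersurface (φ : FormField 7 M 3) (j : S → M) : Prop :=
  ∃ n : ∀ y : S, TangentSpace (𝓡 7) (j y),
    ContMDiff (𝓡 6) (𝓡 7).tangent ∞ (fun y => (⟨j y, n y⟩ : TangentBundle (𝓡 7) M)) ∧
    (∀ y, IsUnitNormalAt φ j y (n y)) ∧
    IsClosedForm (hypersurfaceForm φ j n)

/-- `T` is a tubular neighbourhood of the hypersurface `j : S → M`: an open set which is the image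
of a diffeomorphism `η : S × (-ε, ε) → T` with `η(y, 0) = y` and with `∂η/∂s` at `s = 0` a unit
normal vector to `S`. -/
def IsTubularNeighbourhood (φ : FormField 7 M 3) (j : S → M) (T : Set M) : Prop :=
  IsOpen T ∧ ∃ ε : ℝ, 0 < ε ∧ ∃ η : S × ℝ → M,
    IsDiffeoOnto ((𝓡 6).prod 𝓘(ℝ, ℝ)) (𝓡 7) η (univ ×ˢ Ioo (-ε) ε) T ∧
    ∀ y : S, η (y, 0) = j y ∧ ∃ n : TangentSpace (𝓡 7) (j y), IsUnitNormalAt φ j y n ∧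
      velocity (fun s : ℝ => η (y, s)) 0 = ⟨j y, n⟩

/-- The hypersurface `j : S → M` is totally geodesic for `h`: every geodesic which is tangent to
`S` at some time stays in `S` for some time. -/
def IsTotallyGeodesic (h : Metric7 M) (j : S → M) : Prop :=
  ∀ (γ : ℝ → M) (δ : ℝ), 0 < δ → IsGeodesicOn h γ (Ioo (-δ) δ) →
    velocity γ 0 ∈ range (tangentMap (𝓡 6) (𝓡 7) j) → ∀ᶠ t in 𝓝 (0 : ℝ), γ t ∈ range j

end Hypersurface

/-! ### Coassociative 4-folds with boundary -/

section FourFold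

variable {N : Type*} [TopologicalSpace N] [ChartedSpace (EuclideanHalfSpace 4) N]

/-- The 4-fold `i : N → M` is coassociative: `φ|_N = 0`. -/
def IsCoassociative (φ : FormField 7 M 3) (i : N → M) : Prop :=
  ∀ z : N, (φ (i z)).compContinuousLinearMap (mfderiv (𝓡∂ 4) (𝓡 7) i z) = 0

/-- `n ∈ T_zN` is the inward-pointing unit normal to `∂N` at the boundary point `z`. In the
preferred chart at `z`, with values in `{x | 0 ≤ x₁}`, the vectors tangent to `∂N` are those with
first coordinate zero and the inward-pointing ones are those with positive first coordinate. -/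
def IsInwardNormal (φ : FormField 7 M 3) (i : N → M) (z : N)
    (n : TangentSpace (𝓡∂ 4) z) : Prop :=
  0 < (show EuclideanSpace ℝ (Fin 4) from n) 0 ∧
    g2Metric φ (i z) (mfderiv (𝓡∂ 4) (𝓡 7) i z n) (mfderiv (𝓡∂ 4) (𝓡 7) i z n) = 1 ∧
    ∀ w : TangentSpace (𝓡∂ 4) z, (show EuclideanSpace ℝ (Fin 4) from w) 0 = 0 →
      g2Metric φ (i z) (mfderiv (𝓡∂ 4) (𝓡 7) i z n) (mfderiv (𝓡∂ 4) (𝓡 7) i z w) = 0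

/-- `S` is a scaffold for `N`: `∂N ⊆ S`, the inward unit normal `n` of `∂N` in `N` is normal to
`S`, and `S` is an (orientable) symplectic submanifold. -/
structure IsScaffold {S : Type*} [TopologicalSpace S] [ChartedSpace (EuclideanSpace ℝ (Fin 6)) S]
    (φ : FormField 7 M 3) (i : N → M) (j : S → M) : Prop where
  boundary_subset : ∀ z ∈ (𝓡∂ 4).boundary N, i z ∈ range j
  normal : ∀ z ∈ (𝓡∂ 4).boundary N, ∀ n : TangentSpace (𝓡∂ 4) z, IsInwardNormal φ i z n →
    ∀ w : TangentSpace (𝓡 7) (i z),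
      (⟨i z, w⟩ : TangentBundle (𝓡 7) M) ∈ range (tangentMap (𝓡 6) (𝓡 7) j) →
      g2Metric φ (i z) (mfderiv (𝓡∂ 4) (𝓡 7) i z n) w = 0
  symplectic : IsSymplecticHypersurface φ j

/-- The fibre at `z` of the `h`-normal bundle of `N` in `M`. -/
def normalSpace (h : Metric7 M) (i : N → M) (z : N) : Set (TangentSpace (𝓡 7) (i z)) :=
  {v | ∀ u : TangentSpace (𝓡∂ 4) z, h.inner (i z) v (mfderiv (𝓡∂ 4) (𝓡 7) i z u) = 0}

/-- The `h`-normal bundle of `N` in `M`, as a subspace of the tangent bundle of `M` (`i` being an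
embedding). -/
def normalBundle (h : Metric7 M) (i : N → M) : Set (TangentBundle (𝓡 7) M) :=
  {p | ∃ z : N, ∃ v ∈ normalSpace h i z, p = ⟨i z, v⟩}

variable [IsManifold (𝓡∂ 4) ∞ N]

variable (N) in
/-- The bundle of bilinear forms on the tangent spaces of `N`. -/
abbrev BilinBundle : Type _ :=
  TotalSpace (EuclideanSpace ℝ (Fin 4) →L[ℝ] EuclideanSpace ℝ (Fin 4) →L[ℝ] ℝ)
    (fun z : N => TangentSpace (𝓡∂ 4) z →L[ℝ] TangentSpace (𝓡∂ 4) z →L[ℝ] ℝ)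

/-- The model with corners of `BilinBundle N`. -/
abbrev bilinModel := (𝓡∂ 4).prod
  𝓘(ℝ, EuclideanSpace ℝ (Fin 4) →L[ℝ] EuclideanSpace ℝ (Fin 4) →L[ℝ] ℝ)

/-- `(e₁, …, e₄)` is an orthonormal basis of `T_zN` for `g(φ)`, positive for the orientation of
`N` given by `*φ|_N`. -/
def IsOrientedOrthonormal (φ : FormField 7 M 3) (i : N → M) (z : N)
    (e : Fin 4 → TangentSpace (𝓡∂ 4) z) : Prop :=
  (∀ a b, g2Metric φ (i z) (mfderiv (𝓡∂ 4) (𝓡 7) i z (e a)) (mfderiv (𝓡∂ 4) (𝓡 7) i z (e b))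
      = if a = b then 1 else 0) ∧
    0 < g2StarForm φ (i z) fun a => mfderiv (𝓡∂ 4) (𝓡 7) i z (e a)

/-- The fibre `Λ²₊ T_z^*N` of the bundle of self-dual 2-forms, for the metric `g(φ)|_N` and the
orientation `*φ|_N`: alternating bilinear forms `α` with `*α = α`. As
`(*α)(e₁, e₂) = α(e₃, e₄)` for each positive orthonormal basis, this means
`α(e₁, e₂) = α(e₃, e₄)` for all positive orthonormal bases. -/
def selfDualSpace (φ : FormField 7 M 3) (i : N → M) (z : N) :
    Set (TangentSpace (𝓡∂ 4) z →L[ℝ] TangentSpace (𝓡∂ 4) z →L[ℝ] ℝ) :=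
  {α | (∀ u, α u u = 0) ∧
    ∀ e : Fin 4 → TangentSpace (𝓡∂ 4) z, IsOrientedOrthonormal φ i z e →
      α (e 0) (e 1) = α (e 2) (e 3)}

/-- The bundle `Λ²₊ T^*N` of self-dual 2-forms, as a subspace of the bundle of bilinear forms. -/
def selfDualBundle (φ : FormField 7 M 3) (i : N → M) : Set (BilinBundle N) :=
  {q | q.2 ∈ selfDualSpace φ i q.1}

/-- The image under `jmath` of a subset of the normal bundle of `N`. -/
def jmathImage (φ : FormField 7 M 3) (i : N → M) (V : Set (TangentBundle (𝓡 7) M)) :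
    Set (BilinBundle N) :=
  {q | ∃ v : TangentSpace (𝓡 7) (i q.1),
    (⟨i q.1, v⟩ : TangentBundle (𝓡 7) M) ∈ V ∧ q.2 = jmath φ i q.1 v}

end FourFold

end Ambient

end Coassoc

end

/-!
The statement rests on a metric for which the reflection in `S` is a local isometry.

*The metric.* The metric `g = g(φ)` is smooth, because up to explicit factors
`det (u ⌟ φ + u♭ ⊗ u♭)` computes powers of `g(u, u)` and of the volume
(`det_contraction_add_sq`, `contDiffOn_inner_of_pullback`). The normal exponential map of `g` along
`S`, reparametrized on the fibres, gives a tubular neighbourhood `T_S`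
(`exists_isTubularNeighbourhood`), and `η (y, s) ↦ η (y, -s)` is an involution `R` of `T_S` with
fixed point set `S`. The metric `ĝ` is the average of `g` and `R^*g` near `S`, interpolated to `g`
away from `S`. Since `R` maps the unit normal of `S` to its negative, `ĝ = g` along `S`, and near
`S` the map `R` is an isometry of `ĝ`. A `ĝ`-geodesic whose velocity is tangent to `S` at one time
has the same initial data as its reflection, so it is fixed by `R` and stays in `S`
(`IsReflection.geodesic_mem_range`). Thus `S` is totally geodesic. At a boundary point of `N` the
inward unit normal is normal to `S`; a vector that is `ĝ`-normal to `N` is orthogonal to it and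
hence tangent to `S`, so that the exponential map carries it into `S`
(`exists_metric_of_isScaffold`).

*Geodesics.* Solutions of an autonomous differential equation near an equilibrium are obtained from
the inverse function theorem in a space of continuous curves (`exists_flow_of_contDiff`). The
inverse function theorem also gives their smooth dependence on the initial value. The linearization
of the geodesic field at zero velocity squares to zero, so the derivative of the time-one map is
explicit, and the exponential map restricts to local diffeomorphisms on normal bundles.

*The normal exponential map of `N`.* Near each point, including boundary points, the normal bundle
of `N` is parametrized by a half space times `ℝ³`, and the parametrization extends across the
boundary to an open set on which the exponential map is a local diffeomorphism
(`exists_normalBundle_chart`). Compactness of `N` makes the exponential map injective near the zero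
section (`exists_domain_of_local`), so a neighbourhood of the zero section in the normal bundle is
mapped diffeomorphically onto a domain with boundary (`exists_normal_domain`).

*Self-dual forms.* The kernel of the contraction map `v ↦ (v ⌟ φ)|_N` on `T_zM` is `T_zN`, and its
image is the space of self-dual forms. This follows from identities for the cross product on
coassociative 4-planes, where `f₀ × f₁ = f₂ × f₃` for positive orthonormal frames. Hence the map is
bijective on any complement of `T_zN`, in particular on the `ĝ`-normal space (`bijOn_jmath`). The
contraction and its inverse depend smoothly on all data (`contMDiffOn_contraction`,
`contMDiffOn_normalLift`), so that `δ_N` is a diffeomorphism. A section composed with `δ_N` is an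
embedding, since the inverse of `δ_N` followed by the bundle projection is a smooth left inverse.
-/

set_option linter.unusedSectionVars false
set_option synthInstance.maxHeartbeats 200000

namespace Coassoc

local notation "ℝ⁷" => EuclideanSpace ℝ (Fin 7)

/-! ### Linear algebra of the model form -/

/-- The cross product on `ℝ⁷` determined by `φ₀(u, v, w) = ⟨u × v, w⟩`. -/
noncomputable def cross7 (u v : ℝ⁷) : ℝ⁷ :=
  !₂[(u 1 * v 2 - u 2 * v 1) + (u 3 * v 4 - u 4 * v 3) + (u 5 * v 6 - u 6 * v 5),
    (u 2 * v 0 - u 0 * v 2) + (u 3 * v 5 - u 5 * v 3) - (u 4 * v 6 - u 6 * v 4),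
    (u 0 * v 1 - u 1 * v 0) - (u 3 * v 6 - u 6 * v 3) - (u 4 * v 5 - u 5 * v 4),
    (u 4 * v 0 - u 0 * v 4) + (u 5 * v 1 - u 1 * v 5) - (u 6 * v 2 - u 2 * v 6),
    (u 0 * v 3 - u 3 * v 0) - (u 6 * v 1 - u 1 * v 6) - (u 5 * v 2 - u 2 * v 5),
    (u 6 * v 0 - u 0 * v 6) + (u 1 * v 3 - u 3 * v 1) - (u 2 * v 4 - u 4 * v 2),
    (u 0 * v 5 - u 5 * v 0) - (u 1 * v 4 - u 4 * v 1) - (u 2 * v 3 - u 3 * v 2)]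

theorem inner7 (u v : ℝ⁷) : inner ℝ u v = u 0 * v 0 + u 1 * v 1 + u 2 * v 2 + u 3 * v 3
    + u 4 * v 4 + u 5 * v 5 + u 6 * v 6 := by
  simp [PiLp.inner_apply, Fin.sum_univ_seven, mul_comm]

theorem elemForm_three (s : Fin 3 → Fin 7) (u v w : ℝ⁷) :
    elemForm s ![u, v, w] = u (s 0) * (v (s 1) * w (s 2) - v (s 2) * w (s 1))
      - u (s 1) * (v (s 0) * w (s 2) - v (s 2) * w (s 0))
      + u (s 2) * (v (s 0) * w (s 1) - v (s 1) * w (s 0)) := by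
  simp [elemForm, Matrix.det_fin_three]
  ring

theorem elemForm_four (s : Fin 4 → Fin 7) (a b c d : ℝ⁷) :
    elemForm s ![a, b, c, d] =
      (a (s 0) * b (s 1) - a (s 1) * b (s 0)) * (c (s 2) * d (s 3) - c (s 3) * d (s 2))
      - (a (s 0) * b (s 2) - a (s 2) * b (s 0)) * (c (s 1) * d (s 3) - c (s 3) * d (s 1))
      + (a (s 0) * b (s 3) - a (s 3) * b (s 0)) * (c (s 1) * d (s 2) - c (s 2) * d (s 1))
      + (a (s 1) * b (s 2) - a (s 2) * b (s 1)) * (c (s 0) * d (s 3) - c (s 3) * d (s 0))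
      - (a (s 1) * b (s 3) - a (s 3) * b (s 1)) * (c (s 0) * d (s 2) - c (s 2) * d (s 0))
      + (a (s 2) * b (s 3) - a (s 3) * b (s 2)) * (c (s 0) * d (s 1) - c (s 1) * d (s 0)) := by
  simp [elemForm, Matrix.det_succ_row_zero, Fin.sum_univ_four, Fin.sum_univ_three, Fin.succAbove,
    Matrix.submatrix]
  ring

theorem modelPhi_eq_inner_cross (u v w : ℝ⁷) :
    modelPhi ![u, v, w] = inner ℝ (cross7 u v) w := by
  simp only [modelPhi, elemForm_three, inner7, cross7]
  simp
  ring

/-- The inner product of two cross products is measured by the metric and by `*φ₀`. -/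
theorem inner_cross_cross (a b c d : ℝ⁷) :
    inner ℝ (cross7 a b) (cross7 c d)
      = inner ℝ a c * inner ℝ b d - inner ℝ a d * inner ℝ b c + modelStarPhi ![a, b, c, d] := by
  simp only [modelStarPhi, elemForm_four, inner7, cross7]
  simp
  ring

theorem inner_cross_cross_left (a b d : ℝ⁷) :
    inner ℝ (cross7 a b) (cross7 a d) = inner ℝ a a * inner ℝ b d - inner ℝ a d * inner ℝ b a := by
  simp only [inner7, cross7]
  simp
  ring

theorem cross7_swap (u v : ℝ⁷) : cross7 v u = - cross7 u v := by
  ext i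
  fin_cases i <;> simp [cross7] <;> ring

theorem cross7_self_left (u v : ℝ⁷) : inner ℝ (cross7 u v) u = 0 := by
  simp only [inner7, cross7]
  simp
  ring

theorem inner_cross_swap (u v w : ℝ⁷) : inner ℝ (cross7 u v) w = - inner ℝ (cross7 u w) v := by
  simp only [inner7, cross7]
  simp
  ring

theorem inner_cross_rotate (u v w : ℝ⁷) : inner ℝ (cross7 u v) w = inner ℝ (cross7 v w) u := by
  simp only [inner7, cross7]
  simp
  ring

/-! ### Recovering the metric from the 3-form -/

/-- The matrix of the 2-form `a ⌟ φ₀`. -/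
noncomputable def contractionMatrix (a : ℝ⁷) : Matrix (Fin 7) (Fin 7) ℝ :=
  Matrix.of fun i j => inner ℝ (cross7 a (EuclideanSpace.single i 1)) (EuclideanSpace.single j 1)

theorem contractionMatrix_transpose (a : ℝ⁷) :
    (contractionMatrix a).transpose = - contractionMatrix a := by
  ext i j
  simp only [contractionMatrix, Matrix.transpose_apply, Matrix.of_apply, Matrix.neg_apply]
  rw [inner_cross_swap]

theorem contractionMatrix_mul_self (a : ℝ⁷) :
    contractionMatrix a * contractionMatrix a
      = Matrix.vecMulVec a.ofLp a.ofLp - (inner ℝ a a : ℝ) • (1 : Matrix (Fin 7) (Fin 7) ℝ) := by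
  ext i k
  have h : ∀ j, contractionMatrix a j k = - (cross7 a (EuclideanSpace.single k 1)) j := by
    intro j
    simp only [contractionMatrix, Matrix.of_apply]
    rw [inner_cross_swap]
    simp [EuclideanSpace.inner_single_right]
  have h' : ∀ j, contractionMatrix a i j = (cross7 a (EuclideanSpace.single i 1)) j := by
    intro j
    simp [contractionMatrix, EuclideanSpace.inner_single_right]
  have e := inner_cross_cross_left a (EuclideanSpace.single i 1) (EuclideanSpace.single k 1)
  rw [Matrix.mul_apply]
  simp only [h, h', mul_neg, Finset.sum_neg_distrib]
  have : ∑ j, (cross7 a (EuclideanSpace.single i 1)) j * (cross7 a (EuclideanSpace.single k 1)) j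
    = inner ℝ (cross7 a (EuclideanSpace.single i 1)) (cross7 a (EuclideanSpace.single k 1)) := by
    simp [PiLp.inner_apply, mul_comm]
  rw [this, e]
  simp only [EuclideanSpace.inner_single_right, EuclideanSpace.inner_single_left]
  simp [Matrix.vecMulVec_apply, Matrix.one_apply, eq_comm]
  ring

theorem contractionMatrix_mulVec_self (a : ℝ⁷) : (contractionMatrix a).mulVec a.ofLp = 0 := by
  ext i
  have e := cross7_self_left a (EuclideanSpace.single i 1)
  simp only [Matrix.mulVec, dotProduct, Pi.zero_apply]
  rw [← e]
  simp [contractionMatrix, PiLp.inner_apply, mul_comm]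

theorem vecMul_contractionMatrix_self (a : ℝ⁷) :
    Matrix.vecMul a.ofLp (contractionMatrix a) = 0 := by
  rw [← Matrix.mulVec_transpose, contractionMatrix_transpose, Matrix.neg_mulVec,
    contractionMatrix_mulVec_self, neg_zero]

theorem dotProduct_self_eq_inner (a b : ℝ⁷) : a.ofLp ⬝ᵥ b.ofLp = inner ℝ a b := by
  simp [dotProduct, PiLp.inner_apply, mul_comm]

theorem det_smul_one_add_vecMulVec (r s : ℝ) (hr : r ≠ 0) (a b : Fin 7 → ℝ) :
    (r • (1 : Matrix (Fin 7) (Fin 7) ℝ) + s • Matrix.vecMulVec a b).det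
      = r ^ 7 * (1 + s / r * (b ⬝ᵥ a)) := by
  have : r • (1 : Matrix (Fin 7) (Fin 7) ℝ) + s • Matrix.vecMulVec a b
      = r • (1 + Matrix.vecMulVec ((s / r) • a) b) := by
    rw [Matrix.smul_vecMulVec, smul_add, smul_smul, mul_div_cancel₀ _ hr]
  rw [this, Matrix.det_smul, Fintype.card_fin, Matrix.vecMulVec_eq (Fin 1),
    Matrix.det_one_add_replicateCol_mul_replicateRow]
  simp [dotProduct_smul]

/-- The square of the determinant of `a ⌟ φ₀` plus the rank-one form `(l a)²`. -/
theorem det_contraction_add_self_sq (a : ℝ⁷) (ha : a ≠ 0) (l : ℝ) :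
    (contractionMatrix a + Matrix.vecMulVec (l • a.ofLp) (l • a.ofLp)).det ^ 2
      = l ^ 4 * (inner ℝ a a : ℝ) ^ 8 := by
  have hr : (inner ℝ a a : ℝ) ≠ 0 := by simpa using ha
  set V := Matrix.vecMulVec (l • a.ofLp) (l • a.ofLp) with hV
  have hVt : V.transpose = V := by ext i j; simp [hV, Matrix.vecMulVec_apply, mul_comm]
  have h1 : (contractionMatrix a + V).det ^ 2
      = ((contractionMatrix a + V) * (- contractionMatrix a + V)).det := by
    rw [Matrix.det_mul, sq]
    congr 1
    rw [← Matrix.det_transpose, Matrix.transpose_add, contractionMatrix_transpose, hVt]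
  have hMV : contractionMatrix a * V = 0 := by
    rw [hV, Matrix.mul_vecMulVec, Matrix.mulVec_smul, contractionMatrix_mulVec_self]
    simp
  have hVM : V * contractionMatrix a = 0 := by
    rw [hV, Matrix.vecMulVec_mul, Matrix.smul_vecMul, vecMul_contractionMatrix_self]
    simp
  have hVV : V * V = (l ^ 4 * inner ℝ a a : ℝ) • Matrix.vecMulVec a.ofLp a.ofLp := by
    rw [hV, Matrix.vecMulVec_mul_vecMulVec, smul_dotProduct, dotProduct_smul,
      dotProduct_self_eq_inner]
    ext i j
    simp [Matrix.vecMulVec_apply]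
    ring
  have h2 : (contractionMatrix a + V) * (- contractionMatrix a + V)
      = (inner ℝ a a : ℝ) • (1 : Matrix (Fin 7) (Fin 7) ℝ)
        + (l ^ 4 * inner ℝ a a - 1 : ℝ) • Matrix.vecMulVec a.ofLp a.ofLp := by
    rw [add_mul, mul_add, mul_add, mul_neg, mul_neg, hMV, hVM, hVV, contractionMatrix_mul_self,
      sub_smul, one_smul]
    abel
  rw [h1, h2, det_smul_one_add_vecMulVec _ _ hr, dotProduct_self_eq_inner]
  field_simp
  ring

/-- The square of the determinant of `a ⌟ φ₀ + η ⊗ η`: the square root of this expression is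
the density-valued quadratic form from which the metric is recovered. -/
theorem det_contraction_add_sq (a : ℝ⁷) (ha : a ≠ 0) (η : ℝ⁷) :
    (contractionMatrix a + Matrix.vecMulVec η.ofLp η.ofLp).det ^ 2
      = (inner ℝ η a : ℝ) ^ 4 * (inner ℝ a a : ℝ) ^ 4 := by
  have hr : (inner ℝ a a : ℝ) ≠ 0 := by simpa using ha
  by_cases hη : (inner ℝ η a : ℝ) = 0
  · have : (contractionMatrix a + Matrix.vecMulVec η.ofLp η.ofLp).mulVec a.ofLp = 0 := by
      rw [Matrix.add_mulVec, contractionMatrix_mulVec_self, Matrix.vecMulVec_mulVec,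
        dotProduct_self_eq_inner, hη]
      simp
    have hdet := Matrix.exists_mulVec_eq_zero_iff.1 ⟨a.ofLp, by simpa using ha, this⟩
    rw [hdet, hη]; ring
  · set l := (inner ℝ η a : ℝ) / inner ℝ a a with hl
    have hl0 : l ≠ 0 := div_ne_zero hη hr
    -- a shear fixing `a ⌟ φ₀` turns `η` into the multiple `l a` of `a`
    set c : ℝ⁷ := (l * inner ℝ a a)⁻¹ • (η - l • a) with hc
    have hca : (inner ℝ c a : ℝ) = 0 := by
      rw [hc, inner_smul_left, inner_sub_left, inner_smul_left, RCLike.conj_to_real,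
        RCLike.conj_to_real, hl, div_mul_cancel₀ _ hr, sub_self, mul_zero]
    set U : Matrix (Fin 7) (Fin 7) ℝ := 1 + Matrix.vecMulVec a.ofLp c.ofLp with hU
    have hUdet : U.det = 1 := by
      rw [hU, Matrix.vecMulVec_eq (Fin 1), Matrix.det_one_add_replicateCol_mul_replicateRow,
        dotProduct_self_eq_inner, hca, add_zero]
    have hUt : U.transpose = 1 + Matrix.vecMulVec c.ofLp a.ofLp := by
      ext i j; simp [hU, Matrix.vecMulVec_apply, Matrix.one_apply, mul_comm, eq_comm]
    have hlη : l • (a.ofLp + (inner ℝ a a : ℝ) • c.ofLp) = η.ofLp := by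
      have : l • (a + (inner ℝ a a : ℝ) • c) = η := by
        rw [hc, smul_add, smul_smul, smul_smul, mul_inv_cancel₀ (mul_ne_zero hl0 hr), one_smul]
        abel
      rw [← this]; rfl
    have key : U.transpose * (contractionMatrix a + Matrix.vecMulVec (l • a.ofLp) (l • a.ofLp)) * U
        = contractionMatrix a + Matrix.vecMulVec η.ofLp η.ofLp := by
      have e1 : U.transpose * contractionMatrix a * U = contractionMatrix a := by
        rw [hUt, hU, add_mul, one_mul, Matrix.vecMulVec_mul, vecMul_contractionMatrix_self,
          Matrix.vecMulVec_zero, add_zero, mul_add, mul_one, Matrix.mul_vecMulVec,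
          contractionMatrix_mulVec_self, Matrix.zero_vecMulVec, add_zero]
      have e2 : U.transpose * Matrix.vecMulVec (l • a.ofLp) (l • a.ofLp) * U
          = Matrix.vecMulVec η.ofLp η.ofLp := by
        have w1 : U.transpose.mulVec (l • a.ofLp) = η.ofLp := by
          rw [hUt, Matrix.add_mulVec, Matrix.one_mulVec, Matrix.vecMulVec_mulVec, dotProduct_smul,
            dotProduct_self_eq_inner, ← hlη]
          ext i; simp; ring
        have w2 : Matrix.vecMul (l • a.ofLp) U = η.ofLp := by
          rw [← Matrix.mulVec_transpose, w1]
        rw [Matrix.mul_vecMulVec, Matrix.vecMulVec_mul, w1, w2]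
      rw [Matrix.mul_add U.transpose, Matrix.add_mul, e1, e2]
    rw [← key, Matrix.det_mul, Matrix.det_mul, Matrix.det_transpose, hUdet, one_mul, mul_one,
      det_contraction_add_self_sq a ha, hl]
    field_simp

/-! ### Coassociative subspaces -/

/-- `f` is an orthonormal family spanning a 4-plane on which `φ₀` vanishes. -/
structure IsCoassociativeFrame (f : Fin 4 → ℝ⁷) : Prop where
  orthonormal : Orthonormal ℝ f
  vanish : ∀ a b c, inner ℝ (cross7 (f a) (f b)) (f c) = 0

theorem IsCoassociativeFrame.inner_eq {f : Fin 4 → ℝ⁷} (h : IsCoassociativeFrame f) (a b : Fin 4) :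
    inner ℝ (f a) (f b) = if a = b then (1 : ℝ) else 0 :=
  (orthonormal_iff_ite.1 h.orthonormal) a b

/-- The vectors `f₀ × f₁, f₀ × f₂, f₀ × f₃` complete a coassociative frame to an orthonormal basis
of `ℝ⁷`. -/
theorem IsCoassociativeFrame.orthonormal_sum {f : Fin 4 → ℝ⁷} (h : IsCoassociativeFrame f) :
    Orthonormal ℝ (Sum.elim f (fun k : Fin 3 => cross7 (f 0) (f k.succ))) := by
  rw [orthonormal_iff_ite]
  rintro (a | a) (b | b)
  · simp [h.inner_eq]
  · rw [real_inner_comm]; simp [h.vanish]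
  · simp [h.vanish]
  · simp only [Sum.elim_inr, inner_cross_cross_left, h.inner_eq]
    simp [Fin.succ_ne_zero, (Fin.succ_ne_zero _).symm]

theorem IsCoassociativeFrame.eq_sum {f : Fin 4 → ℝ⁷} (h : IsCoassociativeFrame f) (v : ℝ⁷) :
    v = ∑ a, (inner ℝ (f a) v : ℝ) • f a
      + ∑ k : Fin 3, (inner ℝ (cross7 (f 0) (f k.succ)) v : ℝ) • cross7 (f 0) (f k.succ) := by
  have hspan : ⊤ ≤ Submodule.span ℝ
      (Set.range (Sum.elim f (fun k : Fin 3 => cross7 (f 0) (f k.succ)))) := by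
    rw [LinearIndependent.span_eq_top_of_card_eq_finrank' h.orthonormal_sum.linearIndependent]
    simp
  have := (OrthonormalBasis.mk h.orthonormal_sum hspan).sum_repr' v
  rw [Fintype.sum_sum_type] at this
  simpa using this.symm

/-- For a coassociative frame, `f₂ × f₃ = ± f₀ × f₁`, and the sign is the orientation of the frame
with respect to `*φ₀`. -/
theorem IsCoassociativeFrame.cross_two_three {f : Fin 4 → ℝ⁷} (h : IsCoassociativeFrame f) :
    cross7 (f 2) (f 3) = modelStarPhi f • cross7 (f 0) (f 1) ∧ modelStarPhi f ^ 2 = 1 := by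
  have hf : f = ![f 0, f 1, f 2, f 3] := by ext a; fin_cases a <;> rfl
  have h1 : inner ℝ (cross7 (f 0) (f 1)) (cross7 (f 2) (f 3)) = modelStarPhi f := by
    rw [inner_cross_cross, ← hf]; simp [h.inner_eq]
  have h2 : inner ℝ (cross7 (f 0) (f 2)) (cross7 (f 2) (f 3)) = (0 : ℝ) := by
    rw [cross7_swap, inner_neg_left, inner_cross_cross_left]; simp [h.inner_eq]
  have h3 : inner ℝ (cross7 (f 0) (f 3)) (cross7 (f 2) (f 3)) = (0 : ℝ) := by
    rw [cross7_swap, cross7_swap (f 3) (f 2), inner_neg_left, inner_neg_right,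
      inner_cross_cross_left]
    simp [h.inner_eq]
  have e : cross7 (f 2) (f 3) = modelStarPhi f • cross7 (f 0) (f 1) := by
    have := h.eq_sum (cross7 (f 2) (f 3))
    rw [this, Fin.sum_univ_four, Fin.sum_univ_three]
    have hv : ∀ a, inner ℝ (f a) (cross7 (f 2) (f 3)) = (0 : ℝ) := fun a => by
      rw [real_inner_comm]; exact h.vanish _ _ _
    rw [hv, hv, hv, hv]
    change _ + ((inner ℝ (cross7 (f 0) (f 1)) _ : ℝ) • cross7 (f 0) (f 1)
      + (inner ℝ (cross7 (f 0) (f 2)) _ : ℝ) • cross7 (f 0) (f 2)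
      + (inner ℝ (cross7 (f 0) (f 3)) _ : ℝ) • cross7 (f 0) (f 3)) = _
    rw [h1, h2, h3]
    simp
  refine ⟨e, ?_⟩
  have n1 : inner ℝ (cross7 (f 2) (f 3)) (cross7 (f 2) (f 3)) = (1 : ℝ) := by
    rw [inner_cross_cross_left]; simp only [h.inner_eq]; simp
  have n2 : inner ℝ (cross7 (f 0) (f 1)) (cross7 (f 0) (f 1)) = (1 : ℝ) := by
    rw [inner_cross_cross_left]; simp only [h.inner_eq]; simp
  rw [e, inner_smul_left, inner_smul_right, n2] at n1
  simpa [sq] using n1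

/-- On a positive coassociative frame `f₀ × f₁ = f₂ × f₃`: contractions of `φ₀` restrict to
self-dual forms. -/
theorem IsCoassociativeFrame.cross_eq {f : Fin 4 → ℝ⁷} (h : IsCoassociativeFrame f)
    (hpos : 0 < modelStarPhi f) : cross7 (f 0) (f 1) = cross7 (f 2) (f 3) := by
  obtain ⟨h1, h2⟩ := h.cross_two_three
  have : modelStarPhi f = 1 := by nlinarith
  rw [h1, this, one_smul]

local notation "ℝ⁴" => EuclideanSpace ℝ (Fin 4)

section Plane

variable {T : ℝ⁴ →L[ℝ] ℝ⁷}

/-- `e` is an orthonormal basis of `ℝ⁴` for the metric pulled back by `T`, positive for the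
pullback of `*φ₀`. -/
def IsPositiveFrame (T : ℝ⁴ →L[ℝ] ℝ⁷) (e : Fin 4 → ℝ⁴) : Prop :=
  (∀ a b, inner ℝ (T (e a)) (T (e b)) = if a = b then (1 : ℝ) else 0) ∧
    0 < modelStarPhi fun a => T (e a)

theorem IsPositiveFrame.isCoassociativeFrame {e : Fin 4 → ℝ⁴} (he : IsPositiveFrame T e)
    (hT : ∀ u v w, modelPhi ![T u, T v, T w] = 0) : IsCoassociativeFrame fun a => T (e a) :=
  ⟨orthonormal_iff_ite.2 he.1, fun a b c => by rw [← modelPhi_eq_inner_cross]; exact hT _ _ _⟩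

theorem modelStarPhi_neg_left (f : Fin 4 → ℝ⁷) :
    modelStarPhi ![- f 0, f 1, f 2, f 3] = - modelStarPhi f := by
  have hf : f = ![f 0, f 1, f 2, f 3] := by ext a; fin_cases a <;> rfl
  conv_rhs => rw [hf]
  simp only [modelStarPhi, elemForm_four]
  simp
  ring

theorem modelStarPhi_rotate (a b c d : ℝ⁷) :
    modelStarPhi ![a, c, d, b] = modelStarPhi ![a, b, c, d] := by
  simp only [modelStarPhi, elemForm_four]
  ring

/-- An orthonormal basis becomes a positive frame after a change of sign of its first vector, if
necessary. -/
theorem exists_isPositiveFrame (hinj : Function.Injective T)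
    (hT : ∀ u v w, modelPhi ![T u, T v, T w] = 0) : ∃ e, IsPositiveFrame T e := by
  have hfr : Module.finrank ℝ (LinearMap.range (T : ℝ⁴ →ₗ[ℝ] ℝ⁷)) = 4 := by
    rw [LinearMap.finrank_range_of_inj hinj]; simp
  let b := (stdOrthonormalBasis ℝ (LinearMap.range (T : ℝ⁴ →ₗ[ℝ] ℝ⁷))).reindex (finCongr hfr)
  choose e he using fun a => (b a).2
  have he' : ∀ a, T (e a) = (b a : ℝ⁷) := he
  have hon : ∀ a c, inner ℝ (T (e a)) (T (e c)) = if a = c then (1 : ℝ) else 0 := by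
    intro a c
    rw [he', he', ← Submodule.coe_inner]
    exact (orthonormal_iff_ite.1 b.orthonormal) a c
  have hC : IsCoassociativeFrame fun a => T (e a) :=
    ⟨orthonormal_iff_ite.2 hon, fun a b c => by rw [← modelPhi_eq_inner_cross]; exact hT _ _ _⟩
  have hsq := hC.cross_two_three.2
  rcases lt_or_ge 0 (modelStarPhi fun a => T (e a)) with hpos | hneg
  · exact ⟨e, hon, hpos⟩
  · refine ⟨![- e 0, e 1, e 2, e 3], ?_, ?_⟩
    · intro a c
      fin_cases a <;> fin_cases c <;> simp [-inner_self_eq_norm_sq_to_K, hon]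
    · have : (fun a => T ((![- e 0, e 1, e 2, e 3] : Fin 4 → ℝ⁴) a))
          = ![- T (e 0), T (e 1), T (e 2), T (e 3)] := by
        ext a; fin_cases a <;> simp
      rw [this, modelStarPhi_neg_left fun a => T (e a)]
      rcases eq_or_lt_of_le hneg with h | h
      · rw [h] at hsq; norm_num at hsq
      · linarith

/-- A vector whose contraction with `φ₀` vanishes on a coassociative plane is tangent to it. -/
theorem mem_range_of_contraction_eq_zero (hinj : Function.Injective T)
    (hT : ∀ u v w, modelPhi ![T u, T v, T w] = 0) {v : ℝ⁷}
    (hv : ∀ u w, modelPhi ![v, T u, T w] = 0) : ∃ u, T u = v := by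
  obtain ⟨e, he⟩ := exists_isPositiveFrame hinj hT
  have h := (he.isCoassociativeFrame hT).eq_sum v
  have hz : ∀ k : Fin 3, inner ℝ (cross7 (T (e 0)) (T (e k.succ))) v = (0 : ℝ) := fun k => by
    rw [← inner_cross_rotate, ← modelPhi_eq_inner_cross]; exact hv _ _
  simp only [hz, zero_smul, Finset.sum_const_zero, add_zero] at h
  exact ⟨∑ a, (inner ℝ (T (e a)) v : ℝ) • e a, by rw [map_sum]; simpa using h.symm⟩

/-- Every self-dual form on a coassociative plane is the contraction of `φ₀` with some vector. -/
theorem exists_contraction_eq (hinj : Function.Injective T)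
    (hT : ∀ u v w, modelPhi ![T u, T v, T w] = 0) (α : ℝ⁴ →L[ℝ] ℝ⁴ →L[ℝ] ℝ)
    (halt : ∀ u, α u u = 0)
    (hα : ∀ e, IsPositiveFrame T e → α (e 0) (e 1) = α (e 2) (e 3)) :
    ∃ v : ℝ⁷, ∀ u w, modelPhi ![v, T u, T w] = α u w := by
  obtain ⟨e, he⟩ := exists_isPositiveFrame hinj hT
  have hC := he.isCoassociativeFrame hT
  have hskew : ∀ u w, α u w = - α w u := fun u w => by
    have := halt (u + w)
    simp only [map_add, add_apply, halt, zero_add, add_zero] at this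
    linarith
  have hf : (fun a => T (e a)) = ![T (e 0), T (e 1), T (e 2), T (e 3)] := by
    ext a; fin_cases a <;> rfl
  have he2 : IsPositiveFrame T ![e 0, e 2, e 3, e 1] := by
    refine ⟨?_, ?_⟩
    · intro a c
      fin_cases a <;> fin_cases c <;> simp [-inner_self_eq_norm_sq_to_K, he.1]
    · have : (fun a => T ((![e 0, e 2, e 3, e 1] : Fin 4 → ℝ⁴) a))
          = ![T (e 0), T (e 2), T (e 3), T (e 1)] := by ext a; fin_cases a <;> rfl
      rw [this, modelStarPhi_rotate, ← hf]; exact he.2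
  have he3 : IsPositiveFrame T ![e 0, e 3, e 1, e 2] := by
    refine ⟨?_, ?_⟩
    · intro a c
      fin_cases a <;> fin_cases c <;> simp [-inner_self_eq_norm_sq_to_K, he.1]
    · have : (fun a => T ((![e 0, e 3, e 1, e 2] : Fin 4 → ℝ⁴) a))
          = ![T (e 0), T (e 3), T (e 1), T (e 2)] := by ext a; fin_cases a <;> rfl
      rw [this, modelStarPhi_rotate, modelStarPhi_rotate, ← hf]; exact he.2
  have a1 := hα _ he
  have a2 := hα _ he2
  have a3 := hα _ he3
  have c1 := hC.cross_eq he.2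
  have c2 := (he2.isCoassociativeFrame hT).cross_eq he2.2
  have c3 := (he3.isCoassociativeFrame hT).cross_eq he3.2
  simp only [Matrix.cons_val] at a2 a3 c2 c3
  set v : ℝ⁷ := ∑ k : Fin 3, α (e 0) (e k.succ) • cross7 (T (e 0)) (T (e k.succ)) with hv
  have hvk : ∀ k : Fin 3, inner ℝ (cross7 (T (e 0)) (T (e k.succ))) v = α (e 0) (e k.succ) := by
    intro k
    simp only [hv, inner_sum, inner_smul_right, inner_cross_cross_left, he.1]
    fin_cases k <;> simp [Fin.sum_univ_three]
  have b1 : inner ℝ (cross7 (T (e 0)) (T (e 1))) v = α (e 0) (e 1) := hvk 0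
  have b2 : inner ℝ (cross7 (T (e 0)) (T (e 2))) v = α (e 0) (e 2) := hvk 1
  have b3 : inner ℝ (cross7 (T (e 0)) (T (e 3))) v = α (e 0) (e 3) := hvk 2
  have hlin : LinearIndependent ℝ e :=
    LinearIndependent.of_comp (T : ℝ⁴ →ₗ[ℝ] ℝ⁷) hC.orthonormal.linearIndependent
  let B := basisOfLinearIndependentOfCardEqFinrank hlin (by simp)
  have hB : ⇑B = e := coe_basisOfLinearIndependentOfCardEqFinrank _ _
  refine ⟨v, ?_⟩
  have hcs : ∀ a c, inner ℝ (cross7 (T (e c)) (T (e a))) v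
      = - (inner ℝ (cross7 (T (e a)) (T (e c))) v : ℝ) := fun a c => by
    rw [cross7_swap, inner_neg_left]
  have hself : ∀ a, inner ℝ (cross7 (T (e a)) (T (e a))) v = (0 : ℝ) := fun a => by
    have := hcs a a; linarith
  have hbas : ∀ a c, inner ℝ (cross7 (T (e a)) (T (e c))) v = α (e a) (e c) := by
    intro a c
    fin_cases a <;> fin_cases c <;> simp only [Fin.mk_zero, Fin.mk_one, Fin.reduceFinMk,
      Fin.isValue, hself, halt, b1, b2, b3]
    · rw [hcs, b1, ← hskew]
    · rw [← c3, b3, a3]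
    · rw [hcs, ← c2, b2, hskew (e 1), a2]
    · rw [hcs, b2, ← hskew]
    · rw [hcs, ← c3, b3, hskew (e 2), a3]
    · rw [← c1, b1, a1]
    · rw [hcs, b3, ← hskew]
    · rw [← c2, b2, a2]
    · rw [hcs, ← c1, b1, hskew (e 3), a1]
  intro u w
  rw [modelPhi_eq_inner_cross, inner_cross_rotate, ← B.sum_repr u, ← B.sum_repr w, hB]
  have hadd : ∀ (c : Fin 4 → ℝ) (y : ℝ⁷), inner ℝ (cross7 (T (∑ a, c a • e a)) y) v
      = ∑ a, c a * inner ℝ (cross7 (T (e a)) y) v := by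
    intro c y
    rw [inner_cross_rotate, real_inner_comm, map_sum, sum_inner]
    refine Finset.sum_congr rfl fun a _ => ?_
    rw [map_smul, inner_smul_left, inner_cross_rotate (T (e a)), real_inner_comm]; simp
  have hadd' : ∀ (c : Fin 4 → ℝ) (y : ℝ⁷), inner ℝ (cross7 y (T (∑ a, c a • e a))) v
      = ∑ a, c a * inner ℝ (cross7 y (T (e a))) v := by
    intro c y
    rw [cross7_swap, inner_neg_left, hadd, ← Finset.sum_neg_distrib]
    refine Finset.sum_congr rfl fun a _ => ?_
    rw [cross7_swap, inner_neg_left]; ring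
  rw [hadd]
  simp only [hadd', hbas]
  simp only [map_sum, map_smul, sum_apply, smul_apply, smul_eq_mul, Finset.mul_sum]
  rw [Finset.sum_comm]
  exact Finset.sum_congr rfl fun a _ => Finset.sum_congr rfl fun c _ => by ring

end Plane

end Coassoc

namespace Coassoc

/-! ### The inverse function theorem for smooth maps -/

section InverseFunction

variable {E F : Type*} [NormedAddCommGroup E] [NormedSpace ℝ E] [CompleteSpace E]
  [NormedAddCommGroup F] [NormedSpace ℝ F]

/-- The inverse function theorem for a smooth map, with an inverse which is smooth on its whole
domain. -/
theorem exists_openPartialHomeomorph_of_contDiffOn {f : E → F} {O : Set E} (hO : IsOpen O)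
    (hf : ContDiffOn ℝ ∞ f O) {a : E} (ha : a ∈ O) (f' : E ≃L[ℝ] F)
    (hf' : HasFDerivAt f (f' : E →L[ℝ] F) a) :
    ∃ e : OpenPartialHomeomorph E F, a ∈ e.source ∧ e.source ⊆ O ∧ (∀ x ∈ e.source, e x = f x) ∧
      ContDiffOn ℝ ∞ e.symm e.target := by
  have hfa : ContDiffAt ℝ ∞ f a := hf.contDiffAt (hO.mem_nhds ha)
  have hs : HasStrictFDerivAt f (f' : E →L[ℝ] F) a := hfa.hasStrictFDerivAt' hf' (by simp)
  let e₀ := hs.toOpenPartialHomeomorph f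
  have hcont : ContinuousOn (fderiv ℝ f) O := hf.continuousOn_fderiv_of_isOpen hO (by simp)
  let O' := O ∩ fderiv ℝ f ⁻¹' range ((↑) : (E ≃L[ℝ] F) → E →L[ℝ] F)
  have hO' : IsOpen O' := hcont.isOpen_inter_preimage hO ContinuousLinearEquiv.isOpen
  have haO' : a ∈ O' := ⟨ha, f', hf'.fderiv.symm⟩
  refine ⟨e₀.restrOpen O' hO', ?_, ?_, ?_, ?_⟩
  · rw [OpenPartialHomeomorph.restrOpen_source]
    exact ⟨hs.mem_toOpenPartialHomeomorph_source, haO'⟩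
  · rw [OpenPartialHomeomorph.restrOpen_source]
    exact fun x hx => hx.2.1
  · intro x hx; rfl
  · intro y hy
    have hx := (e₀.restrOpen O' hO').map_target hy
    rw [OpenPartialHomeomorph.restrOpen_source] at hx
    obtain ⟨-, hxO, g', hg'⟩ := hx
    have hd : HasFDerivAt f (g' : E →L[ℝ] F) ((e₀.restrOpen O' hO').symm y) := by
      rw [hg']
      exact ((hf.contDiffAt (hO.mem_nhds hxO)).differentiableAt (by simp)).hasFDerivAt
    exact ((e₀.restrOpen O' hO').contDiffAt_symm hy hd
      (hf.contDiffAt (hO.mem_nhds hxO))).contDiffWithinAt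

end InverseFunction

/-! ### Composition operators on spaces of continuous maps -/

section Composition

open BoundedContinuousFunction

universe u

variable {K : Type*} [TopologicalSpace K] [CompactSpace K]
  {E F : Type u} [NormedAddCommGroup E] [NormedSpace ℝ E] [NormedAddCommGroup F] [NormedSpace ℝ F]

variable {G : Type*} [NormedAddCommGroup G] [NormedSpace ℝ G]

/-- A bounded bilinear operation, applied pointwise to continuous maps. -/
noncomputable def pointwiseBilin₀ (B : G →L[ℝ] E →L[ℝ] F) (A : K →ᵇ G) (h : K →ᵇ E) : K →ᵇ F :=
  mkOfCompact ⟨fun t => B (A t) (h t), (B.continuous.comp A.continuous).clm_apply h.continuous⟩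

variable (K) in
/-- `pointwiseBilin₀` as a continuous bilinear map. -/
noncomputable def pointwiseBilin (B : G →L[ℝ] E →L[ℝ] F)
    (hB : ∀ g e, ‖B g e‖ ≤ ‖g‖ * ‖e‖) : (K →ᵇ G) →L[ℝ] (K →ᵇ E) →L[ℝ] (K →ᵇ F) :=
  LinearMap.mkContinuous₂
    (LinearMap.mk₂ ℝ (pointwiseBilin₀ B)
      (fun _ _ _ => by ext; simp [pointwiseBilin₀]) (fun _ _ _ => by ext; simp [pointwiseBilin₀])
      (fun _ _ _ => by ext; simp [pointwiseBilin₀]) (fun _ _ _ => by ext; simp [pointwiseBilin₀]))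
    1
    (fun A h => by
      rw [one_mul, BoundedContinuousFunction.norm_le (mul_nonneg (norm_nonneg _) (norm_nonneg _))]
      intro t
      refine (hB (A t) (h t)).trans ?_
      exact mul_le_mul (A.norm_coe_le_norm t) (h.norm_coe_le_norm t) (norm_nonneg _)
        (norm_nonneg _))

variable (K E F) in
/-- The pointwise application of a field of operators to a field of vectors. -/
noncomputable def pointwiseApply : (K →ᵇ E →L[ℝ] F) →L[ℝ] (K →ᵇ E) →L[ℝ] (K →ᵇ F) :=
  pointwiseBilin K (ContinuousLinearMap.id ℝ (E →L[ℝ] F)) fun g e => g.le_opNorm e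

@[simp]
theorem pointwiseApply_apply (A : K →ᵇ E →L[ℝ] F) (h : K →ᵇ E) (t : K) :
    pointwiseApply K E F A h t = A t (h t) := rfl

/-- Composition with a fixed continuous map. -/
noncomputable def postcomp (K : Type*) [TopologicalSpace K] [CompactSpace K] (X : C(E, F))
    (c : K →ᵇ E) : K →ᵇ F :=
  mkOfCompact (X.comp c.toContinuousMap)

omit [NormedSpace ℝ E] [NormedSpace ℝ F] in
theorem continuous_postcomp (X : C(E, F)) : Continuous (postcomp K X) :=
  (ContinuousMap.isometryEquivBoundedOfCompact K F).continuous.comp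
    ((ContinuousMap.continuous_postcomp X).comp
      (ContinuousMap.isometryEquivBoundedOfCompact K E).symm.continuous)

theorem hasFDerivAt_postcomp (X : C(E, F)) (X' : C(E, E →L[ℝ] F))
    (hX : ∀ x, HasFDerivAt X (X' x) x) (c : K →ᵇ E) :
    HasFDerivAt (postcomp K X) (pointwiseApply K E F (postcomp K X' c)) c := by
  rw [hasFDerivAt_iff_isLittleO, Asymptotics.isLittleO_iff]
  intro ε hε
  have hev : ∀ᶠ h in 𝓝 c, dist (postcomp K X' h) (postcomp K X' c) < ε :=
    (continuous_postcomp X').continuousAt.eventually (Metric.ball_mem_nhds _ hε)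
  obtain ⟨δ, hδ, hball⟩ := Metric.eventually_nhds_iff.1 hev
  filter_upwards [Metric.ball_mem_nhds c hδ] with h hh
  rw [BoundedContinuousFunction.norm_le (mul_nonneg hε.le (norm_nonneg _))]
  intro t
  -- along the segment from `c` to `h` the derivative varies by at most `ε`, uniformly in `t`
  have hseg : ∀ y ∈ segment ℝ (c t) (h t), ‖X' y - X' (c t)‖ ≤ ε := by
    intro y hy
    rw [segment_eq_image'] at hy
    obtain ⟨s, hs, rfl⟩ := hy
    have hmem : dist (c + s • (h - c)) c < δ := by
      rw [dist_eq_norm, add_sub_cancel_left, norm_smul, Real.norm_of_nonneg hs.1, ← dist_eq_norm]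
      exact lt_of_le_of_lt (mul_le_of_le_one_left dist_nonneg hs.2) hh
    have h1 := hball hmem
    rw [dist_eq_norm] at h1
    exact ((BoundedContinuousFunction.norm_coe_le_norm _ t).trans_lt h1).le
  have := (convex_segment (c t) (h t)).norm_image_sub_le_of_norm_hasFDerivWithin_le'
    (fun y _ => (hX y).hasFDerivWithinAt) hseg (left_mem_segment ℝ _ _) (right_mem_segment ℝ _ _)
  refine this.trans ?_
  exact mul_le_mul_of_nonneg_left ((h - c).norm_coe_le_norm t) hε.le

theorem contDiff_postcomp_nat (n : ℕ) : ∀ {F : Type u} [NormedAddCommGroup F] [NormedSpace ℝ F]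
    (X : C(E, F)), ContDiff ℝ ∞ X → ContDiff ℝ n (postcomp K X) := by
  induction n with
  | zero =>
    intro F _ _ X _
    exact contDiff_zero.2 (continuous_postcomp X)
  | succ n ih =>
    intro F _ _ X hX
    obtain ⟨hd, hX'⟩ := contDiff_infty_iff_fderiv.1 hX
    let X' : C(E, E →L[ℝ] F) := ⟨fderiv ℝ X, hX'.continuous⟩
    have h := hasFDerivAt_postcomp (K := K) X X' fun x => (hd x).hasFDerivAt
    push_cast
    rw [contDiff_succ_iff_fderiv]
    refine ⟨fun c => (h c).differentiableAt, fun h => by simp at h, ?_⟩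
    have : fderiv ℝ (postcomp K X) = fun c => pointwiseApply K E F (postcomp K X' c) :=
      funext fun c => (h c).fderiv
    rw [this]
    exact (pointwiseApply K E F).contDiff.comp (ih X' hX')

/-- Composition with a smooth map is a smooth operation on continuous maps on a compact space. -/
theorem contDiff_postcomp (X : C(E, F)) (hX : ContDiff ℝ ∞ X) : ContDiff ℝ ∞ (postcomp K X) :=
  contDiff_infty.2 fun n => contDiff_postcomp_nat n X hX

end Composition

/-! ### Smooth dependence of solutions of differential equations on initial values -/

section Flow

open BoundedContinuousFunction

variable {E : Type*} [NormedAddCommGroup E] [NormedSpace ℝ E]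

/-- The time interval on which flows are constructed. -/
abbrev FlowTime : Type := Icc (-1 : ℝ) 2

/-- The extension to `ℝ` of a function of time which is constant beyond the end points. -/
noncomputable def timeExtend (c : (FlowTime →ᵇ E)) : ℝ → E := IccExtend (by norm_num) c

theorem continuous_timeExtend (c : (FlowTime →ᵇ E)) : Continuous (timeExtend c) :=
  c.continuous.Icc_extend'

theorem timeExtend_coe (c : (FlowTime →ᵇ E)) (t : FlowTime) : timeExtend c t = c t :=
  IccExtend_val _ _ _

theorem norm_timeExtend_le (c : (FlowTime →ᵇ E)) (t : ℝ) : ‖timeExtend c t‖ ≤ ‖c‖ :=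
  c.norm_coe_le_norm _

variable [CompleteSpace E]

variable (E) in
/-- The operator `c ↦ (t ↦ ∫₀ᵗ c)`. -/
noncomputable def primitiveOp : (FlowTime →ᵇ E) →L[ℝ] (FlowTime →ᵇ E) :=
  LinearMap.mkContinuous
    { toFun := fun c => mkOfCompact ⟨fun t => ∫ s in (0 : ℝ)..t, timeExtend c s,
        (intervalIntegral.continuous_primitive
          (fun _ _ => (continuous_timeExtend c).intervalIntegrable _ _) 0).comp
          continuous_subtype_val⟩
      map_add' := fun c d => by
        ext t
        simp only [mkOfCompact_apply, ContinuousMap.coe_mk, BoundedContinuousFunction.add_apply]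
        rw [← intervalIntegral.integral_add ((continuous_timeExtend c).intervalIntegrable _ _)
          ((continuous_timeExtend d).intervalIntegrable _ _)]
        rfl
      map_smul' := fun r c => by
        ext t
        simp only [mkOfCompact_apply, ContinuousMap.coe_mk, BoundedContinuousFunction.smul_apply,
          RingHom.id_apply]
        rw [← intervalIntegral.integral_smul]
        rfl } 2
    (fun c => by
      rw [BoundedContinuousFunction.norm_le (by positivity)]
      intro t
      have h := intervalIntegral.norm_integral_le_of_norm_le_const (a := 0) (b := (t : ℝ))
        (fun s _ => norm_timeExtend_le c s)
      refine h.trans ?_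
      rw [mul_comm]
      refine mul_le_mul_of_nonneg_right ?_ (norm_nonneg _)
      rw [sub_zero, abs_le]
      exact ⟨by linarith [t.2.1], t.2.2⟩)

variable (E) in
/-- The constant curves. -/
noncomputable def constCurve : E →L[ℝ] (FlowTime →ᵇ E) :=
  LinearMap.mkContinuous
    { toFun := fun x => BoundedContinuousFunction.const FlowTime x
      map_add' := fun _ _ => rfl
      map_smul' := fun _ _ => rfl } 1
    (fun x => by
      rw [one_mul, BoundedContinuousFunction.norm_le (norm_nonneg _)]
      exact fun t => le_rfl)

/-- The flow of a small multiple of a vector field near an equilibrium `x₀`: it exists up to time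
`2` and its time-one map is smooth. The derivative of the time-one map at `x₀` is given when the
linearization `A` of the field has square zero. The flow line through `x` is the solution `c` of
`c - ε ∫ X(c) = x`, found by the inverse function theorem in the space of continuous curves. -/
theorem exists_flow_of_contDiff {X : E → E} (hX : ContDiff ℝ ∞ X) {x₀ : E} (hX₀ : X x₀ = 0)
    {A : E →L[ℝ] E} (hA : HasFDerivAt X A x₀) (hAA : ∀ v, A (A v) = 0) {r : ℝ} (hr : 0 < r) :
    ∃ ε : ℝ, 0 < ε ∧ ∃ U : Set E, IsOpen U ∧ x₀ ∈ U ∧ ∃ c : E → ℝ → E,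
      (∀ x ∈ U, c x 0 = x ∧ ∀ t ∈ Ioo (-1 : ℝ) 2, c x t ∈ Metric.ball x₀ r ∧
        HasDerivAt (c x) (ε • X (c x t)) t) ∧
      ContDiffOn ℝ ∞ (fun x => c x 1) U ∧
      HasFDerivAt (fun x => c x 1) (ContinuousLinearMap.id ℝ E + ε • A) x₀ := by
  obtain ⟨hd, hX'⟩ := contDiff_infty_iff_fderiv.1 hX
  let Xc : C(E, E) := ⟨X, hX.continuous⟩
  let X'c : C(E, E →L[ℝ] E) := ⟨fderiv ℝ X, hX'.continuous⟩
  let cst : E →L[ℝ] (FlowTime →ᵇ E) := constCurve E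
  let B : (FlowTime →ᵇ E) →L[ℝ] (FlowTime →ᵇ E) :=
    primitiveOp E ∘L pointwiseApply FlowTime E E (postcomp FlowTime X'c (cst x₀))
  set ε : ℝ := (2 * (‖B‖ + 1))⁻¹ with hε
  have hε0 : 0 < ε := by positivity
  have hBsmall : ‖ε • B‖ < 1 := by
    rw [norm_smul, Real.norm_of_nonneg hε0.le, hε, inv_mul_lt_iff₀ (by positivity)]
    linarith [norm_nonneg B]
  let Ψ : (FlowTime →ᵇ E) → (FlowTime →ᵇ E) := fun c =>
    c - ε • primitiveOp E (postcomp FlowTime Xc c)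
  have hΨ : ContDiff ℝ ∞ Ψ := contDiff_id.sub
    (((primitiveOp E).contDiff.comp (contDiff_postcomp Xc hX)).const_smul ε)
  let u : (FlowTime →ᵇ E) ≃L[ℝ] (FlowTime →ᵇ E) :=
    ContinuousLinearEquiv.unitsEquiv ℝ (FlowTime →ᵇ E) (Units.oneSub (ε • B) hBsmall)
  have hu : ∀ k, u k = k - ε • B k := fun k => rfl
  have hΨ' : HasFDerivAt Ψ (u : (FlowTime →ᵇ E) →L[ℝ] (FlowTime →ᵇ E)) (cst x₀) := by
    have h1 := hasFDerivAt_postcomp Xc X'c (fun x => (hd x).hasFDerivAt) (cst x₀)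
    have h2 := (hasFDerivAt_id (cst x₀)).sub
      (((primitiveOp E).hasFDerivAt.comp (cst x₀) h1).const_smul ε)
    exact h2
  obtain ⟨e, he, -, hef, hes⟩ :=
    exists_openPartialHomeomorph_of_contDiffOn isOpen_univ hΨ.contDiffOn (mem_univ _) u hΨ'
  have hΨ₀ : Ψ (cst x₀) = cst x₀ := by
    have : postcomp FlowTime Xc (cst x₀) = 0 := by ext t; exact hX₀
    simp only [Ψ, this, map_zero, smul_zero, sub_zero]
  have hx₀t : cst x₀ ∈ e.target := by rw [← hΨ₀, ← hef _ he]; exact e.map_source he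
  have hes₀ : e.symm (cst x₀) = cst x₀ := by
    conv_lhs => rw [← hΨ₀, ← hef _ he]
    exact e.left_inv he
  let U : Set E := cst ⁻¹' (e.symm.source ∩ e.symm ⁻¹' Metric.ball (cst x₀) r)
  have hU : IsOpen U := (e.symm.isOpen_inter_preimage Metric.isOpen_ball).preimage cst.continuous
  let d : E → (FlowTime →ᵇ E) := fun x => e.symm (cst x)
  let c : E → ℝ → E := fun x t => x + ε • ∫ s in (0 : ℝ)..t, X (timeExtend (d x) s)
  have hc : ∀ x ∈ U, ∀ t : FlowTime, c x t = d x t := by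
    intro x hx t
    have h1 : Ψ (d x) = cst x := by
      rw [← hef _ (e.map_target hx.1)]; exact e.right_inv hx.1
    have h2 := congrArg (fun f : (FlowTime →ᵇ E) => f t) h1
    change d x t - ε • (∫ s in (0 : ℝ)..t, X (timeExtend (d x) s)) = x at h2
    exact (sub_eq_iff_eq_add.1 h2).symm
  have hcd : ∀ x t, HasDerivAt (c x) (ε • X (timeExtend (d x) t)) t := by
    intro x t
    have hcont : Continuous fun s => X (timeExtend (d x) s) :=
      hX.continuous.comp (continuous_timeExtend _)
    exact ((intervalIntegral.integral_hasDerivAt_right (hcont.intervalIntegrable _ _)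
      (hcont.stronglyMeasurableAtFilter _ _) hcont.continuousAt).const_smul ε).const_add x
  have hdU : ContDiffOn ℝ ∞ d U := hes.comp cst.contDiff.contDiffOn fun x hx => hx.1
  have one_mem : (1 : ℝ) ∈ Icc (-1 : ℝ) 2 := by norm_num
  have zero_mem : (0 : ℝ) ∈ Icc (-1 : ℝ) 2 := by norm_num
  have hx₀U : x₀ ∈ U := ⟨hx₀t, by
    change e.symm (cst x₀) ∈ Metric.ball (cst x₀) r
    rw [hes₀]; exact Metric.mem_ball_self hr⟩
  refine ⟨ε, hε0, U, hU, hx₀U, c, fun x hx => ⟨by simp [c], fun t ht => ?_⟩, ?_, ?_⟩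
  · have h1 := hc x hx ⟨t, ht.1.le, ht.2.le⟩
    have h2 : timeExtend (d x) t = c x t := by
      rw [h1]; exact timeExtend_coe (d x) ⟨t, ht.1.le, ht.2.le⟩
    refine ⟨?_, h2 ▸ hcd x t⟩
    rw [h1]
    exact (BoundedContinuousFunction.dist_coe_le_dist (f := d x) (g := cst x₀) _).trans_lt hx.2
  · have h1 : ContDiffOn ℝ ∞ (fun x => d x ⟨1, one_mem⟩) U :=
      (BoundedContinuousFunction.evalCLM ℝ (⟨1, one_mem⟩ : FlowTime) :
        (FlowTime →ᵇ E) →L[ℝ] E).contDiff.comp_contDiffOn hdU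
    exact h1.congr fun x hx => hc x hx ⟨1, one_mem⟩
  · -- the linearized equation is solved by `t ↦ h + ε t A h`, since `A ∘ A = 0`
    have hdd : HasFDerivAt d ((u.symm : (FlowTime →ᵇ E) →L[ℝ] (FlowTime →ᵇ E)) ∘L cst) x₀ := by
      have h1 : HasFDerivAt e.symm (u.symm : (FlowTime →ᵇ E) →L[ℝ] (FlowTime →ᵇ E)) (cst x₀) := by
        refine e.hasFDerivAt_symm hx₀t ?_
        rw [hes₀]
        exact hΨ'.congr_of_eventuallyEq
          (Filter.eventuallyEq_of_mem (e.open_source.mem_nhds he) hef)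
      exact h1.comp x₀ cst.hasFDerivAt
    have h2 := (BoundedContinuousFunction.evalCLM ℝ
      (⟨1, one_mem⟩ : FlowTime)).hasFDerivAt.comp x₀ hdd
    have h3 : HasFDerivAt (fun x => c x 1) _ x₀ := h2.congr_of_eventuallyEq
      (Filter.eventuallyEq_of_mem (hU.mem_nhds hx₀U) fun x hx => hc x hx ⟨1, one_mem⟩)
    convert h3 using 1
    ext h
    let k : FlowTime →ᵇ E := mkOfCompact ⟨fun t => h + (ε * (t : ℝ)) • A h, by fun_prop⟩
    have hk : u k = cst h := by
      rw [hu]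
      ext t
      have hBk : B k t = (t : ℝ) • A h := by
        have : ∀ s, timeExtend (pointwiseApply FlowTime E E
            (postcomp FlowTime X'c (cst x₀)) k) s = A h := by
          intro s
          simp only [timeExtend, IccExtend, Function.comp]
          rw [pointwiseApply_apply]
          change fderiv ℝ X x₀ (h + (ε * (projIcc (-1 : ℝ) 2 (by norm_num) s : ℝ)) • A h) = A h
          rw [hA.fderiv, map_add, map_smul, hAA, smul_zero, add_zero]
        change (∫ s in (0 : ℝ)..t,
          timeExtend (pointwiseApply FlowTime E E (postcomp FlowTime X'c (cst x₀)) k) s) = _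
        simp only [this]
        simp
      change k t - ε • B k t = h
      rw [hBk]
      change h + (ε * (t : ℝ)) • A h - _ = h
      rw [smul_smul]; abel
    have : u.symm (cst h) = k := by rw [← hk]; simp
    change h + ε • A h = (u.symm (cst h)) ⟨1, one_mem⟩
    rw [this]
    change _ = h + (ε * (1 : ℝ)) • A h
    rw [mul_one]

/-- The local form of `exists_flow_of_contDiff`, for a field defined near `x₀` only. -/
theorem exists_flow_of_contDiffOn [FiniteDimensional ℝ E] {X : E → E} {Ω : Set E}
    (hΩ : IsOpen Ω) (hX : ContDiffOn ℝ ∞ X Ω) {x₀ : E} (hx₀ : x₀ ∈ Ω) (hX₀ : X x₀ = 0)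
    {A : E →L[ℝ] E} (hA : HasFDerivAt X A x₀) (hAA : ∀ v, A (A v) = 0) :
    ∃ ε : ℝ, 0 < ε ∧ ∃ U : Set E, IsOpen U ∧ x₀ ∈ U ∧ ∃ c : E → ℝ → E,
      (∀ x ∈ U, c x 0 = x ∧ ∀ t ∈ Ioo (-1 : ℝ) 2, c x t ∈ Ω ∧
        HasDerivAt (c x) (ε • X (c x t)) t) ∧
      ContDiffOn ℝ ∞ (fun x => c x 1) U ∧
      HasFDerivAt (fun x => c x 1) (ContinuousLinearMap.id ℝ E + ε • A) x₀ := by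
  obtain ⟨R, hR, hRΩ⟩ := Metric.nhds_basis_closedBall.mem_iff.1 (hΩ.mem_nhds hx₀)
  let f : ContDiffBump x₀ := ⟨R / 2, R, by positivity, by linarith⟩
  let Y : E → E := fun x => f x • X x
  have hY : ContDiff ℝ ∞ Y := by
    rw [contDiff_iff_contDiffAt]
    intro x
    by_cases hx : x ∈ Ω
    · exact f.contDiff.contDiffAt.smul (hX.contDiffAt (hΩ.mem_nhds hx))
    · have : Y =ᶠ[𝓝 x] fun _ => 0 := by
        have hx' : x ∈ (Metric.closedBall x₀ R)ᶜ := fun h => hx (hRΩ h)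
        filter_upwards [Metric.isClosed_closedBall.isOpen_compl.mem_nhds hx'] with y hy
        have : f y = 0 := f.zero_of_le_dist (by
          simp only [mem_compl_iff, Metric.mem_closedBall, not_le] at hy; exact hy.le)
        simp [Y, this]
      exact contDiffAt_const.congr_of_eventuallyEq this
  have hYX : ∀ x ∈ Metric.ball x₀ (R / 2), Y x = X x := fun x hx => by
    simp [Y, f.one_of_mem_closedBall (Metric.ball_subset_closedBall hx)]
  have hYA : HasFDerivAt Y A x₀ := hA.congr_of_eventuallyEq
    (Filter.eventuallyEq_of_mem (Metric.ball_mem_nhds x₀ (by positivity)) hYX)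
  have hY₀ : Y x₀ = 0 := by simp [Y, hX₀]
  obtain ⟨ε, hε, U, hU, hxU, c, hc, h1, h2⟩ :=
    exists_flow_of_contDiff hY hY₀ hYA hAA (r := R / 2) (by positivity)
  refine ⟨ε, hε, U, hU, hxU, c, fun x hx => ⟨(hc x hx).1, fun t ht => ?_⟩, h1, h2⟩
  obtain ⟨h3, h4⟩ := (hc x hx).2 t ht
  refine ⟨hRΩ (Metric.ball_subset_closedBall (Metric.ball_subset_ball (by linarith) h3)), ?_⟩
  rwa [hYX _ h3] at h4

end Flow

end Coassoc

namespace Coassoc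

/-! ### Smooth maps into the tangent bundle and into the bundle of bilinear forms -/

section BundleSmoothness

variable {E H EA HA A B : Type*} [NormedAddCommGroup E] [NormedSpace ℝ E] [TopologicalSpace H]
  {I : ModelWithCorners ℝ E H} [TopologicalSpace B] [ChartedSpace H B] [IsManifold I ∞ B]
  [NormedAddCommGroup EA] [NormedSpace ℝ EA] [TopologicalSpace HA]
  {IA : ModelWithCorners ℝ EA HA} [TopologicalSpace A] [ChartedSpace HA A]

theorem contMDiffWithinAt_of_apply {F G : Type*} [NormedAddCommGroup F] [NormedSpace ℝ F]
    [FiniteDimensional ℝ F] [NormedAddCommGroup G] [NormedSpace ℝ G] {f : A → F →L[ℝ] G}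
    {s : Set A} {a : A} (h : ∀ u, ContMDiffWithinAt IA 𝓘(ℝ, G) ∞ (fun b => f b u) s a) :
    ContMDiffWithinAt IA 𝓘(ℝ, F →L[ℝ] G) ∞ f s a := by
  let b := Module.finBasis ℝ F
  have hf : f = fun x => ∑ i, ContinuousLinearMap.smulRightL ℝ F G
      (LinearMap.toContinuousLinearMap (b.coord i)) (f x (b i)) := by
    ext x u
    conv_lhs => rw [← b.sum_repr u, map_sum]
    simp
  rw [hf]
  refine ContMDiffWithinAt.sum fun i _ => ?_
  exact (ContinuousLinearMap.contMDiff (ContinuousLinearMap.smulRightL ℝ F G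
      (LinearMap.toContinuousLinearMap (b.coord i)))).contMDiffAt.comp_contMDiffWithinAt _ (h _)

variable (I) in
/-- The coordinates of a tangent vector in the preferred chart at `p`. -/
noncomputable def tcoord (p : B) (v : TangentBundle I B) : E :=
  mfderiv I 𝓘(ℝ, E) (extChartAt I p) v.1 v.2

theorem tcoord_eq_trivialization {p : B} {v : TangentBundle I B}
    (hv : v.1 ∈ (chartAt H p).source) :
    tcoord I p v = (trivializationAt E (TangentSpace I) p v).2 := by
  have := TangentBundle.continuousLinearMapAt_trivializationAt (I := I) hv
  have h2 : tcoord I p v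
    = (trivializationAt E (TangentSpace I) p).continuousLinearMapAt ℝ v.1 v.2 := by
    rw [this]; rfl
  rw [h2, Trivialization.continuousLinearMapAt_apply, Trivialization.linearMapAt_apply, if_pos]
  rw [TangentBundle.trivializationAt_baseSet]; exact hv

/-- A map into the tangent bundle is smooth when the base point and the coordinates of the vector
in the preferred chart at `p` are. -/
theorem contMDiffWithinAt_tangentBundle_iff {f : A → TangentBundle I B}
    {s : Set A} {a : A} {p : B} (hp : (f a).1 ∈ (chartAt H p).source) :
    ContMDiffWithinAt IA I.tangent ∞ f s a ↔
      ContMDiffWithinAt IA I ∞ (fun a => (f a).1) s a ∧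
      ContMDiffWithinAt IA 𝓘(ℝ, E) ∞ (fun a => tcoord I p (f a)) s a := by
  have he : f a ∈ (trivializationAt E (TangentSpace I) p).source := by
    rw [Trivialization.mem_source, TangentBundle.trivializationAt_baseSet]; exact hp
  have key := Trivialization.contMDiffWithinAt_iff (IB := I) (IM := IA) (n := ∞)
    (e := trivializationAt E (TangentSpace I) p) (f := f) (s := s) he
  refine key.trans ?_
  refine and_congr_right fun hf => ?_
  have hnhds : ∀ᶠ a in 𝓝[s] a, (f a).1 ∈ (chartAt H p).source :=
    hf.continuousWithinAt.preimage_mem_nhdsWithin ((chartAt H p).open_source.mem_nhds hp)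
  refine ⟨fun h => h.congr_of_eventuallyEq (hnhds.mono fun a ha => tcoord_eq_trivialization ha)
    (tcoord_eq_trivialization hp), fun h => h.congr_of_eventuallyEq
    (hnhds.mono fun a ha => (tcoord_eq_trivialization ha).symm) (tcoord_eq_trivialization hp).symm⟩

/-- A map into the bundle of bilinear forms is smooth when the base point is and the values of the
form on the local frame of the preferred trivialization at the given point are. -/
theorem contMDiffWithinAt_bilinBundle_iff [FiniteDimensional ℝ E]
    (f : A → TotalSpace (E →L[ℝ] E →L[ℝ] ℝ)
      (fun z : B => TangentSpace I z →L[ℝ] TangentSpace I z →L[ℝ] ℝ)) {s : Set A} {a : A} :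
    ContMDiffWithinAt IA (I.prod 𝓘(ℝ, E →L[ℝ] E →L[ℝ] ℝ)) ∞ f s a ↔
      ContMDiffWithinAt IA I ∞ (fun a => (f a).proj) s a ∧
      ∀ u w : E, ContMDiffWithinAt IA 𝓘(ℝ, ℝ) ∞ (fun b => (f b).snd
        ((trivializationAt E (TangentSpace I) (f a).proj).symmL ℝ (f b).proj u)
        ((trivializationAt E (TangentSpace I) (f a).proj).symmL ℝ (f b).proj w)) s a := by
  rw [contMDiffWithinAt_hom_bundle]
  refine and_congr_right fun hf => ?_
  have hnhds : ∀ᶠ b in 𝓝[s] a,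
      (f b).proj ∈ (trivializationAt E (TangentSpace I) (f a).proj).baseSet :=
    hf.continuousWithinAt.preimage_mem_nhdsWithin
      ((trivializationAt E (TangentSpace I) (f a).proj).open_baseSet.mem_nhds
        (FiberBundle.mem_baseSet_trivializationAt' _))
  have hev : ∀ (u w : E) (b : A),
      (f b).proj ∈ (trivializationAt E (TangentSpace I) (f a).proj).baseSet →
      ContinuousLinearMap.inCoordinates E (TangentSpace I) (E →L[ℝ] ℝ)
        (fun z : B => TangentSpace I z →L[ℝ] ℝ) (f a).proj (f b).proj (f a).proj (f b).proj
        (f b).snd u w = (f b).snd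
        ((trivializationAt E (TangentSpace I) (f a).proj).symmL ℝ (f b).proj u)
        ((trivializationAt E (TangentSpace I) (f a).proj).symmL ℝ (f b).proj w) := by
    intro u w b hb
    have := inCoordinates_apply_eq₂ (F₁ := E) (E₁ := (TangentSpace I : B → Type _)) (F₂ := E)
      (E₂ := (TangentSpace I : B → Type _)) (F₃ := ℝ) (E₃ := Bundle.Trivial B ℝ)
      (x₀ := (f a).proj) (x := (f b).proj) (ϕ := (f b).snd) (v := u) (w := w) hb hb
      (by simp [Bundle.Trivial.trivialization])
    refine Eq.trans this ?_
    rw [Trivialization.symmL_apply _ hb, Trivialization.symmL_apply _ hb]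
    simp
  constructor
  · intro h u w
    have h2 : ContMDiffWithinAt IA 𝓘(ℝ, ℝ) ∞ (fun b =>
      ContinuousLinearMap.inCoordinates E (TangentSpace I) (E →L[ℝ] ℝ)
        (fun z : B => TangentSpace I z →L[ℝ] ℝ) (f a).proj (f b).proj (f a).proj (f b).proj
        (f b).snd u w) s a :=
      (h.clm_apply contMDiffWithinAt_const).clm_apply contMDiffWithinAt_const
    exact h2.congr_of_eventuallyEq (hnhds.mono fun b hb => (hev u w b hb).symm)
      (hev u w a (FiberBundle.mem_baseSet_trivializationAt' _)).symm
  · intro h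
    refine contMDiffWithinAt_of_apply fun u => contMDiffWithinAt_of_apply fun w => ?_
    exact (h u w).congr_of_eventuallyEq (hnhds.mono fun b hb => hev u w b hb)
      (hev u w a (FiberBundle.mem_baseSet_trivializationAt' _))

variable (I) in
/-- The inverse of `tcoord`: the tangent vector at `x` with given coordinates in the preferred chart
at `p`. -/
noncomputable def tframe (p x : B) : E →L[ℝ] TangentSpace I x :=
  (trivializationAt E (TangentSpace I) p).symmL ℝ x

variable (I) in
/-- `tcoord` as a linear map on a tangent space. -/
noncomputable def tcoordL (p x : B) : TangentSpace I x →L[ℝ] E :=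
  mfderiv I 𝓘(ℝ, E) (extChartAt I p) x

theorem tcoordL_eq {p x : B} (hx : x ∈ (chartAt H p).source) :
    tcoordL I p x = (trivializationAt E (TangentSpace I) p).continuousLinearMapAt ℝ x :=
  (TangentBundle.continuousLinearMapAt_trivializationAt (I := I) hx).symm

@[simp]
theorem tcoordL_tframe {p x : B} (hx : x ∈ (chartAt H p).source) (u : E) :
    tcoordL I p x (tframe I p x u) = u := by
  rw [tcoordL_eq hx]
  exact Trivialization.continuousLinearMapAt_symmL _
    (by rw [TangentBundle.trivializationAt_baseSet]; exact hx) u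

@[simp]
theorem tframe_tcoordL {p x : B} (hx : x ∈ (chartAt H p).source) (v : TangentSpace I x) :
    tframe I p x (tcoordL I p x v) = v := by
  rw [tcoordL_eq hx]
  exact Trivialization.symmL_continuousLinearMapAt _
    (by rw [TangentBundle.trivializationAt_baseSet]; exact hx) v

theorem tframe_eq_mfderivWithin {p x : B} (hx : x ∈ (chartAt H p).source) :
    tframe I p x = mfderivWithin 𝓘(ℝ, E) I (extChartAt I p).symm (range I) (extChartAt I p x) :=
  TangentBundle.symmL_trivializationAt (I := I) hx

theorem contMDiffWithinAt_tframe {f : A → B} {w : A → E} {s : Set A} {a : A} {p : B}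
    (hp : f a ∈ (chartAt H p).source) (hf : ContMDiffWithinAt IA I ∞ f s a)
    (hw : ContMDiffWithinAt IA 𝓘(ℝ, E) ∞ w s a) :
    ContMDiffWithinAt IA I.tangent ∞
      (fun a => (⟨f a, tframe I p (f a) (w a)⟩ : TangentBundle I B)) s a := by
  refine (contMDiffWithinAt_tangentBundle_iff hp).2 ⟨hf, ?_⟩
  have hnhds : ∀ᶠ a in 𝓝[s] a, f a ∈ (chartAt H p).source :=
    hf.continuousWithinAt.preimage_mem_nhdsWithin ((chartAt H p).open_source.mem_nhds hp)
  exact hw.congr_of_eventuallyEq (hnhds.mono fun b hb => tcoordL_tframe hb (w b))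
    (tcoordL_tframe hp (w a))

theorem contMDiffOn_tcoord (p : B) :
    ContMDiffOn I.tangent 𝓘(ℝ, E) ∞ (tcoord I p) {v | v.1 ∈ (chartAt H p).source} := fun _ hv =>
  ((contMDiffWithinAt_tangentBundle_iff (f := id) hv).1 contMDiffWithinAt_id).2

theorem isOpen_tangent_source (p : B) :
    IsOpen {v : TangentBundle I B | v.1 ∈ (chartAt H p).source} :=
  (chartAt H p).open_source.preimage (FiberBundle.continuous_proj E (TangentSpace I))

end BundleSmoothness

/-! ### Coordinates on a manifold without boundary -/

section Boundaryless

variable {E : Type*} [NormedAddCommGroup E] [NormedSpace ℝ E]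
  {B : Type*} [TopologicalSpace B] [ChartedSpace E B] [IsManifold 𝓘(ℝ, E) ∞ B]

theorem tframe_symm {p : B} {y : E} (hy : y ∈ (extChartAt 𝓘(ℝ, E) p).target) :
    tframe 𝓘(ℝ, E) p ((extChartAt 𝓘(ℝ, E) p).symm y)
      = mfderiv 𝓘(ℝ, E) 𝓘(ℝ, E) (extChartAt 𝓘(ℝ, E) p).symm y := by
  have hx : (extChartAt 𝓘(ℝ, E) p).symm y ∈ (chartAt E p).source := by
    rw [← extChartAt_source 𝓘(ℝ, E)]; exact (extChartAt 𝓘(ℝ, E) p).map_target hy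
  rw [tframe_eq_mfderivWithin hx, (extChartAt 𝓘(ℝ, E) p).right_inv hy]
  rw [show range 𝓘(ℝ, E) = univ from range_id, mfderivWithin_univ]

theorem extChartAt_symm_mem_source {p : B} {y : E} (hy : y ∈ (extChartAt 𝓘(ℝ, E) p).target) :
    (extChartAt 𝓘(ℝ, E) p).symm y ∈ (chartAt E p).source := by
  rw [← extChartAt_source 𝓘(ℝ, E)]; exact (extChartAt 𝓘(ℝ, E) p).map_target hy

/-- The tangent vector with base point coordinates `z.1` and vector coordinates `z.2` in the
preferred chart at `p`. -/
noncomputable def tpoint (p : B) (z : E × E) : TangentBundle 𝓘(ℝ, E) B :=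
  ⟨(extChartAt 𝓘(ℝ, E) p).symm z.1, tframe 𝓘(ℝ, E) p ((extChartAt 𝓘(ℝ, E) p).symm z.1) z.2⟩

/-- Both coordinates of a tangent vector in the preferred chart at `p`. -/
noncomputable def tpair (p : B) (v : TangentBundle 𝓘(ℝ, E) B) : E × E :=
  (extChartAt 𝓘(ℝ, E) p v.1, tcoord 𝓘(ℝ, E) p v)

theorem tpair_tpoint {p : B} {z : E × E} (hz : z.1 ∈ (extChartAt 𝓘(ℝ, E) p).target) :
    tpair p (tpoint p z) = z := by
  refine Prod.ext ((extChartAt 𝓘(ℝ, E) p).right_inv hz) ?_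
  exact tcoordL_tframe (extChartAt_symm_mem_source hz) z.2

theorem tpoint_tpair {p : B} {v : TangentBundle 𝓘(ℝ, E) B} (hv : v.1 ∈ (chartAt E p).source) :
    tpoint p (tpair p v) = v := by
  have h1 : (extChartAt 𝓘(ℝ, E) p).symm (extChartAt 𝓘(ℝ, E) p v.1) = v.1 :=
    (extChartAt 𝓘(ℝ, E) p).left_inv (by rwa [extChartAt_source])
  have h2 : tframe 𝓘(ℝ, E) p v.1 (tcoord 𝓘(ℝ, E) p v) = v.2 := tframe_tcoordL hv v.2
  have h3 : tpoint p (tpair p v) = ⟨v.1, tframe 𝓘(ℝ, E) p v.1 (tcoord 𝓘(ℝ, E) p v)⟩ :=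
    congrArg (fun x => (⟨x, tframe 𝓘(ℝ, E) p x (tcoord 𝓘(ℝ, E) p v)⟩ : TangentBundle 𝓘(ℝ, E) B)) h1
  exact h3.trans (congrArg (fun w => (⟨v.1, w⟩ : TangentBundle 𝓘(ℝ, E) B)) h2)

theorem contMDiffOn_tpair (p : B) : ContMDiffOn 𝓘(ℝ, E).tangent 𝓘(ℝ, E × E) ∞ (tpair p)
    {v : TangentBundle 𝓘(ℝ, E) B | v.1 ∈ (chartAt E p).source} := by
  have h1 : ContMDiffOn 𝓘(ℝ, E).tangent 𝓘(ℝ, E) ∞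
      (fun v : TangentBundle 𝓘(ℝ, E) B => extChartAt 𝓘(ℝ, E) p v.1)
      {v : TangentBundle 𝓘(ℝ, E) B | v.1 ∈ (chartAt E p).source} :=
    (contMDiffOn_extChartAt (I := 𝓘(ℝ, E)) (n := ∞) (x := p)).comp
      (Bundle.contMDiff_proj (TangentSpace 𝓘(ℝ, E) : B → Type _)).contMDiffOn fun v hv => hv
  exact h1.prodMk_space (contMDiffOn_tcoord p)

end Boundaryless

end Coassoc

namespace Coassoc

local notation "ℝ⁷" => EuclideanSpace ℝ (Fin 7)

/-! ### Smoothness of forms evaluated on smooth vector fields -/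

section FormSmoothness

variable {EA HA A : Type*} [NormedAddCommGroup EA] [NormedSpace ℝ EA] [TopologicalSpace HA]
  {IA : ModelWithCorners ℝ EA HA} [TopologicalSpace A] [ChartedSpace HA A]

theorem contMDiffWithinAt_alternating_apply {E : Type*} [NormedAddCommGroup E] [NormedSpace ℝ E]
    [FiniteDimensional ℝ E] {k : ℕ} {β : A → E [⋀^Fin k]→L[ℝ] ℝ} {w : Fin k → A → E}
    {s : Set A} {a : A}
    (hβ : ∀ u : Fin k → E, ContMDiffWithinAt IA 𝓘(ℝ, ℝ) ∞ (fun a => β a u) s a)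
    (hw : ∀ c, ContMDiffWithinAt IA 𝓘(ℝ, E) ∞ (w c) s a) :
    ContMDiffWithinAt IA 𝓘(ℝ, ℝ) ∞ (fun a => β a fun c => w c a) s a := by
  let b := Module.finBasis ℝ E
  have h : (fun a => β a fun c => w c a) = fun a => ∑ r : Fin k → Fin (Module.finrank ℝ E),
      (∏ c, b.coord (r c) (w c a)) * β a fun c => b (r c) := by
    funext a
    have : (fun c => w c a) = fun c => ∑ l, b.coord l (w c a) • b l :=
      funext fun c => (b.sum_repr (w c a)).symm
    conv_lhs => rw [this]
    refine ((β a).toMultilinearMap.map_sum _).trans (Finset.sum_congr rfl fun r _ => ?_)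
    exact (β a).toMultilinearMap.map_smul_univ _ _
  rw [h]
  refine ContMDiffWithinAt.sum fun r _ => ContMDiffWithinAt.mul ?_ (hβ _)
  refine contMDiffWithinAt_finsetProd fun c _ => ?_
  exact (ContinuousLinearMap.contMDiff (LinearMap.toContinuousLinearMap
    (b.coord (r c)))).contMDiffAt.comp_contMDiffWithinAt _ (hw c)

variable {n : ℕ} {X : Type*} [TopologicalSpace X] [ChartedSpace (EuclideanSpace ℝ (Fin n)) X]
  [IsManifold (𝓡 n) ∞ X]

theorem FormField.apply_eq_formInChart {k : ℕ} (β : FormField n X k) {p x : X}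
    (hx : x ∈ (chartAt (EuclideanSpace ℝ (Fin n)) p).source) (v : Fin k → TangentSpace (𝓡 n) x) :
    β x v = formInChart β p (extChartAt (𝓡 n) p x) fun c => tcoordL (𝓡 n) p x (v c) := by
  have hx' : x ∈ (extChartAt (𝓡 n) p).source := by rwa [extChartAt_source]
  obtain ⟨y, hy, rfl⟩ : ∃ y ∈ (extChartAt (𝓡 n) p).target, (extChartAt (𝓡 n) p).symm y = x :=
    ⟨_, (extChartAt (𝓡 n) p).map_source hx', (extChartAt (𝓡 n) p).left_inv hx'⟩
  rw [(extChartAt (𝓡 n) p).right_inv hy]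
  have : v = fun c => mfderiv (𝓡 n) (𝓡 n) (extChartAt (𝓡 n) p).symm y
      (tcoordL (𝓡 n) p ((extChartAt (𝓡 n) p).symm y) (v c)) := funext fun c => by
    have h := tframe_tcoordL (I := 𝓡 n) hx (v c)
    rw [tframe_symm hy] at h
    exact h.symm
  conv_lhs => rw [this]
  rfl

theorem IsSmoothForm.contMDiffWithinAt_apply {k : ℕ} {β : FormField n X k} (hβ : IsSmoothForm β)
    {f : A → X} {v : Fin k → ∀ a, TangentSpace (𝓡 n) (f a)} {s : Set A} {a : A}
    (hf : ContMDiffWithinAt IA (𝓡 n) ∞ f s a)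
    (hv : ∀ c, ContMDiffWithinAt IA (𝓡 n).tangent ∞
      (fun a => (⟨f a, v c a⟩ : TangentBundle (𝓡 n) X)) s a) :
    ContMDiffWithinAt IA 𝓘(ℝ, ℝ) ∞ (fun a => β (f a) fun c => v c a) s a := by
  have hp : f a ∈ (chartAt (EuclideanSpace ℝ (Fin n)) (f a)).source := mem_chart_source _ _
  have hnhds : ∀ᶠ b in 𝓝[s] a, f b ∈ (chartAt (EuclideanSpace ℝ (Fin n)) (f a)).source :=
    hf.continuousWithinAt.preimage_mem_nhdsWithin ((chartAt _ (f a)).open_source.mem_nhds hp)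
  have hy : ContMDiffWithinAt IA (𝓡 n) ∞ (fun b => extChartAt (𝓡 n) (f a) (f b)) s a :=
    contMDiffAt_extChartAt.comp_contMDiffWithinAt a hf
  have key : ContMDiffWithinAt IA 𝓘(ℝ, ℝ) ∞ (fun b => formInChart β (f a)
      (extChartAt (𝓡 n) (f a) (f b)) fun c => tcoord (𝓡 n) (f a) ⟨f b, v c b⟩) s a := by
    refine contMDiffWithinAt_alternating_apply (fun u => ?_)
      (fun c => ((contMDiffWithinAt_tangentBundle_iff hp).1 (hv c)).2)
    have h1 : ContDiffAt ℝ ∞ (fun y => formInChart β (f a) y u)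
        (extChartAt (𝓡 n) (f a) (f a)) :=
      ((ContinuousAlternatingMap.apply ℝ _ ℝ u).contDiff.contDiffAt).comp _
        ((hβ (f a)).contDiffAt (extChartAt_target_mem_nhds (I := 𝓡 n) (f a)))
    exact h1.contMDiffAt.comp_contMDiffWithinAt a hy
  exact key.congr_of_eventuallyEq (hnhds.mono fun b hb => β.apply_eq_formInChart hb _)
    (β.apply_eq_formInChart hp _)

end FormSmoothness

/-! ### Smoothness of the metric of a positive 3-form -/

theorem inner_cross_eq_sum (a x y : ℝ⁷) :
    inner ℝ (cross7 a x) y = ∑ j, (∑ i, x i * contractionMatrix a i j) * y j := by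
  have h : ∀ j, (cross7 a x) j = ∑ i, x i * contractionMatrix a i j := by
    intro j
    simp only [contractionMatrix, Matrix.of_apply, EuclideanSpace.inner_single_right]
    fin_cases j <;> simp [cross7, Fin.sum_univ_seven] <;> ring
  simp [PiLp.inner_apply, mul_comm, h]

theorem det_toMatrix_single (L : ℝ⁷ →ₗ[ℝ] ℝ⁷) :
    (Matrix.of fun i j : Fin 7 => L (EuclideanSpace.single j 1) i).det = LinearMap.det L := by
  rw [← LinearMap.det_toMatrix (EuclideanSpace.basisFun (Fin 7) ℝ).toBasis L]
  congr 1

open Matrix in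
/-- For `β = L^*φ₀`, the square of `det (u ⌟ β + u♭ ⊗ u♭)` is `(det L)⁴ ⟨u, u⟩⁴ |L u|⁸`. -/
theorem det_pullback_contraction_sq {β : (Fin 3 → ℝ⁷) → ℝ} {L : ℝ⁷ ≃L[ℝ] ℝ⁷}
    (h : ∀ v, β v = modelPhi fun a => L (v a)) {u : ℝ⁷} (hu : u ≠ 0) :
    (Matrix.of fun a b : Fin 7 => β ![u, EuclideanSpace.single a 1, EuclideanSpace.single b 1]
      + u a * u b).det ^ 2
      = (LinearMap.det (L : ℝ⁷ →ₗ[ℝ] ℝ⁷)) ^ 4 * inner ℝ u u ^ 4 * inner ℝ (L u) (L u) ^ 4 := by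
  set Lm : Matrix (Fin 7) (Fin 7) ℝ := Matrix.of fun i j => L (EuclideanSpace.single j 1) i with hLm
  have hdet : Lm.det = LinearMap.det (L : ℝ⁷ →ₗ[ℝ] ℝ⁷) :=
    det_toMatrix_single (L : ℝ⁷ →ₗ[ℝ] ℝ⁷)
  set η : ℝ⁷ := ContinuousLinearMap.adjoint (L.symm : ℝ⁷ →L[ℝ] ℝ⁷) u with hη
  have hηL : ∀ v, inner ℝ η (L v) = inner ℝ u v := fun v => by
    rw [hη, ContinuousLinearMap.adjoint_inner_left]; simp
  have hηu : ∀ b, ∑ i, η i * Lm i b = u b := fun b => by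
    have := hηL (EuclideanSpace.single b 1)
    rw [EuclideanSpace.inner_single_right] at this
    simpa [PiLp.inner_apply, mul_comm, hLm] using this
  have hZ : (Matrix.of fun a b : Fin 7 =>
      β ![u, EuclideanSpace.single a 1, EuclideanSpace.single b 1] + u a * u b)
      = Lmᵀ * (contractionMatrix (L u) + Matrix.vecMulVec η.ofLp η.ofLp) * Lm := by
    rw [mul_add, add_mul]
    ext a b
    have h1 : β ![u, EuclideanSpace.single a 1, EuclideanSpace.single b 1]
        = (Lmᵀ * contractionMatrix (L u) * Lm) a b := by
      have h2 : (fun c => L ((![u, EuclideanSpace.single a 1, EuclideanSpace.single b 1] :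
          Fin 3 → ℝ⁷) c))
          = ![L u, L (EuclideanSpace.single a 1), L (EuclideanSpace.single b 1)] := by
        ext c; fin_cases c <;> rfl
      rw [h, h2, modelPhi_eq_inner_cross, inner_cross_eq_sum]
      simp [Matrix.mul_apply, hLm]
    have h3 : u a * u b = (Lmᵀ * Matrix.vecMulVec η.ofLp η.ofLp * Lm) a b := by
      rw [← hηu a, ← hηu b, Finset.sum_mul_sum]
      simp only [Matrix.mul_apply, Matrix.transpose_apply, Matrix.vecMulVec_apply, Finset.sum_mul]
      rw [Finset.sum_comm]
      exact Finset.sum_congr rfl fun _ _ => Finset.sum_congr rfl fun _ _ => by ring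
    rw [Matrix.of_apply, h1, h3, Matrix.add_apply]
  rw [hZ, Matrix.det_mul, Matrix.det_mul, Matrix.det_transpose, hdet]
  have key := det_contraction_add_sq (L u) (by simpa using hu) η
  rw [hηL u] at key
  linear_combination (LinearMap.det (L : ℝ⁷ →ₗ[ℝ] ℝ⁷)) ^ 4 * key

/-- The metric induced by a smooth positive form is smooth, although the frames `L y` need not
depend continuously on `y`: `|det L y|` and then the metric are obtained by roots from
determinants of matrices with smooth entries. -/
theorem contDiffOn_inner_of_pullback {β : ℝ⁷ → ℝ⁷ [⋀^Fin 3]→L[ℝ] ℝ} {L : ℝ⁷ → ℝ⁷ ≃L[ℝ] ℝ⁷}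
    {Ω : Set ℝ⁷} (hβ : ContDiffOn ℝ ∞ β Ω)
    (h : ∀ y ∈ Ω, ∀ v, β y v = modelPhi fun a => L y (v a)) (u v : ℝ⁷) :
    ContDiffOn ℝ ∞ (fun y => inner ℝ (L y u) (L y v)) Ω := by
  set D : ℝ⁷ → ℝ := fun y => LinearMap.det (L y : ℝ⁷ →ₗ[ℝ] ℝ⁷) with hD
  have hD0 : ∀ y, D y ≠ 0 := fun y => (LinearEquiv.isUnit_det' (L y).toLinearEquiv).ne_zero
  have hβ' : ∀ w, ContDiffOn ℝ ∞ (fun y => β y w) Ω := fun w =>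
    (ContinuousAlternatingMap.apply ℝ _ ℝ w).contDiff.comp_contDiffOn hβ
  have hdet : ∀ {m : ℕ} {Z : ℝ⁷ → Matrix (Fin m) (Fin m) ℝ},
      (∀ a b, ContDiffOn ℝ ∞ (fun y => Z y a b) Ω) → ContDiffOn ℝ ∞ (fun y => (Z y).det) Ω := by
    intro m Z hZ
    simp only [Matrix.det_apply']
    exact ContDiffOn.sum fun σ _ => contDiffOn_const.mul (contDiffOn_prod fun c _ => hZ _ _)
  -- the weighted square norm `|det L| |L u|²` is a fourth root of a smooth positive function
  have hq : ∀ u : ℝ⁷, ContDiffOn ℝ ∞ (fun y => |D y| * inner ℝ (L y u) (L y u)) Ω := by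
    intro u
    rcases eq_or_ne u 0 with rfl | hu
    · simpa using contDiffOn_const
    have hu' : 0 < inner ℝ u u := real_inner_self_pos.2 hu
    have hpos : ∀ y, 0 < inner ℝ (L y u) (L y u) := fun y =>
      real_inner_self_pos.2 (by simpa using hu)
    set f : ℝ⁷ → ℝ := fun y => (Matrix.of fun a b : Fin 7 =>
      β y ![u, EuclideanSpace.single a 1, EuclideanSpace.single b 1] + u a * u b).det ^ 2 with hf
    have hfs : ContDiffOn ℝ ∞ f Ω :=
      (hdet fun a b => (hβ' _).add contDiffOn_const).pow 2
    have hfe : ∀ y ∈ Ω, f y = (|D y| * inner ℝ u u * inner ℝ (L y u) (L y u)) ^ 4 := by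
      intro y hy
      rw [hf]
      simp only
      rw [det_pullback_contraction_sq (h y hy) hu, mul_pow, mul_pow, (by decide : Even 4).pow_abs]
    have hsq : ∀ y ∈ Ω, √(√(f y)) / inner ℝ u u = |D y| * inner ℝ (L y u) (L y u) := by
      intro y hy
      have h0 : 0 ≤ |D y| * inner ℝ u u * inner ℝ (L y u) (L y u) := by
        have := hpos y; positivity
      rw [hfe y hy, show ∀ x : ℝ, x ^ 4 = (x ^ 2) ^ 2 from fun x => by ring,
        Real.sqrt_sq (by positivity), Real.sqrt_sq h0]
      field_simp
    have hfp : ∀ y ∈ Ω, 0 < f y := fun y hy => by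
      rw [hfe y hy]
      have := hpos y; have := abs_pos.2 (hD0 y); positivity
    refine ContDiffOn.congr (f := fun y => √(√(f y)) / inner ℝ u u) ?_ fun y hy => (hsq y hy).symm
    exact ((hfs.sqrt fun y hy => (hfp y hy).ne').sqrt
      fun y hy => (Real.sqrt_pos.2 (hfp y hy)).ne').div_const _
  have hb : ∀ u v : ℝ⁷, ContDiffOn ℝ ∞ (fun y => |D y| * inner ℝ (L y u) (L y v)) Ω := by
    intro u v
    refine ContDiffOn.congr (((hq (u + v)).sub ((hq u).add (hq v))).div_const 2) fun y _ => ?_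
    simp only [map_add, inner_add_left, inner_add_right, real_inner_comm (L y u) (L y v)]
    ring
  -- the determinant of the weighted Gram matrix is `|det L|⁹`
  have hgram : ∀ y, (Matrix.of fun a b : Fin 7 => |D y| * inner ℝ
      (L y (EuclideanSpace.single a 1)) (L y (EuclideanSpace.single b 1))).det = |D y| ^ 9 := by
    intro y
    have h1 : (Matrix.of fun a b : Fin 7 => |D y| * inner ℝ (L y (EuclideanSpace.single a 1))
        (L y (EuclideanSpace.single b 1))) = |D y| •
        ((Matrix.of fun i j : Fin 7 => L y (EuclideanSpace.single j 1) i).transpose *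
          Matrix.of fun i j : Fin 7 => L y (EuclideanSpace.single j 1) i) := by
      ext a b
      simp [Matrix.mul_apply, PiLp.inner_apply, mul_comm]
    have h2 : (Matrix.of fun i j : Fin 7 => L y (EuclideanSpace.single j 1) i).det = D y :=
      det_toMatrix_single (L y : ℝ⁷ →ₗ[ℝ] ℝ⁷)
    rw [h1, Matrix.det_smul, Matrix.det_mul, Matrix.det_transpose, h2, Fintype.card_fin]
    rw [← abs_mul_abs_self (D y)]
    ring
  have habs : ContDiffOn ℝ ∞ (fun y => |D y|) Ω := by
    refine ContDiffOn.congr (f := fun y => ((Matrix.of fun a b : Fin 7 => |D y| * inner ℝ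
      (L y (EuclideanSpace.single a 1)) (L y (EuclideanSpace.single b 1))).det) ^ (9⁻¹ : ℝ)) ?_ ?_
    · refine ContDiffOn.rpow_const_of_ne (hdet fun a b => hb _ _) fun y _ => ?_
      rw [hgram]
      exact pow_ne_zero _ (abs_pos.2 (hD0 y)).ne'
    · intro y _
      rw [hgram, ← Real.rpow_natCast, ← Real.rpow_mul (abs_nonneg _)]
      norm_num
  refine ContDiffOn.congr ((hb u v).div habs fun y _ => (abs_pos.2 (hD0 y)).ne') fun y _ => ?_
  simp only [Pi.div_apply]
  rw [mul_div_cancel_left₀ _ (abs_pos.2 (hD0 y)).ne']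

end Coassoc

namespace Coassoc

local notation "ℝ⁷" => EuclideanSpace ℝ (Fin 7)

/-! ### Metrics -/

theorem isVonNBounded_of_pos (B : ℝ⁷ →L[ℝ] ℝ⁷ →L[ℝ] ℝ) (hB : ∀ v, v ≠ 0 → 0 < B v v) :
    Bornology.IsVonNBounded ℝ {v : ℝ⁷ | B v v < 1} := by
  have hne : (Metric.sphere (0 : ℝ⁷) 1).Nonempty :=
    ⟨EuclideanSpace.single 0 1, by simp⟩
  obtain ⟨v₀, hv₀, hmin⟩ := (isCompact_sphere (0 : ℝ⁷) 1).exists_isMinOn hne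
    (f := fun v => B v v) (B.continuous.clm_apply continuous_id).continuousOn
  have hm : 0 < B v₀ v₀ := hB v₀ (by rintro rfl; simp at hv₀)
  refine (NormedSpace.isVonNBounded_iff' ℝ).2 ⟨1 / B v₀ v₀ + 1, fun v hv => ?_⟩
  rcases eq_or_ne v 0 with rfl | h0
  · simp only [norm_zero]; positivity
  have hn : 0 < ‖v‖ := norm_pos_iff.2 h0
  have h1 : B v₀ v₀ ≤ B (‖v‖⁻¹ • v) (‖v‖⁻¹ • v) :=
    hmin (show ‖v‖⁻¹ • v ∈ Metric.sphere (0 : ℝ⁷) 1 by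
      simp [norm_smul, hn.ne'])
  simp only [map_smul, smul_apply, smul_eq_mul] at h1
  have h2 : B v₀ v₀ * (‖v‖ * ‖v‖) ≤ B v v := by
    have := mul_le_mul_of_nonneg_right h1 (mul_nonneg hn.le hn.le)
    field_simp at this
    linarith
  have h3 : ‖v‖ * ‖v‖ < 1 / B v₀ v₀ := by
    rw [lt_div_iff₀ hm]; have : B v v < 1 := hv; linarith
  nlinarith [sq_nonneg (‖v‖ - 1)]

/-- The pullback of a bilinear form on `ℝ⁷`. -/
noncomputable def pullBilin (B : ℝ⁷ →L[ℝ] ℝ⁷ →L[ℝ] ℝ) (L : ℝ⁷ →L[ℝ] ℝ⁷) : ℝ⁷ →L[ℝ] ℝ⁷ →L[ℝ] ℝ :=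
  B.bilinearComp L L

variable {M : Type*} [TopologicalSpace M] [ChartedSpace ℝ⁷ M] [IsManifold (𝓡 7) ∞ M]

section

variable {EA HA A : Type*} [NormedAddCommGroup EA] [NormedSpace ℝ EA] [TopologicalSpace HA]
  {IA : ModelWithCorners ℝ EA HA} [TopologicalSpace A] [ChartedSpace HA A]

theorem metric7_contMDiffWithinAt (h : Metric7 M) {f : A → M}
    {v w : ∀ a, TangentSpace (𝓡 7) (f a)} {s : Set A} {a : A}
    (hv : ContMDiffWithinAt IA (𝓡 7).tangent ∞
      (fun a => (⟨f a, v a⟩ : TangentBundle (𝓡 7) M)) s a)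
    (hw : ContMDiffWithinAt IA (𝓡 7).tangent ∞
      (fun a => (⟨f a, w a⟩ : TangentBundle (𝓡 7) M)) s a) :
    ContMDiffWithinAt IA 𝓘(ℝ, ℝ) ∞ (fun a => h.inner (f a) (v a) (w a)) s a := by
  have hb : ContMDiffWithinAt IA (𝓡 7) ∞ f s a :=
    ((contMDiffWithinAt_tangentBundle_iff (p := f a) (mem_chart_source ℝ⁷ (f a))).1 hv).1
  have : ContMDiffWithinAt IA ((𝓡 7).prod 𝓘(ℝ)) ∞
      (fun m ↦ TotalSpace.mk' ℝ (E := Bundle.Trivial M ℝ) (f m)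
        (h.inner (f m) (v m) (w m))) s a := by
    apply ContMDiffWithinAt.clm_bundle_apply₂ (F₁ := ℝ⁷) (F₂ := ℝ⁷)
    · exact ContMDiffAt.comp_contMDiffWithinAt a h.contMDiff.contMDiffAt hb
    · exact hv
    · exact hw
  simp only [contMDiffWithinAt_totalSpace] at this
  exact this.2

end

/-- A smooth metric from a field of positive definite bilinear forms whose coefficients in the
preferred charts are smooth. -/
noncomputable def metric7OfSmooth
    (b : ∀ x : M, TangentSpace (𝓡 7) x →L[ℝ] TangentSpace (𝓡 7) x →L[ℝ] ℝ)
    (symm : ∀ x v w, b x v w = b x w v) (pos : ∀ x v, v ≠ 0 → 0 < b x v v)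
    (smooth : ∀ (p : M) (u w : ℝ⁷), ContMDiffAt (𝓡 7) 𝓘(ℝ, ℝ) ∞
      (fun x => b x (tframe (𝓡 7) p x u) (tframe (𝓡 7) p x w)) p) : Metric7 M where
  inner := b
  symm := symm
  pos := pos
  isVonNBounded x := isVonNBounded_of_pos (b x) (pos x)
  contMDiff x := (contMDiffWithinAt_bilinBundle_iff (I := 𝓡 7) (IA := 𝓡 7)
    (fun x => TotalSpace.mk' (ℝ⁷ →L[ℝ] ℝ⁷ →L[ℝ] ℝ) x (b x)) (s := univ) (a := x)).2
    ⟨contMDiffWithinAt_id, fun u w => smooth x u w⟩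

theorem isG2Frame_g2Frame {φ : FormField 7 M 3} (hφ : IsPositiveForm φ) (x : M) :
    IsG2Frame φ x (g2Frame φ x) := by
  have h : g2Frame φ x = (hφ x).choose := dif_pos (hφ x)
  rw [h]
  exact (hφ x).choose_spec

/-- `tframe` as an isomorphism of the model space with a tangent space. -/
noncomputable def tframeEquiv {p x : M} (hx : x ∈ (chartAt ℝ⁷ p).source) :
    ℝ⁷ ≃L[ℝ] TangentSpace (𝓡 7) x :=
  ContinuousLinearEquiv.equivOfInverse (tframe (𝓡 7) p x) (tcoordL (𝓡 7) p x)
    (tcoordL_tframe hx) (tframe_tcoordL hx)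

/-- The metric of a smooth positive form has smooth coefficients in the frame of a chart. -/
theorem g2Metric_contMDiffOn {φ : FormField 7 M 3} (hφ : IsPositiveForm φ) (hs : IsSmoothForm φ)
    (p : M) (u w : ℝ⁷) : ContMDiffOn (𝓡 7) 𝓘(ℝ, ℝ) ∞
      (fun x => g2Metric φ x (tframe (𝓡 7) p x u) (tframe (𝓡 7) p x w)) (chartAt ℝ⁷ p).source := by
  classical
  let L : ℝ⁷ → ℝ⁷ ≃L[ℝ] ℝ⁷ := fun y =>
    if hy : (extChartAt (𝓡 7) p).symm y ∈ (chartAt ℝ⁷ p).source then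
      (tframeEquiv hy).trans (g2Frame φ ((extChartAt (𝓡 7) p).symm y))
    else ContinuousLinearEquiv.refl ℝ ℝ⁷
  have hL : ∀ y ∈ (extChartAt (𝓡 7) p).target, ∀ v, L y v = g2Frame φ ((extChartAt (𝓡 7) p).symm y)
      (tframe (𝓡 7) p ((extChartAt (𝓡 7) p).symm y) v) := by
    intro y hy v
    simp only [L, dif_pos (extChartAt_symm_mem_source hy)]
    rfl
  have key := contDiffOn_inner_of_pullback (L := L) (hs p) (fun y hy v => by
    have h1 := isG2Frame_g2Frame hφ ((extChartAt (𝓡 7) p).symm y)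
      (fun a => mfderiv (𝓡 7) (𝓡 7) (extChartAt (𝓡 7) p).symm y (v a))
    refine Eq.trans h1 ?_
    congr 1
    funext a
    rw [hL y hy, tframe_symm hy]
    rfl) u w
  have h2 : ContMDiffOn (𝓡 7) 𝓘(ℝ, ℝ) ∞ (fun x => inner ℝ (L (extChartAt (𝓡 7) p x) u)
      (L (extChartAt (𝓡 7) p x) w)) (chartAt ℝ⁷ p).source :=
    key.contMDiffOn.comp (contMDiffOn_extChartAt (I := 𝓡 7) (n := ∞) (x := p))
      fun x hx => (extChartAt (𝓡 7) p).map_source (by rwa [extChartAt_source])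
  refine h2.congr fun x hx => ?_
  have hx' : x ∈ (extChartAt (𝓡 7) p).source := by rwa [extChartAt_source]
  rw [hL _ ((extChartAt (𝓡 7) p).map_source hx'), hL _ ((extChartAt (𝓡 7) p).map_source hx'),
    (extChartAt (𝓡 7) p).left_inv hx']
  rfl

/-- `g2Metric` as a field of continuous bilinear forms. -/
noncomputable def g2Bilin (φ : FormField 7 M 3) (x : M) :
    TangentSpace (𝓡 7) x →L[ℝ] TangentSpace (𝓡 7) x →L[ℝ] ℝ :=
  pullBilin (innerSL ℝ : ℝ⁷ →L[ℝ] ℝ⁷ →L[ℝ] ℝ) (g2Frame φ x : TangentSpace (𝓡 7) x →L[ℝ] ℝ⁷)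

theorem g2Bilin_apply (φ : FormField 7 M 3) (x : M) (v w : TangentSpace (𝓡 7) x) :
    g2Bilin φ x v w = g2Metric φ x v w := rfl

theorem g2Metric_comm (φ : FormField 7 M 3) (x : M) (v w : TangentSpace (𝓡 7) x) :
    g2Metric φ x v w = g2Metric φ x w v := real_inner_comm _ _

theorem g2Metric_pos (φ : FormField 7 M 3) (x : M) (v : TangentSpace (𝓡 7) x) (hv : v ≠ 0) :
    0 < g2Metric φ x v v :=
  real_inner_self_pos.2 fun h => hv ((g2Frame φ x).map_eq_zero_iff.1 h)

/-- The metric of a positive form, as a smooth Riemannian metric. -/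
noncomputable def g2Metric7 (φ : FormField 7 M 3) (hφ : IsPositiveForm φ) (hs : IsSmoothForm φ) :
    Metric7 M :=
  metric7OfSmooth (g2Bilin φ) (g2Metric_comm φ) (g2Metric_pos φ)
    (fun p u w => (g2Metric_contMDiffOn hφ hs p u w).contMDiffAt
      ((chartAt ℝ⁷ p).open_source.mem_nhds (mem_chart_source ℝ⁷ p)))

end Coassoc

namespace Coassoc

local notation "ℝ⁷" => EuclideanSpace ℝ (Fin 7)

/-! ### The geodesic equation in a vector space -/

section VectorCalculus

variable {E : Type*} [NormedAddCommGroup E] [NormedSpace ℝ E]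

/-- The Christoffel form `w ↦ Γ(v, v; w)` of a field `G` of bilinear forms. -/
noncomputable def christoffelForm (G : E → E →L[ℝ] E →L[ℝ] ℝ) (y v : E) : E →L[ℝ] ℝ :=
  fderiv ℝ G y v v - (2⁻¹ : ℝ) • ((fderiv ℝ G y).flip v).flip v

theorem christoffelForm_apply (G : E → E →L[ℝ] E →L[ℝ] ℝ) (y v w : E) :
    christoffelForm G y v w = fderiv ℝ G y v v w - 2⁻¹ * fderiv ℝ G y w v v := rfl

/-- The defect of a curve `c` at time `t` from being a geodesic of `G`. -/
noncomputable def geodesicDefect (G : E → E →L[ℝ] E →L[ℝ] ℝ) (c : ℝ → E) (t : ℝ) : E →L[ℝ] ℝ :=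
  G (c t) (deriv (deriv c) t) + christoffelForm G (c t) (deriv c t)

/-- If `F` is an isometry from `G` to `G'`, then the Christoffel forms differ by the second
derivative of `F`. -/
theorem christoffelForm_comp {G G' : E → E →L[ℝ] E →L[ℝ] ℝ} {F : E → E} {y : E}
    (hG : DifferentiableAt ℝ G y) (hG' : DifferentiableAt ℝ G' (F y)) (hF : ContDiffAt ℝ 2 F y)
    (hsymm : ∀ u v, G' (F y) u v = G' (F y) v u)
    (h : ∀ᶠ z in 𝓝 y, ∀ u v, G z u v = G' (F z) (fderiv ℝ F z u) (fderiv ℝ F z v)) (v w : E) :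
    christoffelForm G y v w = christoffelForm G' (F y) (fderiv ℝ F y v) (fderiv ℝ F y w)
      + G' (F y) (fderiv ℝ (fderiv ℝ F) y v v) (fderiv ℝ F y w) := by
  have hF1 : HasFDerivAt F (fderiv ℝ F y) y := (hF.differentiableAt (by norm_num)).hasFDerivAt
  have hF2 : HasFDerivAt (fderiv ℝ F) (fderiv ℝ (fderiv ℝ F) y) y :=
    ((hF.fderiv_right (m := 1) (by norm_num)).differentiableAt (by norm_num)).hasFDerivAt
  have hs : ∀ a b, fderiv ℝ (fderiv ℝ F) y a b = fderiv ℝ (fderiv ℝ F) y b a := fun a b =>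
    (hF.isSymmSndFDerivAt (by simp)).eq a b
  have key : ∀ a b u, fderiv ℝ G y u a b = fderiv ℝ G' (F y) (fderiv ℝ F y u) (fderiv ℝ F y a)
      (fderiv ℝ F y b) + G' (F y) (fderiv ℝ (fderiv ℝ F) y u a) (fderiv ℝ F y b)
      + G' (F y) (fderiv ℝ F y a) (fderiv ℝ (fderiv ℝ F) y u b) := by
    intro a b u
    have e1 : HasFDerivAt (fun z => G z a b) _ y :=
      (hG.hasFDerivAt.clm_apply (hasFDerivAt_const a y)).clm_apply (hasFDerivAt_const b y)
    have e2 : HasFDerivAt (fun z => G' (F z) (fderiv ℝ F z a) (fderiv ℝ F z b)) _ y :=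
      ((hG'.hasFDerivAt.comp y hF1).clm_apply (hF2.clm_apply (hasFDerivAt_const a y))).clm_apply
        (hF2.clm_apply (hasFDerivAt_const b y))
    have e3 := e1.unique (e2.congr_of_eventuallyEq (h.mono fun z hz => hz a b))
    have e4 := congrArg (fun l => l u) e3
    simp at e4
    linarith
  rw [christoffelForm_apply, christoffelForm_apply, key, key, hs w v,
    hsymm (fderiv ℝ F y v) (fderiv ℝ (fderiv ℝ F) y v w)]
  ring

/-- The defect in the geodesic equation is natural under local isometries. -/
theorem geodesicDefect_comp {G G' : E → E →L[ℝ] E →L[ℝ] ℝ} {F : E → E} {c : ℝ → E} {t : ℝ}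
    (hc : ContDiffAt ℝ 2 c t)
    (hG : DifferentiableAt ℝ G (c t)) (hG' : DifferentiableAt ℝ G' (F (c t)))
    (hF : ContDiffAt ℝ 2 F (c t)) (hsymm : ∀ u v, G' (F (c t)) u v = G' (F (c t)) v u)
    (h : ∀ᶠ z in 𝓝 (c t), ∀ u v, G z u v = G' (F z) (fderiv ℝ F z u) (fderiv ℝ F z v)) (w : E) :
    geodesicDefect G c t w = geodesicDefect G' (F ∘ c) t (fderiv ℝ F (c t) w) := by
  have hcd : ∀ᶠ s in 𝓝 t, ContDiffAt ℝ 2 c s := hc.eventually (by simp)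
  have hFd : ∀ᶠ s in 𝓝 t, ContDiffAt ℝ 2 F (c s) :=
    hc.continuousAt.eventually (hF.eventually (by simp))
  have h1 : deriv (F ∘ c) =ᶠ[𝓝 t] fun s => fderiv ℝ F (c s) (deriv c s) := by
    filter_upwards [hcd, hFd] with s hs hs'
    exact ((hs'.differentiableAt (by norm_num)).hasFDerivAt.comp_hasDerivAt s
      (hs.differentiableAt (by norm_num)).hasDerivAt).deriv
  have hF2 : HasFDerivAt (fderiv ℝ F) (fderiv ℝ (fderiv ℝ F) (c t)) (c t) :=
    ((hF.fderiv_right (m := 1) (by norm_num)).differentiableAt (by norm_num)).hasFDerivAt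
  have hc1 : HasDerivAt c (deriv c t) t := (hc.differentiableAt (by norm_num)).hasDerivAt
  have hc2 : HasDerivAt (deriv c) (deriv (deriv c) t) t := by
    have : ContDiffAt ℝ 1 (deriv c) t :=
      (hc.fderiv_right (m := 1) (by norm_num)).clm_apply contDiffAt_const
    exact (this.differentiableAt (by norm_num)).hasDerivAt
  have h2 : deriv (deriv (F ∘ c)) t = fderiv ℝ (fderiv ℝ F) (c t) (deriv c t) (deriv c t)
      + fderiv ℝ F (c t) (deriv (deriv c) t) := by
    rw [h1.deriv_eq]
    exact ((hF2.comp_hasDerivAt t hc1).clm_apply hc2).deriv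
  have h3 := christoffelForm_comp hG hG' hF hsymm h (deriv c t) w
  simp only [geodesicDefect, add_apply, Function.comp_apply] at h3 ⊢
  rw [h3, h2, h1.self_of_nhds, h.self_of_nhds, map_add, add_apply]
  ring

/-- Solutions of a smooth autonomous equation are smooth. -/
theorem contDiffOn_of_hasDerivAt {X : E → E} {Ω : Set E} (hX : ContDiffOn ℝ ∞ X Ω) {c : ℝ → E}
    {J : Set ℝ} (hJ : IsOpen J) (hc : ∀ t ∈ J, c t ∈ Ω ∧ HasDerivAt c (X (c t)) t) :
    ContDiffOn ℝ ∞ c J := by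
  rw [contDiffOn_infty]
  intro n
  induction n with
  | zero =>
    rw [Nat.cast_zero, contDiffOn_zero]
    exact fun t ht => (hc t ht).2.continuousAt.continuousWithinAt
  | succ n ih =>
    rw [Nat.cast_succ, contDiffOn_succ_iff_deriv_of_isOpen hJ]
    refine ⟨fun t ht => (hc t ht).2.differentiableAt.differentiableWithinAt, by simp, ?_⟩
    exact (((contDiffOn_infty.1 hX) n).comp ih fun t ht => (hc t ht).1).congr
      fun t ht => (hc t ht).2.deriv

variable [FiniteDimensional ℝ E]

/-- The acceleration of the geodesic of `G` with position `z.1` and velocity `z.2`. -/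
noncomputable def geodesicAccel (G : E → E →L[ℝ] E →L[ℝ] ℝ) (z : E × E) : E :=
  ContinuousLinearMap.inverse (G z.1) (-christoffelForm G z.1 z.2)

theorem exists_equiv_of_pos (B : E →L[ℝ] E →L[ℝ] ℝ) (hB : ∀ v, v ≠ 0 → 0 < B v v) :
    ∃ e : E ≃L[ℝ] (E →L[ℝ] ℝ), (e : E →L[ℝ] (E →L[ℝ] ℝ)) = B := by
  have hinj : Function.Injective B := by
    refine (injective_iff_map_eq_zero B).2 fun v hv => ?_
    by_contra h0
    have := hB v h0
    rw [hv] at this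
    simp at this
  have hfr : Module.finrank ℝ E = Module.finrank ℝ (E →L[ℝ] ℝ) := by
    rw [← (LinearMap.toContinuousLinearMap : (E →ₗ[ℝ] ℝ) ≃ₗ[ℝ] (E →L[ℝ] ℝ)).finrank_eq]
    exact (Subspace.dual_finrank_eq).symm
  refine ⟨(LinearEquiv.ofInjectiveOfFinrankEq (B : E →ₗ[ℝ] (E →L[ℝ] ℝ))
    hinj hfr).toContinuousLinearEquiv, ?_⟩
  ext; rfl

theorem eq_geodesicAccel_iff {G : E → E →L[ℝ] E →L[ℝ] ℝ} {y : E}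
    (hpos : ∀ v, v ≠ 0 → 0 < G y v v) (v a : E) :
    a = geodesicAccel G (y, v) ↔ G y a + christoffelForm G y v = 0 := by
  obtain ⟨e, he⟩ := exists_equiv_of_pos _ hpos
  have : geodesicAccel G (y, v) = e.symm (-christoffelForm G y v) := by
    simp only [geodesicAccel]
    rw [← he, ContinuousLinearMap.inverse_equiv]; rfl
  rw [this, ContinuousLinearEquiv.eq_symm_apply, eq_neg_iff_add_eq_zero, ← he]
  rfl

theorem contDiffOn_geodesicAccel {G : E → E →L[ℝ] E →L[ℝ] ℝ} {Ω : Set E} (hΩ : IsOpen Ω)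
    (hG : ContDiffOn ℝ ∞ G Ω) (hpos : ∀ y ∈ Ω, ∀ v, v ≠ 0 → 0 < G y v v) :
    ContDiffOn ℝ ∞ (geodesicAccel G) (Ω ×ˢ univ) := by
  have hfst : ContDiffOn ℝ ∞ (fun z : E × E => z.1) (Ω ×ˢ univ) := contDiff_fst.contDiffOn
  have hsnd : ContDiffOn ℝ ∞ (fun z : E × E => z.2) (Ω ×ˢ univ) := contDiff_snd.contDiffOn
  have hmaps : MapsTo (fun z : E × E => z.1) (Ω ×ˢ univ) Ω := fun z hz => hz.1
  have h1 : ContDiffOn ℝ ∞ (fun z : E × E => ContinuousLinearMap.inverse (G z.1)) (Ω ×ˢ univ) := by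
    intro z hz
    obtain ⟨e, he⟩ := exists_equiv_of_pos _ (hpos z.1 hz.1)
    have := contDiffAt_map_inverse (𝕜 := ℝ) (n := ∞) e
    rw [he] at this
    exact this.comp_contDiffWithinAt z ((hG.comp hfst hmaps) z hz)
  have hd := (hG.fderiv_of_isOpen hΩ (m := ∞) (by simp)).comp hfst hmaps
  have h2 : ContDiffOn ℝ ∞ (fun z : E × E => -christoffelForm G z.1 z.2) (Ω ×ˢ univ) := by
    refine ContDiffOn.neg (contDiffOn_clm_apply.2 fun w => ?_)
    simp only [christoffelForm_apply]
    refine ContDiffOn.sub (((hd.clm_apply hsnd).clm_apply hsnd).clm_apply contDiffOn_const)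
      (contDiffOn_const.mul (((hd.clm_apply contDiffOn_const).clm_apply hsnd).clm_apply hsnd))
  exact h1.clm_apply h2

/-- The acceleration is quadratic in the velocity; hence rescaled geodesics are geodesics, and the
derivative of the acceleration vanishes at velocity zero. -/
theorem geodesicAccel_smul (G : E → E →L[ℝ] E →L[ℝ] ℝ) (y v : E) (r : ℝ) :
    geodesicAccel G (y, r • v) = r ^ 2 • geodesicAccel G (y, v) := by
  have : christoffelForm G y (r • v) = r ^ 2 • christoffelForm G y v := by
    ext w
    simp only [christoffelForm_apply, map_smul, smul_apply, smul_eq_mul]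
    ring
  simp only [geodesicAccel]
  rw [this, ← map_smul, smul_neg]

/-- The first-order vector field whose integral curves are the geodesics with their velocities. -/
noncomputable def geodesicField (G : E → E →L[ℝ] E →L[ℝ] ℝ) (z : E × E) : E × E :=
  (z.2, geodesicAccel G z)

theorem geodesicField_zero (G : E → E →L[ℝ] E →L[ℝ] ℝ) (y : E) : geodesicField G (y, 0) = 0 := by
  have := geodesicAccel_smul G y 0 0
  simp only [smul_zero, zero_pow two_ne_zero, zero_smul] at this
  simp [geodesicField, this]

/-- The linearization of the geodesic field at a zero velocity is `(a, b) ↦ (b, 0)`, which is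
nilpotent of order two. -/
theorem hasFDerivAt_geodesicField {G : E → E →L[ℝ] E →L[ℝ] ℝ} {Ω : Set E} (hΩ : IsOpen Ω)
    (hG : ContDiffOn ℝ ∞ G Ω) (hpos : ∀ y ∈ Ω, ∀ v, v ≠ 0 → 0 < G y v v) {y : E} (hy : y ∈ Ω) :
    HasFDerivAt (geodesicField G) ((ContinuousLinearMap.snd ℝ E E).prod 0) (y, 0) := by
  have hd : DifferentiableAt ℝ (geodesicAccel G) (y, 0) :=
    ((contDiffOn_geodesicAccel hΩ hG hpos).contDiffAt
      ((hΩ.prod isOpen_univ).mem_nhds ⟨hy, mem_univ _⟩)).differentiableAt (by simp)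
  have hz : ∀ y, geodesicAccel G (y, 0) = 0 := fun y => (Prod.ext_iff.1 (geodesicField_zero G y)).2
  have h0 : fderiv ℝ (geodesicAccel G) (y, 0) = 0 := by
    refine ContinuousLinearMap.ext fun ⟨a, b⟩ => ?_
    have hl : ∀ a b : E, fderiv ℝ (geodesicAccel G) (y, 0) (a, b)
        = deriv (fun t : ℝ => geodesicAccel G (y + t • a, t • b)) 0 := by
      intro a b
      have hc : HasDerivAt (fun t : ℝ => (y + t • a, t • b)) (a, b) 0 := by
        refine HasDerivAt.prodMk ?_ ?_
        · simpa using ((hasDerivAt_id (0 : ℝ)).smul_const a).const_add y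
        · simpa using (hasDerivAt_id (0 : ℝ)).smul_const b
      have hd' : HasFDerivAt (geodesicAccel G) (fderiv ℝ (geodesicAccel G) (y, 0))
          (y + (0 : ℝ) • a, (0 : ℝ) • b) := by simpa using hd.hasFDerivAt
      exact (hd'.comp_hasDerivAt (0 : ℝ) hc).deriv.symm
    have h1 : fderiv ℝ (geodesicAccel G) (y, 0) (a, 0) = 0 := by
      rw [hl]; simp [hz]
    have h2 : fderiv ℝ (geodesicAccel G) (y, 0) (0, b) = 0 := by
      rw [hl]
      simp only [smul_zero, add_zero, geodesicAccel_smul]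
      simpa using (((hasDerivAt_id (0 : ℝ)).pow 2).smul_const (geodesicAccel G (y, b))).deriv
    have h3 : ((a, b) : E × E) = (a, 0) + (0, b) := by simp
    rw [h3, map_add, h1, h2]; simp
  exact (ContinuousLinearMap.snd ℝ E E).hasFDerivAt.prodMk (h0 ▸ hd.hasFDerivAt)

end VectorCalculus

end Coassoc

namespace Coassoc

local notation "ℝ⁷" => EuclideanSpace ℝ (Fin 7)

/-! ### Geodesics on a manifold -/

variable {M : Type*} [TopologicalSpace M] [ChartedSpace ℝ⁷ M] [IsManifold (𝓡 7) ∞ M]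

/-- The Gram form of a metric in the preferred chart at `p`. -/
noncomputable def gram (h : Metric7 M) (p : M) (y : ℝ⁷) : ℝ⁷ →L[ℝ] ℝ⁷ →L[ℝ] ℝ :=
  pullBilin (h.inner ((extChartAt (𝓡 7) p).symm y))
    (mfderiv (𝓡 7) (𝓡 7) (extChartAt (𝓡 7) p).symm y)

theorem gram_apply (h : Metric7 M) (p : M) (y u v : ℝ⁷) :
    gram h p y u v = metricInChart h p u v y := rfl

theorem gram_eq_tframe (h : Metric7 M) {p : M} {y : ℝ⁷} (hy : y ∈ (extChartAt (𝓡 7) p).target)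
    (u v : ℝ⁷) : gram h p y u v = h.inner ((extChartAt (𝓡 7) p).symm y)
      (tframe (𝓡 7) p ((extChartAt (𝓡 7) p).symm y) u)
      (tframe (𝓡 7) p ((extChartAt (𝓡 7) p).symm y) v) := by
  rw [tframe_symm hy]; rfl

theorem extChartAt_mem_target {p x : M} (hx : x ∈ (chartAt ℝ⁷ p).source) :
    extChartAt (𝓡 7) p x ∈ (extChartAt (𝓡 7) p).target :=
  (extChartAt (𝓡 7) p).map_source (by rwa [extChartAt_source])

theorem extChartAt_symm_extChartAt {p x : M} (hx : x ∈ (chartAt ℝ⁷ p).source) :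
    (extChartAt (𝓡 7) p).symm (extChartAt (𝓡 7) p x) = x :=
  (extChartAt (𝓡 7) p).left_inv (by rwa [extChartAt_source])

theorem inner_tframe_eq_gram (h : Metric7 M) {p x : M} (hx : x ∈ (chartAt ℝ⁷ p).source)
    (u v : ℝ⁷) : h.inner x (tframe (𝓡 7) p x u) (tframe (𝓡 7) p x v)
      = gram h p (extChartAt (𝓡 7) p x) u v := by
  rw [gram_eq_tframe h (extChartAt_mem_target hx), extChartAt_symm_extChartAt hx]

theorem inner_eq_gram (h : Metric7 M) {p x : M} (hx : x ∈ (chartAt ℝ⁷ p).source)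
    (v w : TangentSpace (𝓡 7) x) :
    h.inner x v w
      = gram h p (extChartAt (𝓡 7) p x) (tcoordL (𝓡 7) p x v) (tcoordL (𝓡 7) p x w) := by
  rw [← inner_tframe_eq_gram h hx, tframe_tcoordL hx, tframe_tcoordL hx]

theorem gram_symm (h : Metric7 M) (p : M) (y u v : ℝ⁷) : gram h p y u v = gram h p y v u :=
  h.symm _ _ _

theorem gram_pos (h : Metric7 M) {p : M} {y : ℝ⁷} (hy : y ∈ (extChartAt (𝓡 7) p).target)
    (v : ℝ⁷) (hv : v ≠ 0) : 0 < gram h p y v v := by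
  rw [gram_eq_tframe h hy]
  refine h.pos _ _ fun h0 => hv ?_
  have := tcoordL_tframe (I := 𝓡 7) (extChartAt_symm_mem_source hy) v
  rw [← this, h0, map_zero]

theorem contDiffOn_gram (h : Metric7 M) (p : M) :
    ContDiffOn ℝ ∞ (gram h p) (extChartAt (𝓡 7) p).target := by
  refine contDiffOn_clm_apply.2 fun u => contDiffOn_clm_apply.2 fun v => ?_
  have h1 : ContMDiffOn (𝓡 7) (𝓡 7) ∞ (extChartAt (𝓡 7) p).symm (extChartAt (𝓡 7) p).target :=
    contMDiffOn_extChartAt_symm p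
  have h2 : ContMDiffOn (𝓡 7) 𝓘(ℝ, ℝ) ∞ (fun y => h.inner ((extChartAt (𝓡 7) p).symm y)
      (tframe (𝓡 7) p ((extChartAt (𝓡 7) p).symm y) u)
      (tframe (𝓡 7) p ((extChartAt (𝓡 7) p).symm y) v)) (extChartAt (𝓡 7) p).target := fun y hy =>
    metric7_contMDiffWithinAt h
      (contMDiffWithinAt_tframe (extChartAt_symm_mem_source hy) (h1 y hy) contMDiffWithinAt_const)
      (contMDiffWithinAt_tframe (extChartAt_symm_mem_source hy) (h1 y hy) contMDiffWithinAt_const)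
  exact (contMDiffOn_iff_contDiffOn.1 h2).congr fun y hy => gram_eq_tframe h hy u v

theorem differentiableAt_gram (h : Metric7 M) {p : M} {y : ℝ⁷}
    (hy : y ∈ (extChartAt (𝓡 7) p).target) : DifferentiableAt ℝ (gram h p) y :=
  ((contDiffOn_gram h p).contDiffAt ((isOpen_extChartAt_target p).mem_nhds hy)).differentiableAt
    (by simp)

theorem christoffel_eq (h : Metric7 M) {p : M} {y : ℝ⁷} (hy : y ∈ (extChartAt (𝓡 7) p).target)
    (v w : ℝ⁷) : christoffel h p v v w y = christoffelForm (gram h p) y v w := by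
  have key : ∀ a b u, fderiv ℝ (metricInChart h p a b) y u = fderiv ℝ (gram h p) y u a b := by
    intro a b u
    have e1 : HasFDerivAt (fun z => gram h p z a b) _ y :=
      ((differentiableAt_gram h hy).hasFDerivAt.clm_apply (hasFDerivAt_const a y)).clm_apply
        (hasFDerivAt_const b y)
    rw [show metricInChart h p a b = fun z => gram h p z a b from rfl, e1.fderiv]
    simp
  rw [christoffel, key, key, christoffelForm_apply]
  ring

/-- The geodesic equation of `γ` at time `t`, in all preferred charts. -/
def IsGeodesicAt (h : Metric7 M) (γ : ℝ → M) (t : ℝ) : Prop :=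
  ∀ p : M, γ t ∈ (chartAt ℝ⁷ p).source →
    geodesicDefect (gram h p) (fun s => extChartAt (𝓡 7) p (γ s)) t = 0

theorem isGeodesicOn_iff {h : Metric7 M} {γ : ℝ → M} {J : Set ℝ} :
    IsGeodesicOn h γ J ↔ ContMDiffOn 𝓘(ℝ, ℝ) (𝓡 7) ∞ γ J ∧ ∀ t ∈ J, IsGeodesicAt h γ t := by
  refine and_congr_right fun _ => forall₂_congr fun t _ => forall₂_congr fun p hp => ?_
  rw [ContinuousLinearMap.ext_iff]
  refine forall_congr' fun w => ?_
  rw [← gram_apply, christoffel_eq h (extChartAt_mem_target hp)]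
  rfl

theorem contDiffAt_chart_comp {γ : ℝ → M} {t : ℝ} {p : M}
    (hγ : ContMDiffAt 𝓘(ℝ, ℝ) (𝓡 7) ∞ γ t) (hp : γ t ∈ (chartAt ℝ⁷ p).source) :
    ContDiffAt ℝ ∞ (fun s => extChartAt (𝓡 7) p (γ s)) t :=
  ((contMDiffAt_extChartAt' hp).comp t hγ).contDiffAt

theorem two_le_infty : (2 : WithTop ℕ∞) ≤ ∞ := by
  exact WithTop.coe_le_coe.2 (le_top : (2 : ℕ∞) ≤ ⊤)

/-- Local isometries preserve the geodesic equation. For the identity this is the independence of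
the chart. -/
theorem geodesicDefect_isometry {h : Metric7 M} {f : M → M} {γ : ℝ → M} {t : ℝ} {p q : M}
    (hf : ContMDiffAt (𝓡 7) (𝓡 7) ∞ f (γ t))
    (hiso : ∀ᶠ x in 𝓝 (γ t), ∀ u v : TangentSpace (𝓡 7) x, h.inner x u v
      = h.inner (f x) (mfderiv (𝓡 7) (𝓡 7) f x u) (mfderiv (𝓡 7) (𝓡 7) f x v))
    (hγ : ContMDiffAt 𝓘(ℝ, ℝ) (𝓡 7) ∞ γ t)
    (hp : γ t ∈ (chartAt ℝ⁷ p).source) (hq : f (γ t) ∈ (chartAt ℝ⁷ q).source)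
    (hg : geodesicDefect (gram h p) (fun s => extChartAt (𝓡 7) p (γ s)) t = 0) :
    geodesicDefect (gram h q) (fun s => extChartAt (𝓡 7) q (f (γ s))) t = 0 := by
  set ξ := extChartAt (𝓡 7) p with hξ
  set F : ℝ⁷ → ℝ⁷ := fun y => extChartAt (𝓡 7) q (f (ξ.symm y)) with hF
  set c : ℝ → ℝ⁷ := fun s => ξ (γ s) with hc
  have hct : c t ∈ ξ.target := extChartAt_mem_target hp
  have hxc : ξ.symm (c t) = γ t := extChartAt_symm_extChartAt hp
  have hsymm : ∀ y ∈ ξ.target, ContMDiffAt (𝓡 7) (𝓡 7) ∞ ξ.symm y := fun y hy =>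
    (contMDiffOn_extChartAt_symm p).contMDiffAt ((isOpen_extChartAt_target p).mem_nhds hy)
  have hFc : ContDiffAt ℝ ∞ F (c t) := by
    have h1 : ContMDiffAt (𝓡 7) (𝓡 7) ∞ (f ∘ ξ.symm) (c t) :=
      ContMDiffAt.comp (c t) (by rw [hxc]; exact hf) (hsymm _ hct)
    exact (ContMDiffAt.comp (c t) (contMDiffAt_extChartAt' (by
      rw [Function.comp_apply, hxc]; exact hq)) h1).contDiffAt
  have hcd : ContDiffAt ℝ ∞ c t := contDiffAt_chart_comp hγ hp
  -- near `c t`, the map `F` is an isometry of the Gram forms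
  have hnear : ∀ᶠ z in 𝓝 (c t), ∀ u v, gram h p z u v
      = gram h q (F z) (fderiv ℝ F z u) (fderiv ℝ F z v) := by
    have hcont : Tendsto ξ.symm (𝓝 (c t)) (𝓝 (γ t)) := by
      have := (hsymm _ hct).continuousAt
      rwa [ContinuousAt, hxc] at this
    have e1 : ∀ᶠ x in 𝓝 (γ t), ContMDiffAt (𝓡 7) (𝓡 7) 1 f x :=
      (contMDiffAt_iff_contMDiffAt_nhds (by simp)).1 (hf.of_le (by simp))
    have e2 : ∀ᶠ x in 𝓝 (γ t), f x ∈ (chartAt ℝ⁷ q).source :=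
      hf.continuousAt.eventually ((chartAt ℝ⁷ q).open_source.mem_nhds hq)
    filter_upwards [hcont.eventually e1, hcont.eventually e2, hcont.eventually hiso,
      (isOpen_extChartAt_target p).mem_nhds hct] with z h1 h2 h3 hz u v
    have hd : ∀ u, fderiv ℝ F z u = tcoordL (𝓡 7) q (f (ξ.symm z))
        (mfderiv (𝓡 7) (𝓡 7) f (ξ.symm z) (tframe (𝓡 7) p (ξ.symm z) u)) := by
      intro u
      have a1 : HasMFDerivAt (𝓡 7) (𝓡 7) (extChartAt (𝓡 7) q) (f (ξ.symm z)) _ :=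
        ((contMDiffAt_extChartAt' (n := ∞) h2).mdifferentiableAt (by simp)).hasMFDerivAt
      have a2 := (h1.mdifferentiableAt (by simp)).hasMFDerivAt
      have a3 := ((hsymm z hz).mdifferentiableAt (by simp)).hasMFDerivAt
      have a4 : HasMFDerivAt (𝓡 7) (𝓡 7) F z _ := (a1.comp _ a2).comp z a3
      rw [← mfderiv_eq_fderiv, a4.mfderiv, tframe_symm hz]
      rfl
    rw [gram_eq_tframe h hz, h3, inner_eq_gram h h2, hd, hd]
  have hFt : F (c t) ∈ (extChartAt (𝓡 7) q).target := by
    simp only [hF, hxc]; exact extChartAt_mem_target hq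
  have key := geodesicDefect_comp (hcd.of_le two_le_infty) (differentiableAt_gram h hct)
    (differentiableAt_gram h hFt) (hFc.of_le two_le_infty) (gram_symm h q _) hnear
  have heq : (fun s => extChartAt (𝓡 7) q (f (γ s))) =ᶠ[𝓝 t] F ∘ c := by
    filter_upwards [hγ.continuousAt.eventually ((chartAt ℝ⁷ p).open_source.mem_nhds hp)] with s hs
    simp only [hF, hc, Function.comp_apply]
    rw [extChartAt_symm_extChartAt hs]
  have heq' : geodesicDefect (gram h q) (fun s => extChartAt (𝓡 7) q (f (γ s))) t
      = geodesicDefect (gram h q) (F ∘ c) t := by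
    simp only [geodesicDefect]
    rw [heq.deriv.deriv_eq, heq.deriv_eq, ← heq.self_of_nhds]
  have hinj : Function.Injective (fderiv ℝ F (c t)) := by
    refine (injective_iff_map_eq_zero _).2 fun u hu => ?_
    by_contra h0
    have := gram_pos h hct u h0
    rw [hnear.self_of_nhds u u, hu] at this
    simp at this
  have hsurj : Function.Surjective (fderiv ℝ F (c t)) :=
    LinearMap.injective_iff_surjective.1
      (show Function.Injective (fderiv ℝ F (c t) : ℝ⁷ →ₗ[ℝ] ℝ⁷) from hinj)
  rw [heq']
  ext w
  obtain ⟨u, rfl⟩ := hsurj w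
  rw [← key u, hg]
  rfl

end Coassoc

namespace Coassoc

local notation "ℝ⁷" => EuclideanSpace ℝ (Fin 7)

variable {M : Type*} [TopologicalSpace M] [ChartedSpace ℝ⁷ M] [IsManifold (𝓡 7) ∞ M]

/-! ### Uniqueness of geodesics and the exponential map -/

theorem tcoord_velocity {γ : ℝ → M} {t : ℝ} {p : M} (hγ : MDifferentiableAt 𝓘(ℝ, ℝ) (𝓡 7) γ t)
    (hp : γ t ∈ (chartAt ℝ⁷ p).source) :
    tcoord (𝓡 7) p (velocity γ t) = deriv (fun s => extChartAt (𝓡 7) p (γ s)) t := by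
  have a1 : HasMFDerivAt (𝓡 7) (𝓡 7) (extChartAt (𝓡 7) p) (γ t) _ :=
    ((contMDiffAt_extChartAt' (n := ∞) hp).mdifferentiableAt (by simp)).hasMFDerivAt
  have a2 : HasMFDerivAt 𝓘(ℝ, ℝ) (𝓡 7) (fun s => extChartAt (𝓡 7) p (γ s)) t _ :=
    a1.comp t hγ.hasMFDerivAt
  rw [← fderiv_apply_one_eq_deriv, ← mfderiv_eq_fderiv, a2.mfderiv]
  rfl

/-- Tangent vectors at the same point of a chart domain agree if their coordinates agree. -/
theorem tangentBundle_ext {p : M} {v w : TangentBundle (𝓡 7) M} (h1 : v.1 = w.1)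
    (hp : v.1 ∈ (chartAt ℝ⁷ p).source) (h2 : tcoord (𝓡 7) p v = tcoord (𝓡 7) p w) : v = w := by
  rw [← tpoint_tpair (p := p) (v := v) hp, ← tpoint_tpair (p := p) (v := w) (h1 ▸ hp)]
  congr 1
  exact Prod.ext (congrArg (extChartAt (𝓡 7) p) h1) h2

/-- An integral curve of the geodesic field of a chart is a geodesic with its velocity. -/
theorem isGeodesicOn_of_hasDerivAt {h : Metric7 M} {p : M} {c : ℝ → ℝ⁷ × ℝ⁷} {J : Set ℝ}
    (hJ : IsOpen J) (hc : ∀ t ∈ J, (c t).1 ∈ (extChartAt (𝓡 7) p).target ∧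
      HasDerivAt c (geodesicField (gram h p) (c t)) t) :
    IsGeodesicOn h (fun t => (extChartAt (𝓡 7) p).symm (c t).1) J ∧
      ∀ t ∈ J, velocity (fun t => (extChartAt (𝓡 7) p).symm (c t).1) t = tpoint p (c t) := by
  set Ω := (extChartAt (𝓡 7) p).target with hΩ
  have hΩo : IsOpen Ω := isOpen_extChartAt_target p
  have hfield : ContDiffOn ℝ ∞ (geodesicField (gram h p)) (Ω ×ˢ univ) :=
    contDiff_snd.contDiffOn.prodMk
      (contDiffOn_geodesicAccel hΩo (contDiffOn_gram h p) fun y hy => gram_pos h hy)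
  have hcs : ContDiffOn ℝ ∞ c J :=
    contDiffOn_of_hasDerivAt hfield hJ fun t ht => ⟨⟨(hc t ht).1, mem_univ _⟩, (hc t ht).2⟩
  set γ : ℝ → M := fun t => (extChartAt (𝓡 7) p).symm (c t).1 with hγ
  have hγs : ContMDiffOn 𝓘(ℝ, ℝ) (𝓡 7) ∞ γ J :=
    (contMDiffOn_extChartAt_symm p).comp (contDiff_fst.comp_contDiffOn hcs).contMDiffOn
      fun t ht => (hc t ht).1
  have hγp : ∀ t ∈ J, γ t ∈ (chartAt ℝ⁷ p).source := fun t ht =>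
    extChartAt_symm_mem_source (hc t ht).1
  have hξγ : ∀ t ∈ J, (fun s => extChartAt (𝓡 7) p (γ s)) =ᶠ[𝓝 t] fun s => (c s).1 := fun t ht => by
    filter_upwards [hJ.mem_nhds ht] with s hs
    exact (extChartAt (𝓡 7) p).right_inv (hc s hs).1
  have hd1 : ∀ t ∈ J, HasDerivAt (fun s => (c s).1) (c t).2 t := fun t ht => by
    have := (hasFDerivAt_fst (𝕜 := ℝ) (p := c t)).comp_hasDerivAt t (hc t ht).2
    exact this
  have hd2 : ∀ t ∈ J, HasDerivAt (fun s => (c s).2) (geodesicAccel (gram h p) (c t)) t :=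
    fun t ht => by
      have := (hasFDerivAt_snd (𝕜 := ℝ) (p := c t)).comp_hasDerivAt t (hc t ht).2
      exact this
  have hder : ∀ t ∈ J, deriv (fun s => extChartAt (𝓡 7) p (γ s)) t = (c t).2 := fun t ht => by
    rw [(hξγ t ht).deriv_eq, (hd1 t ht).deriv]
  have hder' : ∀ t ∈ J, deriv (fun s => extChartAt (𝓡 7) p (γ s)) =ᶠ[𝓝 t] fun s => (c s).2 :=
    fun t ht => by
      filter_upwards [hJ.mem_nhds ht] with s hs using hder s hs
  refine ⟨isGeodesicOn_iff.2 ⟨hγs, fun t ht q hq => ?_⟩, fun t ht => ?_⟩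
  · refine geodesicDefect_isometry (f := id) (p := p) contMDiffAt_id
      (Eventually.of_forall fun x u v => ?_) (hγs.contMDiffAt (hJ.mem_nhds ht)) (hγp t ht) hq ?_
    · rw [mfderiv_id]; rfl
    · simp only [geodesicDefect]
      rw [(hder' t ht).deriv_eq, (hd2 t ht).deriv, hder t ht]
      exact (eq_geodesicAccel_iff (gram_pos h (extChartAt_mem_target (hγp t ht))) _ _).1
        (congrArg (fun y => geodesicAccel (gram h p) (y, (c t).2)) (hξγ t ht).self_of_nhds.symm)
  · refine tangentBundle_ext rfl (hγp t ht) ?_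
    rw [tcoord_velocity ((hγs.contMDiffAt (hJ.mem_nhds ht)).mdifferentiableAt (by simp))
      (hγp t ht), hder t ht]
    exact (tcoordL_tframe (hγp t ht) _).symm

/-- `γ` is a geodesic near the time `t`. -/
def IsLocalGeodesicAt (h : Metric7 M) (γ : ℝ → M) (t : ℝ) : Prop :=
  ∀ᶠ s in 𝓝 t, ContMDiffAt 𝓘(ℝ, ℝ) (𝓡 7) ∞ γ s ∧ IsGeodesicAt h γ s

theorem IsGeodesicOn.isLocalGeodesicAt {h : Metric7 M} {γ : ℝ → M} {J : Set ℝ}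
    (hγ : IsGeodesicOn h γ J) (hJ : IsOpen J) {t : ℝ} (ht : t ∈ J) : IsLocalGeodesicAt h γ t := by
  rw [isGeodesicOn_iff] at hγ
  filter_upwards [hJ.mem_nhds ht] with s hs
  exact ⟨hγ.1.contMDiffAt (hJ.mem_nhds hs), hγ.2 s hs⟩

theorem IsLocalGeodesicAt.contMDiffAt {h : Metric7 M} {γ : ℝ → M} {t : ℝ}
    (hγ : IsLocalGeodesicAt h γ t) : ContMDiffAt 𝓘(ℝ, ℝ) (𝓡 7) ∞ γ t := hγ.self_of_nhds.1

/-- The lift of a geodesic to the tangent bundle is an integral curve of the geodesic field. -/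
theorem IsLocalGeodesicAt.hasDerivAt {h : Metric7 M} {γ : ℝ → M} {t : ℝ} {p : M}
    (hγ : IsLocalGeodesicAt h γ t) (hp : γ t ∈ (chartAt ℝ⁷ p).source) :
    HasDerivAt (fun s => (extChartAt (𝓡 7) p (γ s), deriv (fun s => extChartAt (𝓡 7) p (γ s)) s))
      (geodesicField (gram h p)
        (extChartAt (𝓡 7) p (γ t), deriv (fun s => extChartAt (𝓡 7) p (γ s)) t)) t := by
  have hc := contDiffAt_chart_comp hγ.contMDiffAt hp
  have hc1 := (hc.differentiableAt (by simp)).hasDerivAt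
  have hc2 : ContDiffAt ℝ 1 (deriv fun s => extChartAt (𝓡 7) p (γ s)) t :=
    (hc.fderiv_right (m := 1) two_le_infty).clm_apply contDiffAt_const
  have h2 := (eq_geodesicAccel_iff (gram_pos h (extChartAt_mem_target hp)) _ _).2
    (hγ.self_of_nhds.2 p hp)
  have h3 := (hc2.differentiableAt (by simp)).hasDerivAt
  rw [h2] at h3
  exact hc1.prodMk h3

/-- Geodesics with the same velocity at one time agree near that time. -/
theorem IsLocalGeodesicAt.eventuallyEq {h : Metric7 M} {γ₁ γ₂ : ℝ → M} {t : ℝ}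
    (h₁ : IsLocalGeodesicAt h γ₁ t) (h₂ : IsLocalGeodesicAt h γ₂ t)
    (hv : velocity γ₁ t = velocity γ₂ t) : γ₁ =ᶠ[𝓝 t] γ₂ := by
  set p := γ₁ t with hp
  have hx : γ₂ t = p := (congrArg TotalSpace.proj hv).symm
  have hp₁ : γ₁ t ∈ (chartAt ℝ⁷ p).source := mem_chart_source _ _
  have hp₂ : γ₂ t ∈ (chartAt ℝ⁷ p).source := by
    rw [hx]; exact mem_chart_source _ _
  have hd : deriv (fun s => extChartAt (𝓡 7) p (γ₁ s)) t
      = deriv (fun s => extChartAt (𝓡 7) p (γ₂ s)) t := by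
    rw [← tcoord_velocity (h₁.contMDiffAt.mdifferentiableAt (by simp)) hp₁,
      ← tcoord_velocity (h₂.contMDiffAt.mdifferentiableAt (by simp)) hp₂, hv]
  set Ω := (extChartAt (𝓡 7) p).target with hΩ
  have hΩo : IsOpen Ω := isOpen_extChartAt_target p
  have hfield : ContDiffOn ℝ ∞ (geodesicField (gram h p)) (Ω ×ˢ univ) :=
    contDiff_snd.contDiffOn.prodMk
      (contDiffOn_geodesicAccel hΩo (contDiffOn_gram h p) fun y hy => gram_pos h hy)
  set z : ℝ⁷ × ℝ⁷ := (extChartAt (𝓡 7) p (γ₁ t), deriv (fun s => extChartAt (𝓡 7) p (γ₁ s)) t)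
    with hz
  have hzd : ContDiffAt ℝ 1 (geodesicField (gram h p)) z :=
    (hfield.contDiffAt ((hΩo.prod isOpen_univ).mem_nhds
      ⟨extChartAt_mem_target hp₁, mem_univ _⟩)).of_le (by simp)
  obtain ⟨K, U, hU, hK⟩ := hzd.exists_lipschitzOnWith
  have key : ∀ {γ : ℝ → M}, IsLocalGeodesicAt h γ t → γ t ∈ (chartAt ℝ⁷ p).source →
      (extChartAt (𝓡 7) p (γ t), deriv (fun s => extChartAt (𝓡 7) p (γ s)) t) = z →
      ∀ᶠ s in 𝓝 t, HasDerivAt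
        (fun s => (extChartAt (𝓡 7) p (γ s), deriv (fun s => extChartAt (𝓡 7) p (γ s)) s))
        (geodesicField (gram h p)
          (extChartAt (𝓡 7) p (γ s), deriv (fun s => extChartAt (𝓡 7) p (γ s)) s)) s ∧
        (extChartAt (𝓡 7) p (γ s), deriv (fun s => extChartAt (𝓡 7) p (γ s)) s) ∈ U := by
    intro γ hγ hγp hγz
    have hcont := (hγ.hasDerivAt hγp).continuousAt
    rw [ContinuousAt, hγz] at hcont
    filter_upwards [hγ.eventually_nhds, hcont.eventually hU,
      hγ.contMDiffAt.continuousAt.eventually ((chartAt ℝ⁷ p).open_source.mem_nhds hγp)]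
      with s hs hsU hsp
    exact ⟨IsLocalGeodesicAt.hasDerivAt hs hsp, hsU⟩
  have hz₂ : (extChartAt (𝓡 7) p (γ₂ t), deriv (fun s => extChartAt (𝓡 7) p (γ₂ s)) t) = z := by
    rw [hz, hd, hx]
  have hu := ODE_solution_unique_of_eventually (v := fun _ => geodesicField (gram h p))
    (s := fun _ => U) (K := K) (t₀ := t) (Eventually.of_forall fun _ => hK) (key h₁ hp₁ rfl)
    (key h₂ hp₂ hz₂) (hz₂ ▸ rfl)
  filter_upwards [hu, h₁.contMDiffAt.continuousAt.eventually
    ((chartAt ℝ⁷ p).open_source.mem_nhds hp₁), h₂.contMDiffAt.continuousAt.eventually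
    ((chartAt ℝ⁷ p).open_source.mem_nhds hp₂)] with s hs hs₁ hs₂
  rw [← extChartAt_symm_extChartAt hs₁, ← extChartAt_symm_extChartAt hs₂]
  exact congrArg _ (Prod.ext_iff.1 hs).1

/-- The velocity of a smooth curve depends continuously on time. -/
theorem continuousAt_tcoord_velocity {γ : ℝ → M} {t : ℝ} {p : M}
    (hγ : ∀ᶠ s in 𝓝 t, ContMDiffAt 𝓘(ℝ, ℝ) (𝓡 7) ∞ γ s) (hp : γ t ∈ (chartAt ℝ⁷ p).source) :
    ContinuousAt (fun s => tcoord (𝓡 7) p (velocity γ s)) t := by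
  have hc := contDiffAt_chart_comp hγ.self_of_nhds hp
  have hc2 : ContDiffAt ℝ 1 (deriv fun s => extChartAt (𝓡 7) p (γ s)) t :=
    (hc.fderiv_right (m := 1) two_le_infty).clm_apply contDiffAt_const
  refine hc2.continuousAt.congr ?_
  filter_upwards [hγ, hγ.self_of_nhds.continuousAt.eventually
    ((chartAt ℝ⁷ p).open_source.mem_nhds hp)] with s hs hsp
  exact (tcoord_velocity (hs.mdifferentiableAt (by simp)) hsp).symm

/-- Geodesics with the same velocity at one time agree. -/
theorem IsGeodesicOn.eqOn [T2Space M] {h : Metric7 M} {γ₁ γ₂ : ℝ → M} {J : Set ℝ} (hJ : IsOpen J)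
    (hJc : IsPreconnected J) (h₁ : IsGeodesicOn h γ₁ J) (h₂ : IsGeodesicOn h γ₂ J) {t₀ : ℝ}
    (ht₀ : t₀ ∈ J) (hv : velocity γ₁ t₀ = velocity γ₂ t₀) : EqOn γ₁ γ₂ J := by
  have hsub : J ⊆ {t | γ₁ =ᶠ[𝓝 t] γ₂} := by
    refine hJc.subset_of_closure_inter_subset (isOpen_iff_mem_nhds.2 fun t ht => ?_)
      ⟨t₀, ht₀, (h₁.isLocalGeodesicAt hJ ht₀).eventuallyEq (h₂.isLocalGeodesicAt hJ ht₀) hv⟩ ?_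
    · exact Filter.Eventually.eventually_nhds ht
    · rintro t ⟨htc, ht⟩
      have l₁ := h₁.isLocalGeodesicAt hJ ht
      have l₂ := h₂.isLocalGeodesicAt hJ ht
      have hfreq : ∃ᶠ s in 𝓝 t, γ₁ =ᶠ[𝓝 s] γ₂ := mem_closure_iff_frequently.1 htc
      have hx : γ₁ t = γ₂ t := by
        by_contra hne
        have := (l₁.contMDiffAt.continuousAt.ne_iff_eventually_ne
          l₂.contMDiffAt.continuousAt).1 hne
        obtain ⟨s, hs, hs'⟩ := (hfreq.and_eventually this).exists
        exact hs' hs.self_of_nhds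
      have hp : γ₁ t ∈ (chartAt ℝ⁷ (γ₁ t)).source := mem_chart_source _ _
      have hp' : γ₂ t ∈ (chartAt ℝ⁷ (γ₁ t)).source := by rw [← hx]; exact hp
      have c₁ := continuousAt_tcoord_velocity (l₁.mono fun s hs => hs.1) hp
      have c₂ := continuousAt_tcoord_velocity (l₂.mono fun s hs => hs.1) hp'
      have hveq : ∀ s, γ₁ =ᶠ[𝓝 s] γ₂ → velocity γ₁ s = velocity γ₂ s := fun s hs => by
        simp only [velocity]
        rw [hs.mfderiv_eq, hs.self_of_nhds]
      have hvt : velocity γ₁ t = velocity γ₂ t := by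
        refine tangentBundle_ext (p := γ₁ t) hx hp ?_
        by_contra hne
        have := (c₁.ne_iff_eventually_ne c₂).1 hne
        obtain ⟨s, hs, hs'⟩ := (hfreq.and_eventually this).exists
        exact hs' (by rw [hveq s hs])
      exact l₁.eventuallyEq l₂ hvt
  exact fun t ht => (hsub ht).self_of_nhds

/-- The value of `expMap` does not depend on the geodesic that is chosen in its definition. -/
theorem expMap_eq [T2Space M] {h : Metric7 M} {v : TangentBundle (𝓡 7) M} {γ : ℝ → M}
    (hγ : IsExpCurve h v γ) : expMap h v = γ 1 := by
  have hex : ∃ γ, IsExpCurve h v γ := ⟨γ, hγ⟩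
  have : expMap h v = hex.choose 1 := dif_pos hex
  rw [this]
  obtain ⟨⟨δ₁, hδ₁, g₁⟩, v₁⟩ := hex.choose_spec
  obtain ⟨⟨δ₂, hδ₂, g₂⟩, v₂⟩ := hγ
  set δ := min δ₁ δ₂
  have hδ : 0 < δ := lt_min hδ₁ hδ₂
  have hmono : ∀ {η γ}, δ ≤ η → IsGeodesicOn h γ (Ioo (-η) (1 + η)) →
      IsGeodesicOn h γ (Ioo (-δ) (1 + δ)) := fun hle hg => by
    have hss : Ioo (-δ) (1 + δ) ⊆ Ioo (-_) (1 + _) := Ioo_subset_Ioo (neg_le_neg hle) (by linarith)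
    exact ⟨hg.1.mono hss, fun t ht => hg.2 t (hss ht)⟩
  exact IsGeodesicOn.eqOn isOpen_Ioo isPreconnected_Ioo (hmono (min_le_left _ _) g₁)
    (hmono (min_le_right _ _) g₂) (t₀ := 0) ⟨by linarith, by linarith⟩ (v₁.trans v₂.symm)
    ⟨by linarith, by linarith⟩

theorem isExpCurve_const (h : Metric7 M) (x : M) :
    IsExpCurve h (⟨x, 0⟩ : TangentBundle (𝓡 7) M) fun _ => x := by
  have hx : x ∈ (chartAt ℝ⁷ x).source := mem_chart_source _ _
  have key := isGeodesicOn_of_hasDerivAt (h := h) (p := x) (J := univ)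
    (c := fun _ => (extChartAt (𝓡 7) x x, 0)) isOpen_univ fun t _ => by
      rw [geodesicField_zero]
      exact ⟨extChartAt_mem_target hx, hasDerivAt_const _ _⟩
  simp only [extChartAt_symm_extChartAt hx] at key
  refine ⟨⟨1, one_pos, key.1.1.mono (subset_univ _), fun t _ => key.1.2 t (mem_univ _)⟩, ?_⟩
  refine tangentBundle_ext (p := x) rfl hx ?_
  rw [tcoord_velocity mdifferentiableAt_const hx, deriv_const]
  exact (map_zero (tcoordL (𝓡 7) x x)).symm

theorem expMap_zero [T2Space M] (h : Metric7 M) (x : M) :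
    expMap h (⟨x, 0⟩ : TangentBundle (𝓡 7) M) = x := expMap_eq (isExpCurve_const h x)

/-- Near a zero vector the exponential map is defined and smooth, and its differential there is
the sum of the base and the fibre components. -/
theorem exists_expMap_local [T2Space M] (h : Metric7 M) (p : M) :
    ∃ O : Set (TangentBundle (𝓡 7) M), IsOpen O ∧ (⟨p, 0⟩ : TangentBundle (𝓡 7) M) ∈ O ∧
      O ⊆ {v | v.1 ∈ (chartAt ℝ⁷ p).source} ∧ O ⊆ expDomain h ∧
      ContMDiffOn (𝓡 7).tangent (𝓡 7) ∞ (expMap h) O ∧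
      HasFDerivAt (fun z => extChartAt (𝓡 7) p (expMap h (tpoint p z)))
        (ContinuousLinearMap.fst ℝ ℝ⁷ ℝ⁷ + ContinuousLinearMap.snd ℝ ℝ⁷ ℝ⁷)
        (extChartAt (𝓡 7) p p, 0) := by
  set Ω := (extChartAt (𝓡 7) p).target with hΩ
  have hΩo : IsOpen Ω := isOpen_extChartAt_target p
  have hp : p ∈ (chartAt ℝ⁷ p).source := mem_chart_source _ _
  have hfield : ContDiffOn ℝ ∞ (geodesicField (gram h p)) (Ω ×ˢ univ) :=
    contDiff_snd.contDiffOn.prodMk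
      (contDiffOn_geodesicAccel hΩo (contDiffOn_gram h p) fun y hy => gram_pos h hy)
  set z₀ : ℝ⁷ × ℝ⁷ := (extChartAt (𝓡 7) p p, 0) with hz₀
  obtain ⟨ε, hε, U, hU, hz₀U, c, hc, hcs, hcd⟩ := exists_flow_of_contDiffOn
    (hΩo.prod isOpen_univ) hfield (x₀ := z₀) ⟨extChartAt_mem_target hp, mem_univ _⟩
    (geodesicField_zero _ _)
    (hasFDerivAt_geodesicField hΩo (contDiffOn_gram h p) (fun y hy => gram_pos h hy)
      (extChartAt_mem_target hp)) (fun v => by ext <;> simp)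
  -- the flow of the scaled field reaches time one; the fibre coordinate is scaled accordingly
  set σ : ℝ⁷ × ℝ⁷ →L[ℝ] ℝ⁷ × ℝ⁷ := (ContinuousLinearMap.fst ℝ ℝ⁷ ℝ⁷).prod
    (ε⁻¹ • ContinuousLinearMap.snd ℝ ℝ⁷ ℝ⁷) with hσ
  set O : Set (TangentBundle (𝓡 7) M) := {v | v.1 ∈ (chartAt ℝ⁷ p).source} ∩
    (fun v => σ (tpair p v)) ⁻¹' U with hO
  have hσ₀ : σ z₀ = z₀ := by simp [hσ, hz₀]
  have hexp : ∀ v ∈ O, IsExpCurve h v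
      fun t => (extChartAt (𝓡 7) p).symm (c (σ (tpair p v)) t).1 := by
    intro v hv
    obtain ⟨hc0, hct⟩ := hc _ hv.2
    set z := σ (tpair p v) with hz
    have key := isGeodesicOn_of_hasDerivAt (h := h) (p := p) (J := Ioo (-1 : ℝ) 2)
      (c := fun t => ((c z t).1, ε • (c z t).2)) isOpen_Ioo fun t ht => by
        obtain ⟨h1, h2⟩ := hct t ht
        refine ⟨h1.1, ?_⟩
        have e1 : HasDerivAt (fun t => (c z t).1) (ε • (c z t).2) t :=
          (hasFDerivAt_fst (𝕜 := ℝ) (p := c z t)).comp_hasDerivAt t h2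
        have e2 : HasDerivAt (fun t => (c z t).2) (ε • geodesicAccel (gram h p) (c z t)) t :=
          (hasFDerivAt_snd (𝕜 := ℝ) (p := c z t)).comp_hasDerivAt t h2
        have e3 := e1.prodMk (e2.const_smul ε)
        rw [smul_smul, ← sq] at e3
        have e4 := geodesicAccel_smul (gram h p) (c z t).1 (c z t).2 ε
        have e5 : geodesicField (gram h p) ((c z t).1, ε • (c z t).2)
            = (ε • (c z t).2, ε ^ 2 • geodesicAccel (gram h p) (c z t)) :=
          Prod.ext rfl e4
        rw [e5]; exact e3
    refine ⟨⟨1, one_pos, by convert key.1 using 2; norm_num⟩, ?_⟩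
    rw [key.2 0 ⟨by norm_num, by norm_num⟩, hc0]
    have : ((z.1, ε • z.2) : ℝ⁷ × ℝ⁷) = tpair p v := by
      rw [hz, hσ]
      refine Prod.ext rfl ?_
      simp [smul_smul, hε.ne']
    rw [this, tpoint_tpair hv.1]
  have hval : ∀ v ∈ O, expMap h v = (extChartAt (𝓡 7) p).symm (c (σ (tpair p v)) 1).1 :=
    fun v hv => expMap_eq (hexp v hv)
  have hmem : ∀ z ∈ U, (c z 1).1 ∈ Ω := fun z hz =>
    ((hc z hz).2 1 ⟨by norm_num, by norm_num⟩).1.1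
  have hpairs : ContMDiffOn (𝓡 7).tangent 𝓘(ℝ, ℝ⁷ × ℝ⁷) ∞ (fun v => σ (tpair p v))
      {v : TangentBundle (𝓡 7) M | v.1 ∈ (chartAt ℝ⁷ p).source} :=
    σ.contMDiff.comp_contMDiffOn (contMDiffOn_tpair p)
  have htp : tpoint p z₀ = (⟨p, 0⟩ : TangentBundle (𝓡 7) M) := by
    have : tpair p (⟨p, 0⟩ : TangentBundle (𝓡 7) M) = z₀ :=
      Prod.ext rfl (map_zero (tcoordL (𝓡 7) p p))
    rw [← this, tpoint_tpair hp]
  have hO0 : ∀ z : ℝ⁷ × ℝ⁷, z.1 ∈ Ω → σ z ∈ U → tpoint p z ∈ O := fun z h1 h2 =>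
    ⟨extChartAt_symm_mem_source h1, by
      simp only [mem_preimage]; rw [tpair_tpoint h1]; exact h2⟩
  refine ⟨O, hpairs.continuousOn.isOpen_inter_preimage (isOpen_tangent_source p) hU, ?_,
    inter_subset_left, fun v hv => ⟨_, hexp v hv⟩, ?_, ?_⟩
  · rw [← htp]
    exact hO0 z₀ (extChartAt_mem_target hp) (by rw [hσ₀]; exact hz₀U)
  · refine ContMDiffOn.congr ?_ hval
    have h1 : ContMDiffOn (𝓡 7).tangent 𝓘(ℝ, ℝ⁷) ∞ (fun v => (c (σ (tpair p v)) 1).1) O :=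
      (contDiff_fst.comp_contDiffOn hcs).contMDiffOn.comp (hpairs.mono inter_subset_left)
        fun v hv => hv.2
    exact (contMDiffOn_extChartAt_symm p).comp h1 fun v hv => hmem _ hv.2
  · rw [← hσ₀] at hcd
    have hd' : HasFDerivAt (fun z => c (σ z) 1) _ z₀ := hcd.comp z₀ σ.hasFDerivAt
    have hd : HasFDerivAt (fun z => (c (σ z) 1).1) _ z₀ :=
      (hasFDerivAt_fst (𝕜 := ℝ)).comp z₀ hd'
    refine (hd.congr_of_eventuallyEq ?_).congr_fderiv ?_
    · have o1 : ∀ᶠ z in 𝓝 z₀, z.1 ∈ Ω :=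
        continuous_fst.continuousAt.eventually (hΩo.mem_nhds (extChartAt_mem_target hp))
      have o2 : ∀ᶠ z in 𝓝 z₀, σ z ∈ U :=
        σ.continuous.continuousAt.eventually (by rw [hσ₀]; exact hU.mem_nhds hz₀U)
      filter_upwards [o1, o2] with z h1 h2
      rw [hval _ (hO0 z h1 h2), tpair_tpoint h1, (extChartAt (𝓡 7) p).right_inv (hmem _ h2)]
    · refine ContinuousLinearMap.ext fun ⟨a, b⟩ => ?_
      simp [hσ, smul_smul, hε.ne']

end Coassoc

namespace Coassoc

local notation "ℝ⁷" => EuclideanSpace ℝ (Fin 7)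

/-! ### Local diffeomorphisms from the exponential map -/

variable {M : Type*} [TopologicalSpace M] [ChartedSpace ℝ⁷ M] [IsManifold (𝓡 7) ∞ M]

/-- If `Ψ` is a smooth family of tangent vectors, zero at `a`, such that the derivatives of the base
point and of the vector at `a` add up to an isomorphism, then `exp ∘ Ψ` is a diffeomorphism
near `a`. -/
theorem exists_openPartialHomeomorph_expMap [T2Space M] (h : Metric7 M)
    {F : Type*} [NormedAddCommGroup F] [NormedSpace ℝ F] [CompleteSpace F]
    {Ψ : F → TangentBundle (𝓡 7) M} {O : Set F} (hO : IsOpen O) {a : F} (ha : a ∈ O) {p : M}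
    (hΨ : ContMDiffOn 𝓘(ℝ, F) (𝓡 7).tangent ∞ Ψ O) (hΨa : Ψ a = ⟨p, 0⟩)
    (L : F ≃L[ℝ] ℝ⁷) (hL : HasFDerivAt (fun b => extChartAt (𝓡 7) p (Ψ b).1 + tcoord (𝓡 7) p (Ψ b))
      (L : F →L[ℝ] ℝ⁷) a) :
    ∃ (e : OpenPartialHomeomorph F M) (Q : Set (TangentBundle (𝓡 7) M)), IsOpen Q ∧
      (⟨p, 0⟩ : TangentBundle (𝓡 7) M) ∈ Q ∧ Q ⊆ expDomain h ∧
      ContMDiffOn (𝓡 7).tangent (𝓡 7) ∞ (expMap h) Q ∧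
      a ∈ e.source ∧ e.source ⊆ O ∧ MapsTo Ψ e.source Q ∧
      (∀ b ∈ e.source, e b = expMap h (Ψ b)) ∧ ContMDiffOn 𝓘(ℝ, F) (𝓡 7) ∞ e e.source ∧
      ContMDiffOn (𝓡 7) 𝓘(ℝ, F) ∞ e.symm e.target := by
  obtain ⟨Q, hQ, hpQ, hQs, hQd, hQe, hder⟩ := exists_expMap_local h p
  have hp : p ∈ (chartAt ℝ⁷ p).source := mem_chart_source _ _
  set O₁ := O ∩ Ψ ⁻¹' (Q ∩ expMap h ⁻¹' (chartAt ℝ⁷ p).source) with hO₁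
  have hO₁o : IsOpen O₁ := hΨ.continuousOn.isOpen_inter_preimage hO
    (hQe.continuousOn.isOpen_inter_preimage hQ (chartAt ℝ⁷ p).open_source)
  have haO₁ : a ∈ O₁ := ⟨ha, by
    rw [mem_preimage, hΨa]; exact ⟨hpQ, by rw [mem_preimage, expMap_zero]; exact hp⟩⟩
  have hEΨ : ContMDiffOn 𝓘(ℝ, F) (𝓡 7) ∞ (fun b => expMap h (Ψ b)) O₁ :=
    hQe.comp (hΨ.mono inter_subset_left) fun b hb => hb.2.1
  set f : F → ℝ⁷ := fun b => extChartAt (𝓡 7) p (expMap h (Ψ b)) with hf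
  have hfs : ContDiffOn ℝ ∞ f O₁ :=
    ((contMDiffOn_extChartAt (I := 𝓡 7) (n := ∞) (x := p)).comp hEΨ fun b hb => hb.2.2).contDiffOn
  have hpair : ContDiffOn ℝ ∞ (fun b => tpair p (Ψ b)) O₁ :=
    ((contMDiffOn_tpair p).comp (hΨ.mono inter_subset_left) fun b hb => hQs hb.2.1).contDiffOn
  have hpaira : tpair p (Ψ a) = (extChartAt (𝓡 7) p p, 0) := by
    rw [hΨa]; exact Prod.ext rfl (map_zero (tcoordL (𝓡 7) p p))
  have hpd := ((hpair.contDiffAt (hO₁o.mem_nhds haO₁)).differentiableAt (by simp)).hasFDerivAt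
  have hfd : HasFDerivAt f (L : F →L[ℝ] ℝ⁷) a := by
    have h1 := HasFDerivAt.comp a (hpaira.symm ▸ hder) hpd
    have h2 := ((ContinuousLinearMap.fst ℝ ℝ⁷ ℝ⁷ + ContinuousLinearMap.snd ℝ ℝ⁷ ℝ⁷).hasFDerivAt
      (x := tpair p (Ψ a))).comp a hpd
    have h3 := h2.unique hL
    rw [h3] at h1
    refine h1.congr_of_eventuallyEq ?_
    filter_upwards [hO₁o.mem_nhds haO₁] with b hb
    simp only [hf, Function.comp_apply]
    rw [tpoint_tpair (hQs hb.2.1)]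
  obtain ⟨e₀, hae, hes, hef, hesym⟩ :=
    exists_openPartialHomeomorph_of_contDiffOn hO₁o hfs haO₁ L hfd
  have hsrc : (e₀.trans (chartAt ℝ⁷ p).symm).source = e₀.source := by
    rw [OpenPartialHomeomorph.trans_source]
    refine inter_eq_left.2 fun b hb => ?_
    rw [mem_preimage, hef b hb]
    exact (chartAt ℝ⁷ p).map_source (hes hb).2.2
  have heq : ∀ b ∈ e₀.source, (e₀.trans (chartAt ℝ⁷ p).symm) b = expMap h (Ψ b) := fun b hb => by
    rw [OpenPartialHomeomorph.trans_apply, hef b hb]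
    exact (chartAt ℝ⁷ p).left_inv (hes hb).2.2
  refine ⟨e₀.trans (chartAt ℝ⁷ p).symm, Q, hQ, hpQ, hQd, hQe, ?_, ?_, ?_, ?_, ?_, ?_⟩
  · rw [hsrc]; exact hae
  · rw [hsrc]; exact hes.trans inter_subset_left
  · rw [hsrc]; exact fun b hb => (hes hb).2.1
  · rw [hsrc]; exact heq
  · rw [hsrc]; exact (hEΨ.mono hes).congr heq
  · refine hesym.contMDiffOn.comp (t := e₀.target) (f := extChartAt (𝓡 7) p)
      ((contMDiffOn_extChartAt (I := 𝓡 7) (n := ∞) (x := p)).mono fun x hx => ?_) fun x hx => ?_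
    · rw [OpenPartialHomeomorph.trans_target] at hx; exact hx.1
    · rw [OpenPartialHomeomorph.trans_target] at hx; exact hx.2

end Coassoc

namespace Coassoc

local notation "ℝ⁷" => EuclideanSpace ℝ (Fin 7)

/-! ### Immersions -/

section Immersion

variable {M : Type*} [TopologicalSpace M] [ChartedSpace ℝ⁷ M] [IsManifold (𝓡 7) ∞ M]
  {E H N : Type*} [NormedAddCommGroup E] [NormedSpace ℝ E] [TopologicalSpace H]
  {I : ModelWithCorners ℝ E H} [TopologicalSpace N] [ChartedSpace H N] [IsManifold I ∞ N]

/-- An immersion extends, in coordinates, to a smooth map of an open subset of the model vector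
space (across the boundary, if there is one) which has a smooth left inverse. -/
theorem exists_extension_of_isImmersionAt {f : N → M} {z : N}
    (hf : IsImmersionAt I (𝓡 7) ∞ f z) :
    ∃ (κ : OpenPartialHomeomorph N H) (U : Set E) (ι : E → M) (O : Set M) (r : M → E),
      κ ∈ IsManifold.maximalAtlas I ∞ N ∧ z ∈ κ.source ∧ IsOpen U ∧ IsOpen O ∧
      ContMDiffOn 𝓘(ℝ, E) (𝓡 7) ∞ ι U ∧ ContMDiffOn (𝓡 7) 𝓘(ℝ, E) ∞ r O ∧
      MapsTo ι U O ∧ (∀ u ∈ U, r (ι u) = u) ∧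
      ∀ w ∈ κ.source, κ.extend I w ∈ U ∧ ι (κ.extend I w) = f w := by
  set ψ := hf.codChart with hψ
  set L := hf.equiv with hL
  have hψm : ψ ∈ IsManifold.maximalAtlas (𝓡 7) ∞ M := hf.codChart_mem_maximalAtlas
  have hψs : ContMDiffOn (𝓡 7) (𝓡 7) ∞ ψ ψ.source := contMDiffOn_of_mem_maximalAtlas hψm
  have hψs' : ContMDiffOn (𝓡 7) (𝓡 7) ∞ ψ.symm ψ.target :=
    contMDiffOn_symm_of_mem_maximalAtlas hψm
  have hL0 : ContDiff ℝ ∞ fun u : E => L (u, 0) :=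
    L.contDiff.comp (contDiff_id.prodMk contDiff_const)
  have hw : ∀ w ∈ hf.domChart.source, ψ (f w) = L (hf.domChart.extend I w, 0) := fun w hw => by
    have h1 := hf.writtenInCharts ((hf.domChart.extend I).map_source
      (by rwa [OpenPartialHomeomorph.extend_source]))
    simp only [Function.comp_apply, OpenPartialHomeomorph.extend_left_inv _ hw] at h1
    exact h1
  refine ⟨hf.domChart, (fun u : E => L (u, 0)) ⁻¹' ψ.target, fun u => ψ.symm (L (u, 0)), ψ.source,
    fun x => (L.symm (ψ x)).1, hf.domChart_mem_maximalAtlas, hf.mem_domChart_source,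
    ψ.open_target.preimage hL0.continuous, ψ.open_source, ?_, ?_, ?_, ?_, ?_⟩
  · exact hψs'.comp hL0.contMDiff.contMDiffOn fun u hu => hu
  · exact (contDiff_fst.comp L.symm.contDiff).contMDiff.comp_contMDiffOn hψs
  · exact fun u hu => ψ.map_target hu
  · intro u hu
    simp only
    rw [ψ.right_inv hu]; simp
  · intro w hw'
    have h1 := hf.source_subset_preimage_source hw'
    refine ⟨?_, ?_⟩
    · rw [mem_preimage, ← hw w hw']; exact ψ.map_source h1
    · simp only
      rw [← hw w hw']; exact ψ.left_inv h1

theorem injective_mfderiv_of_isImmersionAt {f : N → M} {z : N}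
    (hf : IsImmersionAt I (𝓡 7) ∞ f z) : Function.Injective (mfderiv I (𝓡 7) f z) := by
  obtain ⟨κ, U, ι, O, r, hκ, hz, hU, hO, hι, hr, hm, hri, hκf⟩ :=
    exists_extension_of_isImmersionAt hf
  have hfO : f z ∈ O := (hκf z hz).2 ▸ hm (hκf z hz).1
  have h2 := (hf.contMDiffAt.mdifferentiableAt (by simp)).hasMFDerivAt
  have h3 := ((hr.contMDiffAt (hO.mem_nhds hfO)).mdifferentiableAt (by simp)).hasMFDerivAt
  have hrf : ∀ w ∈ κ.source, r (f w) = κ.extend I w := fun w hw => by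
    rw [← (hκf w hw).2, hri _ (hκf w hw).1]
  have h1 : HasMFDerivWithinAt 𝓘(ℝ, E) I (κ.extend I).symm (I '' κ.target) (r (f z)) _ :=
    ((contMDiffOn_extend_symm hκ _ (by
      rw [hrf z hz]; exact ⟨κ z, κ.map_source hz, rfl⟩)
      ).mdifferentiableWithinAt (by simp)).hasMFDerivWithinAt
  have h4 := h1.comp z (h3.comp z h2).hasMFDerivWithinAt (s := κ.source) (fun w hw => by
    rw [mem_preimage, Function.comp_apply, hrf w hw]
    exact ⟨κ w, κ.map_source hw, rfl⟩)
  have h5 := h4.hasMFDerivAt (κ.open_source.mem_nhds hz)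
  have h6 := (hasMFDerivAt_id z).congr_of_eventuallyEq (I := I) (I' := I)
    (f₁ := (κ.extend I).symm ∘ r ∘ f) (by
      filter_upwards [κ.open_source.mem_nhds hz] with w hw
      simp only [Function.comp_apply, id]
      rw [hrf w hw, OpenPartialHomeomorph.extend_left_inv _ hw])
  have h7 := hasMFDerivAt_unique h5 h6
  intro u v huv
  have h8 := fun u => congrArg (fun l => l u) h7
  have e1 := h8 u
  have e2 := h8 v
  simp only [ContinuousLinearMap.comp_apply] at e1 e2
  rw [huv] at e1
  exact e1.symm.trans e2

end Immersion

end Coassoc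

namespace Coassoc

local notation "ℝ⁷" => EuclideanSpace ℝ (Fin 7)

/-! ### Tubular neighbourhoods of hypersurfaces -/

/-- A map `η` on `S × ℝ` which is locally injective near the zero section and restricts to an
isometric embedding of it is injective near the zero section. -/
theorem exists_injOn_nhds_zero {S M : Type*} [MetricSpace S] [MetricSpace M] {j : S → M}
    (hj : Isometry j) {η : S × ℝ → M} (hη : ∀ y, η (y, 0) = j y)
    (hc : ∀ y, ContinuousAt η (y, 0)) (hinj : ∀ y, ∃ Q ∈ 𝓝 ((y, 0) : S × ℝ), InjOn η Q) :
    ∃ D : Set (S × ℝ), IsOpen D ∧ (∀ y, (y, (0 : ℝ)) ∈ D) ∧ InjOn η D := by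
  set D : Set (S × ℝ) := {a | ∃ r : ℝ, InjOn η (Metric.ball (a.1, 0) (4 * r)) ∧ |a.2| < r ∧
    dist (η a) (j a.1) < r} with hD
  have hDinj : InjOn η D := by
    have key : ∀ a b : S × ℝ, ∀ r s : ℝ, s ≤ r → InjOn η (Metric.ball (a.1, 0) (4 * r)) →
        |a.2| < r → dist (η a) (j a.1) < r → |b.2| < s → dist (η b) (j b.1) < s → η a = η b →
        a = b := by
      intro a b r s hsr hi ha ha' hb hb' hab
      have hr : 0 < r := (abs_nonneg _).trans_lt ha
      have h1 : dist a.1 b.1 < 2 * r := by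
        rw [← hj.dist_eq]
        have := dist_triangle_left (j a.1) (j b.1) (η a)
        rw [hab] at this
        rw [hab] at ha'
        linarith
      refine hi ?_ ?_ hab
      · rw [Metric.mem_ball, Prod.dist_eq, max_lt_iff]
        simp only [dist_self, Real.dist_eq, sub_zero]
        exact ⟨by linarith, by linarith⟩
      · rw [Metric.mem_ball, Prod.dist_eq, max_lt_iff]
        simp only [Real.dist_eq, sub_zero]
        rw [dist_comm]
        exact ⟨by linarith, by linarith⟩
    rintro a ⟨r, hi, ha, ha'⟩ b ⟨s, hi', hb, hb'⟩ hab
    rcases le_total s r with h | h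
    · exact key a b r s h hi ha ha' hb hb' hab
    · exact (key b a s r h hi' hb hb' ha ha' hab.symm).symm
  refine ⟨interior D, isOpen_interior, fun y => mem_interior_iff_mem_nhds.2 ?_,
    hDinj.mono interior_subset⟩
  obtain ⟨Q, hQ, hQi⟩ := hinj y
  obtain ⟨R, hR, hRQ⟩ := Metric.mem_nhds_iff.1 hQ
  have e1 : ∀ᶠ a in 𝓝 ((y, 0) : S × ℝ), dist a.1 y < R / 8 :=
    (continuous_fst.dist continuous_const).continuousAt.eventually_lt continuousAt_const (by
      simp only [dist_self]; positivity)
  have e2 : ∀ᶠ a in 𝓝 ((y, 0) : S × ℝ), |a.2| < R / 8 :=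
    continuous_snd.abs.continuousAt.eventually_lt continuousAt_const (by
      simp only [abs_zero]; positivity)
  have e3 : ∀ᶠ a in 𝓝 ((y, 0) : S × ℝ), dist (η a) (j a.1) < R / 8 :=
    ((hc y).dist (hj.continuous.comp continuous_fst).continuousAt).eventually_lt
      continuousAt_const (by
        simp only [hη, Function.comp_apply, dist_self]; positivity)
  filter_upwards [e1, e2, e3] with a h1 h2 h3
  refine ⟨R / 8, hQi.mono ((Metric.ball_subset_ball' ?_).trans hRQ), h2, h3⟩
  have : dist ((a.1, 0) : S × ℝ) (y, 0) = dist a.1 y := by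
    rw [Prod.dist_eq]; simp
  rw [this]; linarith

variable {M : Type*} [TopologicalSpace M] [ChartedSpace ℝ⁷ M] [IsManifold (𝓡 7) ∞ M]

theorem contMDiffOn_smul_tangent {EA HA A : Type*} [NormedAddCommGroup EA] [NormedSpace ℝ EA]
    [TopologicalSpace HA] {IA : ModelWithCorners ℝ EA HA} [TopologicalSpace A] [ChartedSpace HA A]
    {f : A → M} {v : ∀ a, TangentSpace (𝓡 7) (f a)} {r : A → ℝ} {s : Set A}
    (hr : ContMDiffOn IA 𝓘(ℝ, ℝ) ∞ r s)
    (hv : ContMDiffOn IA (𝓡 7).tangent ∞ (fun a => (⟨f a, v a⟩ : TangentBundle (𝓡 7) M)) s) :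
    ContMDiffOn IA (𝓡 7).tangent ∞
      (fun a => (⟨f a, r a • v a⟩ : TangentBundle (𝓡 7) M)) s := by
  intro a ha
  have hp : f a ∈ (chartAt ℝ⁷ (f a)).source := mem_chart_source _ _
  obtain ⟨h1, h2⟩ := (contMDiffWithinAt_tangentBundle_iff hp).1 (hv a ha)
  refine (contMDiffWithinAt_tangentBundle_iff hp).2 ⟨h1, ?_⟩
  refine ((hr a ha).smul h2).congr (fun b _ => ?_) ?_
  · exact map_smul (tcoordL (𝓡 7) (f a) (f b)) (r b) (v b)
  · exact map_smul (tcoordL (𝓡 7) (f a) (f a)) (r a) (v a)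

variable {S : Type*} [TopologicalSpace S] [ChartedSpace (EuclideanSpace ℝ (Fin 6)) S]
  [IsManifold (𝓡 6) ∞ S]

/-- The normal exponential map of a hypersurface is a local diffeomorphism along the zero
section. -/
theorem exists_normal_expMap_chart [T2Space M] (h : Metric7 M) {j : S → M}
    (hj : ContMDiff (𝓡 6) (𝓡 7) ∞ j) {n : ∀ y, TangentSpace (𝓡 7) (j y)}
    (hn : ContMDiff (𝓡 6) (𝓡 7).tangent ∞ (fun y => (⟨j y, n y⟩ : TangentBundle (𝓡 7) M)))
    (y : S) (hind : ∀ (w : TangentSpace (𝓡 6) y) (s : ℝ),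
      mfderiv (𝓡 6) (𝓡 7) j y w + s • n y = 0 → w = 0 ∧ s = 0)
    {W : Set M} (hW : IsOpen W) (hyW : j y ∈ W) :
    ∃ θ : OpenPartialHomeomorph (S × ℝ) M, (y, (0 : ℝ)) ∈ θ.source ∧ θ.target ⊆ W ∧
      (∀ a ∈ θ.source, θ a = expMap h ⟨j a.1, a.2 • n a.1⟩) ∧
      ContMDiffOn ((𝓡 6).prod 𝓘(ℝ, ℝ)) (𝓡 7) ∞ θ θ.source ∧
      ContMDiffOn (𝓡 7) ((𝓡 6).prod 𝓘(ℝ, ℝ)) ∞ θ.symm θ.target := by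
  set E6 := EuclideanSpace ℝ (Fin 6)
  set χ := extChartAt (𝓡 6) y with hχ
  set p := j y with hp
  have hps : p ∈ (chartAt ℝ⁷ p).source := mem_chart_source _ _
  set u₀ : E6 := χ y with hu₀
  have hu₀t : u₀ ∈ χ.target := mem_extChartAt_target y
  have hχu₀ : χ.symm u₀ = y := extChartAt_to_inv y
  have hχs : ContMDiffOn (𝓡 6) (𝓡 6) ∞ χ.symm χ.target := contMDiffOn_extChartAt_symm y
  set Ψ : E6 × ℝ → TangentBundle (𝓡 7) M :=
    fun b => ⟨j (χ.symm b.1), b.2 • n (χ.symm b.1)⟩ with hΨ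
  have hfst : ContMDiffOn 𝓘(ℝ, E6 × ℝ) (𝓡 6) ∞ (fun b : E6 × ℝ => χ.symm b.1)
      (χ.target ×ˢ univ) := hχs.comp contDiff_fst.contMDiff.contMDiffOn fun b hb => hb.1
  have hΨs : ContMDiffOn 𝓘(ℝ, E6 × ℝ) (𝓡 7).tangent ∞ Ψ (χ.target ×ˢ univ) :=
    contMDiffOn_smul_tangent contDiff_snd.contMDiff.contMDiffOn (hn.comp_contMDiffOn hfst)
  have hΨ0 : Ψ (u₀, 0) = ⟨p, 0⟩ := by
    have : ∀ x : S, x = y → (⟨j x, (0 : ℝ) • n x⟩ : TangentBundle (𝓡 7) M) = ⟨j y, 0⟩ :=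
      fun x hx => by rw [hx, zero_smul]
    exact this _ hχu₀
  -- the derivative of the base point and of the vector at the origin
  have hχa : ContMDiffAt (𝓡 6) (𝓡 6) ∞ χ.symm u₀ :=
    hχs.contMDiffAt ((isOpen_extChartAt_target y).mem_nhds hu₀t)
  have hjd := ((hj y).mdifferentiableAt (by simp)).hasMFDerivAt
  have hξd : HasMFDerivAt (𝓡 7) 𝓘(ℝ, ℝ⁷) (extChartAt (𝓡 7) p) p
      (mfderiv (𝓡 7) 𝓘(ℝ, ℝ⁷) (extChartAt (𝓡 7) p) p) :=
    ((contMDiffAt_extChartAt' (n := ∞) hps).mdifferentiableAt (by simp)).hasMFDerivAt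
  have hχd := (hχa.mdifferentiableAt (by simp)).hasMFDerivAt
  have hjχ : ContDiffAt ℝ ∞ (fun u => extChartAt (𝓡 7) p (j (χ.symm u))) u₀ := by
    refine ContMDiffAt.contDiffAt ?_
    have h1 : ContMDiffAt (𝓡 6) (𝓡 7) ∞ (j ∘ χ.symm) u₀ := hj.contMDiffAt.comp u₀ hχa
    refine ContMDiffAt.comp u₀ (contMDiffAt_extChartAt' ?_) h1
    rw [hχu₀]; exact hps
  set D := fderiv ℝ (fun u => extChartAt (𝓡 7) p (j (χ.symm u))) u₀ with hD
  have hDeq : ∀ u, D u = tcoordL (𝓡 7) p p (mfderiv (𝓡 6) (𝓡 7) j y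
      (tframe (𝓡 6) y y u)) := by
    intro u
    have a1 : HasMFDerivAt (𝓡 6) (𝓡 7) (fun u => extChartAt (𝓡 7) p (j (χ.symm u))) u₀ _ :=
      HasMFDerivAt.comp u₀ (g := fun y => extChartAt (𝓡 7) p (j y)) (by
        rw [hχu₀]; exact hξd.comp y hjd) hχd
    have a2 := tframe_symm hu₀t
    rw [hχu₀] at a2
    rw [hD, ← mfderiv_eq_fderiv, a1.mfderiv, a2]
    rfl
  set f₂ : E6 → ℝ⁷ := fun u => tcoord (𝓡 7) p ⟨j (χ.symm u), n (χ.symm u)⟩ with hf₂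
  have hf₂d : DifferentiableAt ℝ f₂ u₀ := by
    have h1 : ContMDiffAt (𝓡 6) (𝓡 7).tangent ∞
        (fun u => (⟨j (χ.symm u), n (χ.symm u)⟩ : TangentBundle (𝓡 7) M)) u₀ :=
      hn.contMDiffAt.comp u₀ hχa
    have h2 := ((contMDiffWithinAt_tangentBundle_iff (p := p) (by
      show j (χ.symm u₀) ∈ _
      rw [hχu₀]; exact hps)).1 h1).2
    exact (ContMDiffAt.contDiffAt h2).differentiableAt (by simp)
  have hf₂u₀ : f₂ u₀ = tcoordL (𝓡 7) p p (n y) := by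
    have : ∀ x : S, x = y → tcoord (𝓡 7) p ⟨j x, n x⟩ = tcoordL (𝓡 7) p p (n y) :=
      fun x hx => by rw [hx]; rfl
    exact this _ hχu₀
  set L₀ : E6 × ℝ →L[ℝ] ℝ⁷ := D.comp (ContinuousLinearMap.fst ℝ E6 ℝ) +
    (ContinuousLinearMap.snd ℝ E6 ℝ).smulRight (f₂ u₀) with hL₀
  have hL₀inj : Function.Injective L₀ := by
    refine (injective_iff_map_eq_zero _).2 fun ⟨u, s⟩ hus => ?_
    have h1 : tcoordL (𝓡 7) p p (mfderiv (𝓡 6) (𝓡 7) j y (tframe (𝓡 6) y y u) + s • n y) = 0 := by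
      rw [map_add, map_smul, ← hDeq, ← hf₂u₀]
      exact hus
    have h2 : mfderiv (𝓡 6) (𝓡 7) j y (tframe (𝓡 6) y y u) + s • n y = 0 := by
      rw [← tframe_tcoordL hps (mfderiv (𝓡 6) (𝓡 7) j y (tframe (𝓡 6) y y u) + s • n y), h1,
        map_zero]
    obtain ⟨h3, h4⟩ := hind _ _ h2
    have h5 := tcoordL_tframe (I := 𝓡 6) (p := y) (x := y) (mem_chart_source _ _) u
    rw [h3, map_zero] at h5
    rw [← h5, h4]; rfl
  let L : (E6 × ℝ) ≃L[ℝ] ℝ⁷ := (LinearEquiv.ofInjectiveOfFinrankEq (L₀ : E6 × ℝ →ₗ[ℝ] ℝ⁷)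
    hL₀inj (by simp [E6])).toContinuousLinearEquiv
  have hL : (L : E6 × ℝ →L[ℝ] ℝ⁷) = L₀ := ContinuousLinearMap.ext fun v => rfl
  have hder : HasFDerivAt (fun b => extChartAt (𝓡 7) p (Ψ b).1 + tcoord (𝓡 7) p (Ψ b))
      (L : E6 × ℝ →L[ℝ] ℝ⁷) (u₀, 0) := by
    have e1 : HasFDerivAt (fun b : E6 × ℝ => extChartAt (𝓡 7) p (j (χ.symm b.1)))
        (D.comp (ContinuousLinearMap.fst ℝ E6 ℝ)) (u₀, 0) := by
      have a1 : HasFDerivAt (fun u => extChartAt (𝓡 7) p (j (χ.symm u))) D (u₀, (0 : ℝ)).1 :=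
        (hjχ.differentiableAt (by simp)).hasFDerivAt
      exact a1.comp (u₀, (0 : ℝ)) hasFDerivAt_fst
    have e2 : HasFDerivAt (fun b : E6 × ℝ => f₂ b.1)
        ((fderiv ℝ f₂ u₀).comp (ContinuousLinearMap.fst ℝ E6 ℝ)) (u₀, 0) := by
      have a1 : HasFDerivAt f₂ (fderiv ℝ f₂ u₀) (u₀, (0 : ℝ)).1 := hf₂d.hasFDerivAt
      exact a1.comp (u₀, (0 : ℝ)) hasFDerivAt_fst
    have e3 := e1.add ((hasFDerivAt_snd (𝕜 := ℝ) (p := (u₀, (0 : ℝ)))).smul e2)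
    rw [hL]
    refine (e3.congr_of_eventuallyEq (Eventually.of_forall fun b => ?_)).congr_fderiv ?_
    · exact congrArg _ (map_smul (tcoordL (𝓡 7) p (j (χ.symm b.1))) b.2 (n (χ.symm b.1)))
    · simp [hL₀]
  obtain ⟨e, Q, hQ, hpQ, hQd, hQe, hae, hes, hmap, heq, hesm, hesym⟩ :=
    exists_openPartialHomeomorph_expMap h ((isOpen_extChartAt_target y).prod isOpen_univ)
      (show ((u₀, (0 : ℝ)) : E6 × ℝ) ∈ χ.target ×ˢ univ from ⟨hu₀t, mem_univ _⟩) hΨs hΨ0 L hder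
  set θ₀ : OpenPartialHomeomorph (S × ℝ) M :=
    ((chartAt E6 y).prod (OpenPartialHomeomorph.refl ℝ)).trans e with hθ₀
  have hθ₀s : ∀ a, a ∈ θ₀.source ↔ a.1 ∈ (chartAt E6 y).source ∧ (χ a.1, a.2) ∈ e.source := by
    intro a
    rw [hθ₀, OpenPartialHomeomorph.trans_source]
    simp only [OpenPartialHomeomorph.prod_source, OpenPartialHomeomorph.refl_source, mem_inter_iff,
      mem_prod, mem_univ, and_true]
    exact Iff.rfl
  have hθ₀e : ∀ a, θ₀ a = e (χ a.1, a.2) := fun a => rfl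
  have hθ₀v : ∀ a ∈ θ₀.source, θ₀ a = expMap h ⟨j a.1, a.2 • n a.1⟩ := by
    intro a ha
    obtain ⟨h1, h2⟩ := (hθ₀s a).1 ha
    rw [hθ₀e, heq _ h2, hΨ]
    have h3 : ∀ x : S, x = a.1 → expMap h ⟨j x, a.2 • n x⟩ = expMap h ⟨j a.1, a.2 • n a.1⟩ :=
      fun x hx => by rw [hx]
    exact h3 _ (χ.left_inv (by rwa [hχ, extChartAt_source]))
  have hχm : ContMDiffOn ((𝓡 6).prod 𝓘(ℝ, ℝ)) 𝓘(ℝ, E6 × ℝ) ∞ (fun a : S × ℝ => (χ a.1, a.2))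
      {a | a.1 ∈ (chartAt E6 y).source} :=
    ((contMDiffOn_extChartAt (I := 𝓡 6) (n := ∞) (x := y)).comp contMDiff_fst.contMDiffOn
      fun a ha => ha).prodMk_space contMDiff_snd.contMDiffOn
  have hθ₀m : ContMDiffOn ((𝓡 6).prod 𝓘(ℝ, ℝ)) (𝓡 7) ∞ θ₀ θ₀.source :=
    hesm.comp (hχm.mono fun a ha => ((hθ₀s a).1 ha).1) fun a ha => ((hθ₀s a).1 ha).2
  have hθ₀i : ContMDiffOn (𝓡 7) ((𝓡 6).prod 𝓘(ℝ, ℝ)) ∞ θ₀.symm θ₀.target := by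
    have hsub : θ₀.target ⊆ e.target := by
      rw [hθ₀, OpenPartialHomeomorph.trans_target]; exact inter_subset_left
    have hmem : ∀ x ∈ θ₀.target, (e.symm x).1 ∈ χ.target := fun x hx =>
      (hes (e.map_target (hsub hx))).1
    have h1 : ContMDiffOn (𝓡 7) (𝓡 6) ∞ (fun x => χ.symm (e.symm x).1) θ₀.target :=
      hχs.comp (contDiff_fst.contMDiff.comp_contMDiffOn (hesym.mono hsub)) hmem
    have h2 : ContMDiffOn (𝓡 7) 𝓘(ℝ, ℝ) ∞ (fun x => (e.symm x).2) θ₀.target :=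
      contDiff_snd.contMDiff.comp_contMDiffOn (hesym.mono hsub)
    exact h1.prodMk h2
  have hopen : IsOpen (θ₀.source ∩ θ₀ ⁻¹' W) := θ₀.isOpen_inter_preimage hW
  have hy₀ : (y, (0 : ℝ)) ∈ θ₀.source := (hθ₀s _).2 ⟨mem_chart_source _ _, hae⟩
  have hsub₁ : (θ₀.restrOpen _ hopen).source ⊆ θ₀.source := by
    rw [OpenPartialHomeomorph.restrOpen_source]; exact inter_subset_left
  refine ⟨θ₀.restrOpen _ hopen, ?_, ?_, ?_, ?_, ?_⟩
  · rw [OpenPartialHomeomorph.restrOpen_source]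
    refine ⟨hy₀, hy₀, ?_⟩
    rw [mem_preimage, hθ₀v _ hy₀]
    have : (⟨j y, (0 : ℝ) • n y⟩ : TangentBundle (𝓡 7) M) = ⟨j y, 0⟩ := by rw [zero_smul]
    simp only [this, expMap_zero]
    exact hyW
  · intro x hx
    have h1 := (θ₀.restrOpen _ hopen).map_target hx
    have h2 := (θ₀.restrOpen _ hopen).right_inv hx
    rw [OpenPartialHomeomorph.restrOpen_source] at h1
    rw [← h2]
    exact h1.2.2
  · exact fun a ha => hθ₀v a (hsub₁ ha)
  · exact hθ₀m.mono hsub₁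
  · refine hθ₀i.mono fun x hx => ?_
    have h1 := (θ₀.restrOpen _ hopen).map_target hx
    have h2 := (θ₀.restrOpen _ hopen).right_inv hx
    rw [← h2]
    exact θ₀.map_source (hsub₁ h1)

end Coassoc

namespace Coassoc

local notation "ℝ⁷" => EuclideanSpace ℝ (Fin 7)

/-- Every neighbourhood of the zero section of `S × ℝ` contains
`{(y, t) | k y * t ^ 2 < 1}` for some smooth positive function `k`. -/
theorem exists_contMDiff_width {E H S : Type*} [NormedAddCommGroup E] [NormedSpace ℝ E]
    [FiniteDimensional ℝ E] [TopologicalSpace H] (I : ModelWithCorners ℝ E H) [TopologicalSpace S]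
    [ChartedSpace H S] [IsManifold I ∞ S] [SigmaCompactSpace S] [T2Space S] {D : Set (S × ℝ)}
    (hD : IsOpen D) (h0 : ∀ y, (y, (0 : ℝ)) ∈ D) :
    ∃ k : S → ℝ, ContMDiff I 𝓘(ℝ, ℝ) ∞ k ∧ (∀ y, 0 < k y) ∧
      ∀ y t, k y * t ^ 2 < 1 → (y, t) ∈ D := by
  have hconv : ∀ y : S, Convex ℝ {k : ℝ | 0 < k ∧ ∀ t, k * t ^ 2 < 1 → (y, t) ∈ D} := by
    intro y
    have : ∀ a ∈ {k : ℝ | 0 < k ∧ ∀ t, k * t ^ 2 < 1 → (y, t) ∈ D}, ∀ b, a ≤ b →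
        b ∈ {k : ℝ | 0 < k ∧ ∀ t, k * t ^ 2 < 1 → (y, t) ∈ D} := fun a ha b hab =>
      ⟨ha.1.trans_le hab, fun t ht => ha.2 t
        ((mul_le_mul_of_nonneg_right hab (sq_nonneg t)).trans_lt ht)⟩
    exact (OrdConnected.mk fun a ha b _ c hc => this a ha c hc.1).convex
  obtain ⟨k, hk⟩ := exists_contMDiffMap_forall_mem_convex_of_local_const (n := ⊤) I hconv (by
    intro y
    obtain ⟨U, hU, R, hR, hUR⟩ := mem_nhds_prod_iff.1 (hD.mem_nhds (h0 y))
    obtain ⟨r, hr, hrR⟩ := Metric.mem_nhds_iff.1 hR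
    refine ⟨1 / r ^ 2, ?_⟩
    filter_upwards [hU] with x hx
    refine ⟨by positivity, fun t ht => hUR ⟨hx, hrR ?_⟩⟩
    rw [Metric.mem_ball, Real.dist_eq, sub_zero]
    refine abs_lt_of_sq_lt_sq ?_ hr.le
    rw [one_div, inv_mul_lt_iff₀ (by positivity)] at ht
    linarith)
  exact ⟨k, k.contMDiff, fun y => (hk y).1, fun y => (hk y).2⟩

/-- The squeezing map `t = s / √(1 + k s²)` of `(-1, 1)` onto the interval
`(k + 1) t² < 1` has inverse `s = t / √(1 - k t²)`. -/
theorem squeeze_mem {k s : ℝ} (hk : 0 < k) (hs : s ∈ Ioo (-1 : ℝ) 1) :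
    (k + 1) * (s / √(1 + k * s ^ 2)) ^ 2 < 1 := by
  have h1 : 0 < 1 + k * s ^ 2 := by positivity
  rw [div_pow, Real.sq_sqrt h1.le, mul_div_assoc', div_lt_one h1]
  have : s ^ 2 < 1 := by rw [sq_lt_one_iff_abs_lt_one, abs_lt]; exact hs
  linarith

theorem unsqueeze_mem {k t : ℝ} (ht : (k + 1) * t ^ 2 < 1) :
    t / √(1 - k * t ^ 2) ∈ Ioo (-1 : ℝ) 1 := by
  have h1 : 0 < 1 - k * t ^ 2 := by nlinarith [sq_nonneg t]
  rw [mem_Ioo, ← abs_lt, ← sq_lt_one_iff_abs_lt_one, div_pow, Real.sq_sqrt h1.le, div_lt_one h1]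
  linarith

theorem unsqueeze_squeeze {k s : ℝ} (hk : 0 < k) :
    s / √(1 + k * s ^ 2) / √(1 - k * (s / √(1 + k * s ^ 2)) ^ 2) = s := by
  have h1 : 0 < 1 + k * s ^ 2 := by positivity
  have h2 : 1 - k * (s / √(1 + k * s ^ 2)) ^ 2 = (1 + k * s ^ 2)⁻¹ := by
    rw [div_pow, Real.sq_sqrt h1.le]; field_simp; ring
  rw [h2, Real.sqrt_inv, div_inv_eq_mul, div_mul_cancel₀ _ (Real.sqrt_pos.2 h1).ne']

theorem squeeze_unsqueeze {k t : ℝ} (ht : (k + 1) * t ^ 2 < 1) :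
    t / √(1 - k * t ^ 2) / √(1 + k * (t / √(1 - k * t ^ 2)) ^ 2) = t := by
  have h1 : 0 < 1 - k * t ^ 2 := by nlinarith [sq_nonneg t]
  have h2 : 1 + k * (t / √(1 - k * t ^ 2)) ^ 2 = (1 - k * t ^ 2)⁻¹ := by
    rw [div_pow, Real.sq_sqrt h1.le]; field_simp; ring
  rw [h2, Real.sqrt_inv, div_inv_eq_mul, div_mul_cancel₀ _ (Real.sqrt_pos.2 h1).ne']

variable {M : Type*} [TopologicalSpace M] [ChartedSpace ℝ⁷ M] [IsManifold (𝓡 7) ∞ M]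

/-- The curve `s ↦ exp (r(s) v)` has velocity `v` at `s = 0` if `r(0) = 0` and `r'(0) = 1`. -/
theorem velocity_expMap_smul [T2Space M] (h : Metric7 M) {p : M} (v : TangentSpace (𝓡 7) p)
    {r : ℝ → ℝ} (hr : ContDiff ℝ ∞ r) (hr0 : r 0 = 0) (hr1 : HasDerivAt r 1 0) :
    velocity (fun s => expMap h ⟨p, r s • v⟩) 0 = ⟨p, v⟩ := by
  obtain ⟨O, hO, hpO, -, -, hOe, hd⟩ := exists_expMap_local h p
  have hps : p ∈ (chartAt ℝ⁷ p).source := mem_chart_source _ _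
  have hcurve : ContMDiff 𝓘(ℝ, ℝ) (𝓡 7).tangent ∞
      (fun s => (⟨p, r s • v⟩ : TangentBundle (𝓡 7) M)) := by
    rw [← contMDiffOn_univ]
    exact contMDiffOn_smul_tangent hr.contMDiff.contMDiffOn contMDiffOn_const
  have h0 : (⟨p, r 0 • v⟩ : TangentBundle (𝓡 7) M) = ⟨p, 0⟩ := by rw [hr0, zero_smul]
  have hsm : ContMDiffAt 𝓘(ℝ, ℝ) (𝓡 7) ∞ (fun s => expMap h ⟨p, r s • v⟩) 0 :=
    ContMDiffAt.comp 0 (hOe.contMDiffAt (hO.mem_nhds (by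
      show (⟨p, r 0 • v⟩ : TangentBundle (𝓡 7) M) ∈ O
      rw [h0]; exact hpO))) hcurve.contMDiffAt
  have hz : expMap h ⟨p, r 0 • v⟩ = p := by rw [h0, expMap_zero]
  refine tangentBundle_ext (p := p) hz (by show expMap h ⟨p, r 0 • v⟩ ∈ _; rw [hz]; exact hps) ?_
  rw [tcoord_velocity (hsm.mdifferentiableAt (by simp)) (by rw [hz]; exact hps)]
  have hc : ∀ s, tpoint p (extChartAt (𝓡 7) p p, r s • tcoordL (𝓡 7) p p v)
      = ⟨p, r s • v⟩ := by
    intro s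
    have := tpoint_tpair (v := (⟨p, r s • v⟩ : TangentBundle (𝓡 7) M)) hps
    rw [← this]
    congr 1
    exact congrArg (Prod.mk _) (map_smul (tcoordL (𝓡 7) p p) (r s) v).symm
  have hcd : HasDerivAt (fun s => ((extChartAt (𝓡 7) p p, r s • tcoordL (𝓡 7) p p v) : ℝ⁷ × ℝ⁷))
      (0, (1 : ℝ) • tcoordL (𝓡 7) p p v) 0 :=
    (hasDerivAt_const _ _).prodMk (hr1.smul_const _)
  have h3 : (extChartAt (𝓡 7) p p, r 0 • tcoordL (𝓡 7) p p v)
      = ((extChartAt (𝓡 7) p p, 0) : ℝ⁷ × ℝ⁷) := by rw [hr0, zero_smul]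
  have h4 := HasFDerivAt.comp_hasDerivAt (0 : ℝ) (by rw [h3]; exact hd) hcd
  have h5 : (fun s => extChartAt (𝓡 7) p (expMap h ⟨p, r s • v⟩))
      = (fun z => extChartAt (𝓡 7) p (expMap h (tpoint p z))) ∘
        fun s => (extChartAt (𝓡 7) p p, r s • tcoordL (𝓡 7) p p v) := by
    funext s
    simp only [Function.comp_apply, hc]
  rw [h5, h4.deriv]
  simp only [add_apply, ContinuousLinearMap.coe_fst', ContinuousLinearMap.coe_snd', one_smul,
    zero_add]
  rfl

variable {S : Type*} [TopologicalSpace S] [ChartedSpace (EuclideanSpace ℝ (Fin 6)) S]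
  [IsManifold (𝓡 6) ∞ S]

/-- The normal exponential map of `g(φ)`, reparametrized so that its fibres become `(-1, 1)`, is a
tubular neighbourhood of a hypersurface with a smooth unit normal field. -/
theorem exists_isTubularNeighbourhood [Nonempty S] [T2Space M] [SecondCountableTopology M]
    {φ : FormField 7 M 3} (hφ : IsPositiveForm φ) (hs : IsSmoothForm φ)
    {j : S → M} (hj : Manifold.IsSmoothEmbedding (𝓡 6) (𝓡 7) ∞ j)
    {n : ∀ y, TangentSpace (𝓡 7) (j y)}
    (hn : ContMDiff (𝓡 6) (𝓡 7).tangent ∞ (fun y => (⟨j y, n y⟩ : TangentBundle (𝓡 7) M)))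
    (hnu : ∀ y, IsUnitNormalAt φ j y (n y)) {W : Set M} (hW : IsOpen W) (hjW : range j ⊆ W) :
    ∃ T, IsTubularNeighbourhood φ j T ∧ T ⊆ W := by
  let h := g2Metric7 φ hφ hs
  have : LocallyCompactSpace M := ChartedSpace.locallyCompactSpace ℝ⁷ M
  have : LocallyCompactSpace S := ChartedSpace.locallyCompactSpace (EuclideanSpace ℝ (Fin 6)) S
  have : SecondCountableTopology S := hj.isEmbedding.secondCountableTopology
  have : T2Space S := hj.isEmbedding.t2Space
  have hjs : ContMDiff (𝓡 6) (𝓡 7) ∞ j := hj.isImmersion.contMDiff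
  have hind : ∀ (y : S) (w : TangentSpace (𝓡 6) y) (s : ℝ),
      mfderiv (𝓡 6) (𝓡 7) j y w + s • n y = 0 → w = 0 ∧ s = 0 := by
    intro y w s hws
    have h1 : h.inner (j y) (n y) (mfderiv (𝓡 6) (𝓡 7) j y w + s • n y) = 0 := by
      rw [hws, map_zero]
    rw [map_add, map_smul, smul_eq_mul] at h1
    have h2 : h.inner (j y) (n y) (mfderiv (𝓡 6) (𝓡 7) j y w) = 0 := (hnu y).2 w
    have h3 : h.inner (j y) (n y) (n y) = 1 := (hnu y).1
    rw [h2, h3, zero_add, mul_one] at h1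
    refine ⟨?_, h1⟩
    rw [h1, zero_smul, add_zero] at hws
    exact injective_mfderiv_of_isImmersionAt (hj.isImmersion.isImmersionAt y)
      (hws.trans (map_zero _).symm)
  choose θ hθ0 hθW hθe hθs hθi using fun y =>
    exists_normal_expMap_chart h hjs hn y (hind y) hW (hjW (mem_range_self y))
  set η₀ : S × ℝ → M := fun a => expMap h ⟨j a.1, a.2 • n a.1⟩ with hη₀
  have hη₀0 : ∀ y, η₀ (y, 0) = j y := fun y => by
    have : (⟨j y, (0 : ℝ) • n y⟩ : TangentBundle (𝓡 7) M) = ⟨j y, 0⟩ := by rw [zero_smul]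
    simp only [hη₀, this, expMap_zero]
  obtain ⟨D, hD, hD0, hDi⟩ : ∃ D : Set (S × ℝ), IsOpen D ∧ (∀ y, (y, (0 : ℝ)) ∈ D) ∧
      InjOn η₀ D := by
    have : TopologicalSpace.MetrizableSpace M := Manifold.metrizableSpace (𝓡 7) M
    let _ := TopologicalSpace.metrizableSpaceMetric M
    let _ := hj.isEmbedding.comapMetricSpace j
    refine exists_injOn_nhds_zero (S := S) (j := j) (Isometry.of_dist_eq fun _ _ => rfl) hη₀0
      (fun y => ?_) (fun y => ⟨(θ y).source, (θ y).open_source.mem_nhds (hθ0 y), ?_⟩)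
    · refine ((θ y).continuousAt (hθ0 y)).congr ?_
      filter_upwards [(θ y).open_source.mem_nhds (hθ0 y)] with a ha using hθe y a ha
    · exact (θ y).injOn.congr fun a ha => hθe y a ha
  obtain ⟨k, hks, hk0, hkD⟩ := exists_contMDiff_width (𝓡 6)
    (hD.inter (isOpen_iUnion fun y => (θ y).open_source))
    (fun y => ⟨hD0 y, mem_iUnion.2 ⟨y, hθ0 y⟩⟩)
  -- the domain of the squeezed normal exponential map
  set D' : Set (S × ℝ) := {a | (k a.1 + 1) * a.2 ^ 2 < 1} with hD'
  have hD'o : IsOpen D' := isOpen_lt (((hks.continuous.comp continuous_fst).add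
    continuous_const).mul (continuous_snd.pow 2)) continuous_const
  have hD'D : ∀ a ∈ D', a ∈ D ∧ ∃ y, a ∈ (θ y).source := by
    intro a ha
    have h1 : k a.1 * a.2 ^ 2 < 1 := lt_of_le_of_lt (by nlinarith [sq_nonneg a.2]) ha
    obtain ⟨h2, h3⟩ := hkD a.1 a.2 h1
    exact ⟨h2, mem_iUnion.1 h3⟩
  have hD'i : InjOn η₀ D' := hDi.mono fun a ha => (hD'D a ha).1
  set T := η₀ '' D' with hT
  have hTloc : ∀ y, (θ y) '' ((θ y).source ∩ D') ⊆ T := by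
    rintro y _ ⟨a, ⟨ha, ha'⟩, rfl⟩
    exact ⟨a, ha', (hθe y a ha).symm⟩
  have hloco : ∀ y, IsOpen ((θ y) '' ((θ y).source ∩ D')) := fun y =>
    (θ y).isOpen_image_of_subset_source ((θ y).open_source.inter hD'o) inter_subset_left
  have hTo : IsOpen T := by
    refine isOpen_iff_mem_nhds.2 ?_
    rintro _ ⟨a, ha, rfl⟩
    obtain ⟨y, hy⟩ := (hD'D a ha).2
    refine mem_of_superset ((hloco y).mem_nhds ⟨a, ⟨hy, ha⟩, hθe y a hy⟩) (hTloc y)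
  have hη₀s : ContMDiffOn ((𝓡 6).prod 𝓘(ℝ, ℝ)) (𝓡 7) ∞ η₀ D' := by
    intro a ha
    obtain ⟨y, hy⟩ := (hD'D a ha).2
    refine ContMDiffAt.contMDiffWithinAt (((hθs y).contMDiffAt
      ((θ y).open_source.mem_nhds hy)).congr_of_eventuallyEq ?_)
    filter_upwards [(θ y).open_source.mem_nhds hy] with b hb using (hθe y b hb).symm
  set g₀ : M → S × ℝ := Function.invFunOn η₀ D' with hg₀
  have hg₀m : ∀ x ∈ T, g₀ x ∈ D' ∧ η₀ (g₀ x) = x := fun x hx =>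
    ⟨Function.invFunOn_mem hx, Function.invFunOn_eq hx⟩
  have hg₀s : ContMDiffOn (𝓡 7) ((𝓡 6).prod 𝓘(ℝ, ℝ)) ∞ g₀ T := by
    intro x hx
    obtain ⟨a, ha, rfl⟩ := hx
    obtain ⟨y, hy⟩ := (hD'D a ha).2
    have hmem : η₀ a ∈ (θ y) '' ((θ y).source ∩ D') := ⟨a, ⟨hy, ha⟩, hθe y a hy⟩
    have htar : η₀ a ∈ (θ y).target := by
      rw [← show θ y a = η₀ a from hθe y a hy]; exact (θ y).map_source hy
    refine ContMDiffAt.contMDiffWithinAt (((hθi y).contMDiffAt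
      ((θ y).open_target.mem_nhds htar)).congr_of_eventuallyEq ?_)
    filter_upwards [(hloco y).mem_nhds hmem] with x hx
    obtain ⟨b, ⟨hb, hb'⟩, rfl⟩ := hx
    rw [(θ y).left_inv hb]
    exact hD'i (hg₀m _ (hTloc y ⟨b, ⟨hb, hb'⟩, rfl⟩)).1 hb'
      ((hg₀m _ (hTloc y ⟨b, ⟨hb, hb'⟩, rfl⟩)).2.trans (hθe y b hb))
  -- squeezing the fibres to length one
  set q : S × ℝ → S × ℝ := fun a => (a.1, a.2 / √(1 + k a.1 * a.2 ^ 2)) with hq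
  set q' : S × ℝ → S × ℝ := fun a => (a.1, a.2 / √(1 - k a.1 * a.2 ^ 2)) with hq'
  have hkf : ContMDiff ((𝓡 6).prod 𝓘(ℝ, ℝ)) 𝓘(ℝ, ℝ) ∞ (fun a : S × ℝ => k a.1) :=
    hks.comp contMDiff_fst
  have hk2 : ContMDiff ((𝓡 6).prod 𝓘(ℝ, ℝ)) 𝓘(ℝ, ℝ × ℝ) ∞ (fun a : S × ℝ => (k a.1, a.2)) :=
    hkf.prodMk_space contMDiff_snd
  have hqs : ContMDiff ((𝓡 6).prod 𝓘(ℝ, ℝ)) ((𝓡 6).prod 𝓘(ℝ, ℝ)) ∞ q := by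
    refine contMDiff_fst.prodMk fun a => ?_
    have h1 : ContDiffAt ℝ ∞ (fun b : ℝ × ℝ => b.2 / √(1 + b.1 * b.2 ^ 2)) (k a.1, a.2) := by
      have h2 : 0 < 1 + k a.1 * a.2 ^ 2 := by have := hk0 a.1; positivity
      exact contDiffAt_snd.div ((contDiffAt_const.add (contDiffAt_fst.mul
        (contDiffAt_snd.pow 2))).sqrt h2.ne') (Real.sqrt_pos.2 h2).ne'
    exact h1.contMDiffAt.comp a hk2.contMDiffAt
  have hq's : ContMDiffOn ((𝓡 6).prod 𝓘(ℝ, ℝ)) ((𝓡 6).prod 𝓘(ℝ, ℝ)) ∞ q' D' := by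
    refine contMDiffOn_fst.prodMk fun a ha => ?_
    have h1 : ContDiffAt ℝ ∞ (fun b : ℝ × ℝ => b.2 / √(1 - b.1 * b.2 ^ 2)) (k a.1, a.2) := by
      have h2 : 0 < 1 - k a.1 * a.2 ^ 2 := by
        have : (k a.1 + 1) * a.2 ^ 2 < 1 := ha
        nlinarith [sq_nonneg a.2]
      exact contDiffAt_snd.div ((contDiffAt_const.sub (contDiffAt_fst.mul
        (contDiffAt_snd.pow 2))).sqrt h2.ne') (Real.sqrt_pos.2 h2).ne'
    exact (h1.contMDiffAt.comp a hk2.contMDiffAt).contMDiffWithinAt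
  have hqm : MapsTo q (univ ×ˢ Ioo (-1) 1) D' := fun a ha => squeeze_mem (hk0 a.1) ha.2
  have hq'm : MapsTo q' D' (univ ×ˢ Ioo (-1) 1) := fun a ha => ⟨mem_univ _, unsqueeze_mem ha⟩
  have hq'q : ∀ a, q' (q a) = a := fun a => Prod.ext rfl (unsqueeze_squeeze (hk0 a.1))
  have hqq' : ∀ a ∈ D', q (q' a) = a := fun a ha => Prod.ext rfl (squeeze_unsqueeze ha)
  refine ⟨T, ⟨hTo, 1, one_pos, η₀ ∘ q, ⟨fun a ha => ⟨q a, hqm ha, rfl⟩,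
    hη₀s.comp hqs.contMDiffOn hqm, q' ∘ g₀, fun x hx => hq'm (hg₀m x hx).1, ⟨?_, ?_⟩,
    hq's.comp hg₀s fun x hx => (hg₀m x hx).1⟩, fun y => ⟨?_, n y, hnu y, ?_⟩⟩, ?_⟩
  · intro a ha
    have : g₀ (η₀ (q a)) = q a := hD'i (hg₀m _ ⟨q a, hqm ha, rfl⟩).1 (hqm ha)
      (hg₀m _ ⟨q a, hqm ha, rfl⟩).2
    simp only [Function.comp_apply, this, hq'q]
  · intro x hx
    simp only [Function.comp_apply]
    rw [hqq' _ (hg₀m x hx).1, (hg₀m x hx).2]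
  · have : q (y, 0) = (y, 0) := by simp [hq]
    rw [Function.comp_apply, this, hη₀0]
  · have h2 : ∀ s : ℝ, 0 < 1 + k y * s ^ 2 := fun s => by have := hk0 y; positivity
    have h3 : ContDiff ℝ ∞ (fun s : ℝ => √(1 + k y * s ^ 2)) :=
      (contDiff_const.add (contDiff_const.mul (contDiff_id.pow 2))).sqrt fun s => (h2 s).ne'
    refine velocity_expMap_smul h (n y) (r := fun s => s / √(1 + k y * s ^ 2)) (contDiff_id.div h3
      fun s => (Real.sqrt_pos.2 (h2 s)).ne') (by simp) ?_
    have h4 := (hasDerivAt_id (0 : ℝ)).div ((h3.differentiable (by simp)) 0).hasDerivAt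
      (Real.sqrt_pos.2 (h2 0)).ne'
    refine h4.congr_deriv ?_
    simp
  · rintro _ ⟨a, ha, rfl⟩
    obtain ⟨y, hy⟩ := (hD'D a ha).2
    rw [← show θ y a = η₀ a from hθe y a hy]
    exact hθW y ((θ y).map_source hy)

end Coassoc

namespace Coassoc

local notation "ℝ⁷" => EuclideanSpace ℝ (Fin 7)

/-! ### The reflection of a tubular neighbourhood -/

variable {M : Type*} [TopologicalSpace M] [ChartedSpace ℝ⁷ M] [IsManifold (𝓡 7) ∞ M]

theorem velocity_comp_neg {γ : ℝ → M} {x : M} {v : TangentSpace (𝓡 7) x}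
    (hγ : MDifferentiableAt 𝓘(ℝ, ℝ) (𝓡 7) γ 0) (hv : velocity γ 0 = ⟨x, v⟩) :
    velocity (fun s => γ (-s)) 0 = ⟨x, -v⟩ := by
  have hx : γ 0 = x := congrArg TotalSpace.proj hv
  have hx' : γ (-0) = x := by rw [neg_zero, hx]
  have hxs : x ∈ (chartAt ℝ⁷ x).source := mem_chart_source _ _
  refine tangentBundle_ext (p := x) hx' (by show γ (-0) ∈ _; rw [hx']; exact hxs) ?_
  have hγ' : MDifferentiableAt 𝓘(ℝ, ℝ) (𝓡 7) (fun s => γ (-s)) 0 := by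
    have h0 : MDifferentiableAt 𝓘(ℝ, ℝ) (𝓡 7) γ (-(0 : ℝ)) := by rwa [neg_zero]
    exact h0.comp (0 : ℝ) differentiableAt_id.neg.mdifferentiableAt
  rw [tcoord_velocity hγ' (by rw [hx']; exact hxs)]
  have h1 : tcoord (𝓡 7) x ⟨x, -v⟩ = -tcoord (𝓡 7) x ⟨x, v⟩ := map_neg (tcoordL (𝓡 7) x x) v
  rw [h1, ← hv, tcoord_velocity hγ (by rw [hx]; exact hxs),
    deriv_comp_neg (fun s => extChartAt (𝓡 7) x (γ s)) 0, neg_zero]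

theorem tangentMap_velocity {f : M → M} {γ : ℝ → M} {t : ℝ}
    (hf : MDifferentiableAt (𝓡 7) (𝓡 7) f (γ t)) (hγ : MDifferentiableAt 𝓘(ℝ, ℝ) (𝓡 7) γ t) :
    velocity (fun s => f (γ s)) t = tangentMap (𝓡 7) (𝓡 7) f (velocity γ t) :=
  tangentMap_comp_at (I := 𝓘(ℝ, ℝ)) (⟨t, (1 : ℝ)⟩ : TangentBundle 𝓘(ℝ, ℝ) ℝ) hf hγ

theorem tangentMap_congr {E E' H H' A B : Type*} [NormedAddCommGroup E] [NormedSpace ℝ E]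
    [NormedAddCommGroup E'] [NormedSpace ℝ E'] [TopologicalSpace H] [TopologicalSpace H']
    {I : ModelWithCorners ℝ E H} {I' : ModelWithCorners ℝ E' H'}
    [TopologicalSpace A] [ChartedSpace H A] [TopologicalSpace B] [ChartedSpace H' B]
    {f g : A → B} {v : TangentBundle I A} (h : f =ᶠ[𝓝 v.1] g) :
    tangentMap I I' f v = tangentMap I I' g v := by
  have key : ∀ (x y : B) (u w : E'), x = y → u = w →
      (⟨x, (u : TangentSpace I' x)⟩ : TangentBundle I' B) = ⟨y, (w : TangentSpace I' y)⟩ := by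
    rintro x _ u _ rfl rfl; rfl
  exact key _ _ _ _ h.eq_of_nhds (DFunLike.congr_fun (h.mfderiv_eq : _) v.2)

theorem velocity_congr {γ₁ γ₂ : ℝ → M} {t : ℝ} (h : γ₁ =ᶠ[𝓝 t] γ₂) :
    velocity γ₁ t = velocity γ₂ t :=
  tangentMap_congr (I := 𝓘(ℝ, ℝ)) (v := (⟨t, (1 : ℝ)⟩ : TangentBundle 𝓘(ℝ, ℝ) ℝ)) h

variable {S : Type*} [TopologicalSpace S] [ChartedSpace (EuclideanSpace ℝ (Fin 6)) S]
  [IsManifold (𝓡 6) ∞ S]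

/-- `R` is a smooth involution of the open set `T` with fixed point set `S`, which acts on the
normal lines of `S` as `-1`. -/
structure IsReflection (φ : FormField 7 M 3) (j : S → M) (T : Set M) (R : M → M) : Prop where
  isOpen : IsOpen T
  range_subset : range j ⊆ T
  mapsTo : MapsTo R T T
  contMDiffOn : ContMDiffOn (𝓡 7) (𝓡 7) ∞ R T
  involutive : ∀ x ∈ T, R (R x) = x
  fixed_iff : ∀ x ∈ T, R x = x ↔ x ∈ range j
  normal : ∀ y, ∃ n : TangentSpace (𝓡 7) (j y), IsUnitNormalAt φ j y n ∧
    tangentMap (𝓡 7) (𝓡 7) R ⟨j y, n⟩ = ⟨j y, -n⟩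

/-- The reflection is `η (y, s) ↦ η (y, -s)`. -/
theorem IsTubularNeighbourhood.exists_isReflection {φ : FormField 7 M 3} {j : S → M} {T : Set M}
    (hT : IsTubularNeighbourhood φ j T) : ∃ R, IsReflection φ j T R := by
  obtain ⟨hTo, ε, hε, η, ⟨hm, hs, g, hgm, ⟨hgη, hηg⟩, hgs⟩, hη⟩ := hT
  have h0 : ∀ y : S, ((y, 0) : S × ℝ) ∈ (univ : Set S) ×ˢ Ioo (-ε) ε := fun y =>
    ⟨mem_univ _, by simpa using hε⟩
  have hneg : ∀ a ∈ (univ : Set S) ×ˢ Ioo (-ε) ε, ((a.1, -a.2) : S × ℝ) ∈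
      (univ : Set S) ×ˢ Ioo (-ε) ε := fun a ha =>
    ⟨mem_univ _, by have := ha.2.1; have := ha.2.2; constructor <;> linarith⟩
  set F : S × ℝ → S × ℝ := fun a => (a.1, -a.2) with hF
  have hFs : ContMDiff ((𝓡 6).prod 𝓘(ℝ, ℝ)) ((𝓡 6).prod 𝓘(ℝ, ℝ)) ∞ F :=
    contMDiff_fst.prodMk (contDiff_neg.contMDiff.comp contMDiff_snd)
  have hgη' : ∀ a ∈ (univ : Set S) ×ˢ Ioo (-ε) ε, η (F (g (η a))) = η (F a) := fun a ha => by
    rw [hgη ha]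
  have hRs : ContMDiffOn (𝓡 7) (𝓡 7) ∞ (fun x => η (F (g x))) T :=
    hs.comp (hFs.comp_contMDiffOn hgs) fun x hx => hneg _ (hgm hx)
  have hrange : range j ⊆ T := by
    rintro _ ⟨y, rfl⟩
    rw [← (hη y).1]; exact hm (h0 y)
  have hopen : IsOpen ((univ : Set S) ×ˢ Ioo (-ε) ε) := isOpen_univ.prod isOpen_Ioo
  refine ⟨fun x => η (F (g x)), hTo, hrange, fun x hx => hm (hneg _ (hgm hx)), hRs, ?_, ?_, ?_⟩
  · intro x hx
    show η (F (g (η (F (g x))))) = x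
    rw [hgη (hneg _ (hgm hx)), ← hηg hx]
    congr 1
    rw [hgη (hgm hx)]
    exact Prod.ext rfl (neg_neg _)
  · intro x hx
    constructor
    · intro h
      have h1 : F (g x) = g x := by
        exact (hgη (hneg _ (hgm hx))).symm.trans (congrArg g h)
      have h2 : (g x).2 = 0 := by
        have h3 : -(g x).2 = (g x).2 := congrArg Prod.snd h1
        linarith
      refine ⟨(g x).1, ?_⟩
      rw [← (hη _).1, ← h2]
      exact hηg hx
    · rintro ⟨y, rfl⟩
      show η (F (g (j y))) = j y
      rw [← (hη y).1, hgη (h0 y)]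
      simp [hF]
  · intro y
    obtain ⟨n, hn, hv⟩ := (hη y).2
    refine ⟨n, hn, ?_⟩
    have hc : ContMDiffAt 𝓘(ℝ, ℝ) (𝓡 7) ∞ (fun s => η (y, s)) 0 :=
      ContMDiffAt.comp (0 : ℝ) (hs.contMDiffAt (hopen.mem_nhds (h0 y)))
        (contMDiffAt_const.prodMk contMDiffAt_id)
    have hcd := hc.mdifferentiableAt (by simp)
    have hjT : η (y, 0) ∈ T := hm (h0 y)
    rw [← hv, ← tangentMap_velocity (f := fun x => η (F (g x)))
      ((hRs.contMDiffAt (hTo.mem_nhds hjT)).mdifferentiableAt (by simp)) hcd,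
      ← velocity_comp_neg hcd hv]
    refine velocity_congr ?_
    filter_upwards [isOpen_Ioo.mem_nhds (h0 y).2] with s hs
    exact hgη' (y, s) ⟨mem_univ _, hs⟩

namespace IsReflection

variable {φ : FormField 7 M 3} {j : S → M} {T : Set M} {R : M → M}

theorem mdifferentiableAt (hR : IsReflection φ j T R) {x : M} (hx : x ∈ T) :
    MDifferentiableAt (𝓡 7) (𝓡 7) R x :=
  (hR.contMDiffOn.contMDiffAt (hR.isOpen.mem_nhds hx)).mdifferentiableAt (by simp)

theorem apply_eq (hR : IsReflection φ j T R) (y : S) : R (j y) = j y :=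
  (hR.fixed_iff _ (hR.range_subset (mem_range_self y))).2 (mem_range_self y)

theorem tangentMap_tangentMap (hR : IsReflection φ j T R) {v : TangentBundle (𝓡 7) M}
    (hv : v.1 ∈ T) : tangentMap (𝓡 7) (𝓡 7) R (tangentMap (𝓡 7) (𝓡 7) R v) = v := by
  rw [← tangentMap_comp_at _ (hR.mdifferentiableAt (hR.mapsTo hv)) (hR.mdifferentiableAt hv)]
  have h : R ∘ R =ᶠ[𝓝 v.1] id := by
    filter_upwards [hR.isOpen.mem_nhds hv] with x hx using hR.involutive x hx
  rw [tangentMap_congr h, tangentMap_id]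
  rfl

theorem tangentMap_eq_self (hR : IsReflection φ j T R) (hj : ContMDiff (𝓡 6) (𝓡 7) ∞ j)
    {v : TangentBundle (𝓡 7) M} (hv : v ∈ range (tangentMap (𝓡 6) (𝓡 7) j)) :
    tangentMap (𝓡 7) (𝓡 7) R v = v := by
  obtain ⟨w, rfl⟩ := hv
  have h : R ∘ j = j := funext hR.apply_eq
  rw [← tangentMap_comp_at _ (hR.mdifferentiableAt (hR.range_subset (mem_range_self _)))
    ((hj _).mdifferentiableAt (by simp)), h]

end IsReflection

/-- The tangent space of `M` at a point of `S` is the sum of the tangent space of `S` and the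
normal line. -/
theorem exists_eq_mfderiv_add_smul {φ : FormField 7 M 3} {j : S → M} {y : S}
    (hinj : Function.Injective (mfderiv (𝓡 6) (𝓡 7) j y)) {n : TangentSpace (𝓡 7) (j y)}
    (hn : IsUnitNormalAt φ j y n) (v : TangentSpace (𝓡 7) (j y)) :
    ∃ (w : TangentSpace (𝓡 6) y) (s : ℝ), v = mfderiv (𝓡 6) (𝓡 7) j y w + s • n := by
  let L : (EuclideanSpace ℝ (Fin 6) × ℝ) →ₗ[ℝ] ℝ⁷ :=
    (show EuclideanSpace ℝ (Fin 6) →L[ℝ] ℝ⁷ from mfderiv (𝓡 6) (𝓡 7) j y).toLinearMap.coprod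
      (LinearMap.toSpanSingleton ℝ ℝ⁷ n)
  have hL : ∀ a, L a = mfderiv (𝓡 6) (𝓡 7) j y a.1 + a.2 • n := fun a => rfl
  have hLi : Function.Injective L := by
    refine (injective_iff_map_eq_zero L).2 fun ⟨w, s⟩ h => ?_
    have h0 : mfderiv (𝓡 6) (𝓡 7) j y w + s • n = 0 := (hL (w, s)).symm.trans h
    have h1 : g2Bilin φ (j y) n (mfderiv (𝓡 6) (𝓡 7) j y w + s • n) = 0 := by rw [h0, map_zero]
    rw [map_add, map_smul, smul_eq_mul, g2Bilin_apply, g2Bilin_apply, hn.1, hn.2 w, zero_add,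
      mul_one] at h1
    rw [h1, zero_smul, add_zero] at h0
    rw [hinj (h0.trans (map_zero _).symm), h1]
    rfl
  obtain ⟨a, ha⟩ := (LinearMap.injective_iff_surjective_of_finrank_eq_finrank (f := L)
    (by simp)).1 hLi v
  exact ⟨a.1, a.2, by rw [← hL]; exact ha.symm⟩

/-- A vector at a point of `S` which is orthogonal to a unit normal of `S` is tangent to `S`. -/
theorem mem_range_tangentMap_of_orthogonal {φ : FormField 7 M 3} {j : S → M} {x : M}
    (hinj : ∀ y, Function.Injective (mfderiv (𝓡 6) (𝓡 7) j y))
    (hnormal : ∀ y, ∃ n : TangentSpace (𝓡 7) (j y), IsUnitNormalAt φ j y n) (hx : x ∈ range j)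
    {m v : TangentSpace (𝓡 7) x}
    (hm : ∀ w : TangentSpace (𝓡 7) x,
      (⟨x, w⟩ : TangentBundle (𝓡 7) M) ∈ range (tangentMap (𝓡 6) (𝓡 7) j) → g2Metric φ x m w = 0)
    (hm1 : g2Metric φ x m m = 1) (hv : g2Metric φ x v m = 0) :
    (⟨x, v⟩ : TangentBundle (𝓡 7) M) ∈ range (tangentMap (𝓡 6) (𝓡 7) j) := by
  obtain ⟨y, rfl⟩ := hx
  obtain ⟨n, hn⟩ := hnormal y
  have hm' : ∀ w : TangentSpace (𝓡 6) y, g2Bilin φ (j y) m (mfderiv (𝓡 6) (𝓡 7) j y w) = 0 :=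
    fun w => hm _ ⟨⟨y, w⟩, rfl⟩
  have hn' : ∀ w : TangentSpace (𝓡 6) y, g2Bilin φ (j y) n (mfderiv (𝓡 6) (𝓡 7) j y w) = 0 := hn.2
  obtain ⟨w, s, rfl⟩ := exists_eq_mfderiv_add_smul (hinj y) hn v
  obtain ⟨w', s', rfl⟩ := exists_eq_mfderiv_add_smul (hinj y) hn m
  have hw' : mfderiv (𝓡 6) (𝓡 7) j y w' = 0 := by
    by_contra h0
    have h1 := hm' w'
    rw [map_add, map_smul, add_apply, smul_apply, hn' w', smul_zero, add_zero] at h1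
    exact (g2Metric_pos φ (j y) _ h0).ne' h1
  rw [hw', zero_add] at hm1 hv
  have h1 : s' * s' = 1 := by
    have h2 : g2Bilin φ (j y) (s' • n) (s' • n) = 1 := hm1
    have h3 : g2Bilin φ (j y) n n = 1 := hn.1
    rw [map_smul, map_smul, smul_apply, h3] at h2
    simpa using h2
  have h2 : s * s' = 0 := by
    have h2 : g2Bilin φ (j y) (mfderiv (𝓡 6) (𝓡 7) j y w + s • n) (s' • n) = 0 := hv
    have h3 : g2Bilin φ (j y) n n = 1 := hn.1
    have h4 : g2Bilin φ (j y) (mfderiv (𝓡 6) (𝓡 7) j y w) n = 0 :=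
      (g2Metric_comm φ (j y) _ _).trans (hn.2 w)
    rw [map_smul, map_add, add_apply, map_smul, smul_apply, h3, h4] at h2
    simp only [smul_eq_mul, zero_add, mul_one] at h2
    linarith
  have h3 : s = 0 := by
    have : s * (s' * s') = 0 := by rw [← mul_assoc, h2, zero_mul]
    rwa [h1, mul_one] at this
  rw [h3, zero_smul, add_zero]
  exact ⟨⟨y, w⟩, rfl⟩

end Coassoc

namespace Coassoc

local notation "ℝ⁷" => EuclideanSpace ℝ (Fin 7)

/-! ### A metric for which a hypersurface is totally geodesic -/

variable {M : Type*} [TopologicalSpace M] [ChartedSpace ℝ⁷ M] [IsManifold (𝓡 7) ∞ M]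
variable {S : Type*} [TopologicalSpace S] [ChartedSpace (EuclideanSpace ℝ (Fin 6)) S]
  [IsManifold (𝓡 6) ∞ S]

/-- The pullback of `g(φ)` under `R`. -/
noncomputable def g2Pull (φ : FormField 7 M 3) (R : M → M) (x : M) :
    TangentSpace (𝓡 7) x →L[ℝ] TangentSpace (𝓡 7) x →L[ℝ] ℝ :=
  pullBilin (g2Bilin φ (R x)) (mfderiv (𝓡 7) (𝓡 7) R x)

theorem g2Metric_congr (φ : FormField 7 M 3) {x x' : M} {u v : TangentSpace (𝓡 7) x}
    {u' v' : TangentSpace (𝓡 7) x'} (hu : (⟨x', u'⟩ : TangentBundle (𝓡 7) M) = ⟨x, u⟩)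
    (hv : (⟨x', v'⟩ : TangentBundle (𝓡 7) M) = ⟨x, v⟩) :
    g2Metric φ x' u' v' = g2Metric φ x u v := by
  obtain rfl : x' = x := congrArg TotalSpace.proj hu
  have h1 : u' = u := by simpa using hu
  have h2 : v' = v := by simpa using hv
  rw [h1, h2]

/-- The average of a metric and its reflection, cut off away from `S`. -/
theorem IsReflection.exists_metric [T2Space M] [SecondCountableTopology M]
    {φ : FormField 7 M 3} (hφ : IsPositiveForm φ) (hs : IsSmoothForm φ) {j : S → M}
    (hj : Manifold.IsSmoothEmbedding (𝓡 6) (𝓡 7) ∞ j) (hjc : IsClosed (range j))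
    {T : Set M} {R : M → M} (hR : IsReflection φ j T R) :
    ∃ g' : Metric7 M, (∀ x ∉ T, ∀ u v, g'.inner x u v = g2Metric φ x u v) ∧
      (∀ y u v, g'.inner (j y) u v = g2Metric φ (j y) u v) ∧
      ∃ U, IsOpen U ∧ range j ⊆ U ∧ U ⊆ T ∧ ∀ x ∈ U, ∀ u v, g'.inner x u v
        = g'.inner (R x) (mfderiv (𝓡 7) (𝓡 7) R x u) (mfderiv (𝓡 7) (𝓡 7) R x v) := by
  have : LocallyCompactSpace M := ChartedSpace.locallyCompactSpace ℝ⁷ M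
  have : TopologicalSpace.MetrizableSpace M := Manifold.metrizableSpace (𝓡 7) M
  obtain ⟨χ, hχ0, hχ1, hχ⟩ := exists_contMDiffMap_zero_one_nhds_of_isClosed (𝓡 7) (n := ⊤)
    hR.isOpen.isClosed_compl hjc (disjoint_compl_left_iff_subset.2 hR.range_subset)
  have hχs : ContMDiff (𝓡 7) 𝓘(ℝ, ℝ) ∞ χ := χ.contMDiff
  have hχ0' : ∀ x ∉ T, χ x = 0 := fun x hx => hχ0.self_of_nhdsSet x hx
  set b : ∀ x : M, TangentSpace (𝓡 7) x →L[ℝ] TangentSpace (𝓡 7) x →L[ℝ] ℝ := fun x =>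
    (1 - χ x / 2) • g2Bilin φ x + (χ x / 2) • g2Pull φ R x with hb
  have hbv : ∀ x u v, b x u v = (1 - χ x / 2) * g2Metric φ x u v + (χ x / 2) * g2Metric φ (R x)
      (mfderiv (𝓡 7) (𝓡 7) R x u) (mfderiv (𝓡 7) (𝓡 7) R x v) := fun x u v => rfl
  have hsymm : ∀ x u v, b x u v = b x v u := by
    intro x u v
    rw [hbv, hbv, g2Metric_comm, g2Metric_comm φ (R x)]
  have hpos : ∀ x v, v ≠ 0 → 0 < b x v v := by
    intro x v hv
    rw [hbv]
    have h1 := g2Metric_pos φ x v hv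
    have h2 : 0 ≤ g2Metric φ (R x) (mfderiv (𝓡 7) (𝓡 7) R x v) (mfderiv (𝓡 7) (𝓡 7) R x v) :=
      real_inner_self_nonneg
    obtain ⟨h3, h4⟩ := hχ x
    have h5 : 0 < (1 - χ x / 2) * g2Metric φ x v v := mul_pos (by linarith) h1
    have h6 := mul_nonneg (show 0 ≤ χ x / 2 by linarith) h2
    linarith
  have hsm : ∀ (p : M) (u w : ℝ⁷), ContMDiffAt (𝓡 7) 𝓘(ℝ, ℝ) ∞
      (fun x => b x (tframe (𝓡 7) p x u) (tframe (𝓡 7) p x w)) p := by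
    intro p u w
    have h1 : ContMDiffAt (𝓡 7) 𝓘(ℝ, ℝ) ∞
        (fun x => g2Metric φ x (tframe (𝓡 7) p x u) (tframe (𝓡 7) p x w)) p :=
      (g2Metric_contMDiffOn hφ hs p u w).contMDiffAt
        ((chartAt ℝ⁷ p).open_source.mem_nhds (mem_chart_source _ _))
    by_cases hp : p ∈ T
    · have hRp := hR.contMDiffOn.contMDiffAt (hR.isOpen.mem_nhds hp)
      have h2 : ∀ u : ℝ⁷, ContMDiffWithinAt (𝓡 7) (𝓡 7).tangent ∞ (fun x => (⟨R x,
          mfderiv (𝓡 7) (𝓡 7) R x (tframe (𝓡 7) p x u)⟩ : TangentBundle (𝓡 7) M)) univ p := by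
        intro u
        have h3 : ContMDiffAt (𝓡 7) (𝓡 7).tangent ∞
            (fun x => (⟨x, tframe (𝓡 7) p x u⟩ : TangentBundle (𝓡 7) M)) p :=
          contMDiffWithinAt_tframe (mem_chart_source ℝ⁷ p) contMDiffWithinAt_id
            contMDiffWithinAt_const
        have h4 : ContMDiffOn (𝓡 7).tangent (𝓡 7).tangent ∞
            (tangentMapWithin (𝓡 7) (𝓡 7) R T) (TotalSpace.proj ⁻¹' T) :=
          hR.contMDiffOn.contMDiffOn_tangentMapWithin (by simp) hR.isOpen.uniqueMDiffOn
        have hTo : IsOpen ((TotalSpace.proj : TangentBundle (𝓡 7) M → M) ⁻¹' T) :=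
          hR.isOpen.preimage (FiberBundle.continuous_proj _ _)
        have h5 : ContMDiffAt (𝓡 7) (𝓡 7).tangent ∞
            (fun x => tangentMapWithin (𝓡 7) (𝓡 7) R T ⟨x, tframe (𝓡 7) p x u⟩) p :=
          ContMDiffAt.comp p (h4.contMDiffAt (hTo.mem_nhds hp)) h3
        refine h5.congr_of_eventuallyEq ?_
        filter_upwards [hR.isOpen.mem_nhds hp] with x hx
        rw [tangentMapWithin_eq_tangentMap (hR.isOpen.uniqueMDiffWithinAt hx)
          (hR.mdifferentiableAt hx)]
        rfl
      have h3 : ContMDiffAt (𝓡 7) 𝓘(ℝ, ℝ) ∞ (fun x => g2Metric φ (R x)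
          (mfderiv (𝓡 7) (𝓡 7) R x (tframe (𝓡 7) p x u))
          (mfderiv (𝓡 7) (𝓡 7) R x (tframe (𝓡 7) p x w))) p :=
        metric7_contMDiffWithinAt (g2Metric7 φ hφ hs) (h2 u) (h2 w)
      have h4 : ContMDiffAt (𝓡 7) 𝓘(ℝ, ℝ) ∞ (fun x => χ x / 2) p := by
        have h5 : ContDiff ℝ ∞ (fun t : ℝ => t / 2) := contDiff_id.div_const 2
        exact h5.contMDiff.contMDiffAt.comp p hχs.contMDiffAt
      exact ((contMDiffAt_const.sub h4).mul h1).add (h4.mul h3)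
    · refine h1.congr_of_eventuallyEq ?_
      filter_upwards [eventually_nhdsSet_iff_forall.1 hχ0 p hp] with x hx
      rw [hbv, hx]
      simp
  refine ⟨metric7OfSmooth b hsymm hpos hsm, fun x hx u v => ?_, fun y u v => ?_, ?_⟩
  · show b x u v = _
    rw [hbv, hχ0' x hx]
    simp
  · show b (j y) u v = _
    have hyT : j y ∈ T := hR.range_subset (mem_range_self y)
    obtain ⟨n, hn, hnR⟩ := hR.normal y
    -- the reflection is an isometry of the tangent space at a point of `S`
    have hiso : g2Metric φ (R (j y)) (mfderiv (𝓡 7) (𝓡 7) R (j y) u)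
        (mfderiv (𝓡 7) (𝓡 7) R (j y) v) = g2Metric φ (j y) u v := by
      have hinj := injective_mfderiv_of_isImmersionAt (hj.isImmersion.isImmersionAt y)
      have hjT : ∀ w, (⟨R (j y), mfderiv (𝓡 7) (𝓡 7) R (j y) (mfderiv (𝓡 6) (𝓡 7) j y w)⟩ :
          TangentBundle (𝓡 7) M) = ⟨j y, mfderiv (𝓡 6) (𝓡 7) j y w⟩ := fun w =>
        hR.tangentMap_eq_self hj.isImmersion.contMDiff ⟨⟨y, w⟩, rfl⟩
      have hn1 : ∀ s : ℝ, (⟨R (j y), mfderiv (𝓡 7) (𝓡 7) R (j y) (s • n)⟩ :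
          TangentBundle (𝓡 7) M) = ⟨j y, -(s • n)⟩ := by
        intro s
        have key : ∀ (x : M) (L : TangentSpace (𝓡 7) (j y) →L[ℝ] TangentSpace (𝓡 7) x),
            (⟨x, L n⟩ : TangentBundle (𝓡 7) M) = ⟨j y, -n⟩ →
            (⟨x, L (s • n)⟩ : TangentBundle (𝓡 7) M) = ⟨j y, -(s • n)⟩ := by
          intro x L h
          obtain rfl : x = j y := congrArg TotalSpace.proj h
          have h1 : L n = -n := by simpa using h
          rw [map_smul, h1, smul_neg]
        exact key _ _ hnR
      have hmap : ∀ (w : TangentSpace (𝓡 6) y) (s : ℝ), (⟨R (j y), mfderiv (𝓡 7) (𝓡 7) R (j y)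
          (mfderiv (𝓡 6) (𝓡 7) j y w + s • n)⟩ : TangentBundle (𝓡 7) M)
          = ⟨j y, mfderiv (𝓡 6) (𝓡 7) j y w - s • n⟩ := by
        intro w s
        have key : ∀ (x : M) (L : TangentSpace (𝓡 7) (j y) →L[ℝ] TangentSpace (𝓡 7) x)
            (a a' c c' : TangentSpace (𝓡 7) (j y)),
            (⟨x, L a⟩ : TangentBundle (𝓡 7) M) = ⟨j y, a'⟩ →
            (⟨x, L c⟩ : TangentBundle (𝓡 7) M) = ⟨j y, c'⟩ →
            (⟨x, L (a + c)⟩ : TangentBundle (𝓡 7) M) = ⟨j y, a' + c'⟩ := by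
          intro x L a a' c c' h h'
          obtain rfl : x = j y := congrArg TotalSpace.proj h
          have h1 : L a = a' := by simpa using h
          have h2 : L c = c' := by simpa using h'
          rw [map_add, h1, h2]
        rw [sub_eq_add_neg]
        exact key _ _ _ _ _ _ (hjT w) (hn1 s)
      obtain ⟨w, s, rfl⟩ := exists_eq_mfderiv_add_smul hinj hn u
      obtain ⟨w', s', rfl⟩ := exists_eq_mfderiv_add_smul hinj hn v
      rw [g2Metric_congr φ (hmap w s) (hmap w' s'), ← g2Bilin_apply, ← g2Bilin_apply]
      have h1 : ∀ w, g2Bilin φ (j y) n (mfderiv (𝓡 6) (𝓡 7) j y w) = 0 := hn.2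
      have h2 : ∀ w, g2Bilin φ (j y) (mfderiv (𝓡 6) (𝓡 7) j y w) n = 0 := fun w =>
        (g2Metric_comm φ (j y) _ _).trans (h1 w)
      simp only [map_add, map_sub, map_smul, add_apply, sub_apply, smul_apply, h1, h2, smul_zero,
        add_zero, sub_zero, zero_add, zero_sub]
      ring
    rw [hbv, hiso]
    ring
  · set U₀ : Set M := interior (χ ⁻¹' {1}) with hU₀
    have hU₀1 : ∀ x ∈ U₀, χ x = 1 := fun x hx =>
      mem_singleton_iff.1 (interior_subset (s := χ ⁻¹' {1}) hx)
    have hjU₀ : range j ⊆ U₀ := subset_interior_iff_mem_nhdsSet.2 hχ1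
    have hV : IsOpen (T ∩ R ⁻¹' U₀) :=
      hR.contMDiffOn.continuousOn.isOpen_inter_preimage hR.isOpen isOpen_interior
    refine ⟨(T ∩ R ⁻¹' U₀) ∩ U₀, hV.inter isOpen_interior, ?_, fun x hx => hx.1.1, ?_⟩
    · rintro _ ⟨y, rfl⟩
      refine ⟨⟨hR.range_subset (mem_range_self y), ?_⟩, hjU₀ (mem_range_self y)⟩
      rw [mem_preimage, hR.apply_eq]
      exact hjU₀ (mem_range_self y)
    · rintro x ⟨⟨hxT, hxR⟩, hx⟩ u v
      show b x u v = b (R x) _ _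
      have hRR : g2Metric φ (R (R x))
          (mfderiv (𝓡 7) (𝓡 7) R (R x) (mfderiv (𝓡 7) (𝓡 7) R x u))
          (mfderiv (𝓡 7) (𝓡 7) R (R x) (mfderiv (𝓡 7) (𝓡 7) R x v)) = g2Metric φ x u v :=
        g2Metric_congr φ (hR.tangentMap_tangentMap (v := ⟨x, u⟩) hxT)
          (hR.tangentMap_tangentMap (v := ⟨x, v⟩) hxT)
      rw [hbv, hbv, hU₀1 x hx, hU₀1 _ hxR, hRR]
      ring

/-- A geodesic which is tangent to the fixed point set `S` of a reflection which is an isometry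
stays in `S`: it coincides with its own reflection. -/
theorem IsReflection.geodesic_mem_range {φ : FormField 7 M 3} {j : S → M}
    (hj : ContMDiff (𝓡 6) (𝓡 7) ∞ j) (hjc : IsClosed (range j))
    {T : Set M} {R : M → M} (hR : IsReflection φ j T R) {h : Metric7 M} {U : Set M}
    (hU : IsOpen U) (hjU : range j ⊆ U) (hUT : U ⊆ T)
    (hiso : ∀ x ∈ U, ∀ u v, h.inner x u v
      = h.inner (R x) (mfderiv (𝓡 7) (𝓡 7) R x u) (mfderiv (𝓡 7) (𝓡 7) R x v))
    {γ : ℝ → M} {J : Set ℝ} (hJ : IsOpen J) (hJc : IsPreconnected J) (hγ : IsGeodesicOn h γ J)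
    {t₀ : ℝ} (ht₀ : t₀ ∈ J) (hv : velocity γ t₀ ∈ range (tangentMap (𝓡 6) (𝓡 7) j)) :
    ∀ t ∈ J, γ t ∈ range j := by
  have hloc : ∀ t ∈ J, IsLocalGeodesicAt h γ t := fun t ht => hγ.isLocalGeodesicAt hJ ht
  have hcont : ∀ t ∈ J, ContinuousAt γ t := fun t ht => (hloc t ht).contMDiffAt.continuousAt
  have hRs : ∀ x ∈ U, ContMDiffAt (𝓡 7) (𝓡 7) ∞ R x := fun x hx =>
    hR.contMDiffOn.contMDiffAt (hR.isOpen.mem_nhds (hUT hx))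
  have hRloc : ∀ t ∈ J, γ t ∈ U → IsLocalGeodesicAt h (fun s => R (γ s)) t := by
    intro t ht htU
    filter_upwards [hloc t ht, (hcont t ht).eventually (hU.mem_nhds htU)] with s hs hsU
    refine ⟨(hRs _ hsU).comp s hs.1, fun q hq => ?_⟩
    refine geodesicDefect_isometry (p := γ s) (hRs _ hsU) ?_ hs.1 (mem_chart_source _ _) hq
      (hs.2 _ (mem_chart_source _ _))
    filter_upwards [hU.mem_nhds hsU] with x hx using hiso x hx
  have hRv : ∀ t ∈ J, γ t ∈ U → velocity (fun s => R (γ s)) t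
      = tangentMap (𝓡 7) (𝓡 7) R (velocity γ t) := fun t ht htU =>
    tangentMap_velocity ((hRs _ htU).mdifferentiableAt (by simp))
      ((hloc t ht).contMDiffAt.mdifferentiableAt (by simp))
  set A : Set ℝ := {t | ∀ᶠ s in 𝓝 t, γ s ∈ range j} with hA
  have hAo : IsOpen A := isOpen_setOfPred_eventually_nhds
  have hmem : ∀ t ∈ J, γ t ∈ U → velocity (fun s => R (γ s)) t = velocity γ t → t ∈ A := by
    intro t ht htU hvt
    filter_upwards [(hRloc t ht htU).eventuallyEq (hloc t ht) hvt,
      (hcont t ht).eventually (hU.mem_nhds htU)] with s hs hsU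
    exact (hR.fixed_iff _ (hUT hsU)).1 hs
  have hsub : J ⊆ A := by
    refine hJc.subset_of_closure_inter_subset hAo ⟨t₀, ht₀, ?_⟩ ?_
    · have htU : γ t₀ ∈ U := by
        obtain ⟨w, hw⟩ := hv
        have : j w.1 = γ t₀ := congrArg TotalSpace.proj hw
        rw [← this]; exact hjU (mem_range_self _)
      exact hmem t₀ ht₀ htU (by rw [hRv t₀ ht₀ htU, hR.tangentMap_eq_self hj hv])
    · rintro t ⟨htA, ht⟩
      have hfreq : ∃ᶠ s in 𝓝 t, s ∈ A := mem_closure_iff_frequently.1 htA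
      have hγt : γ t ∈ range j := by
        have h1 : ∃ᶠ s in 𝓝 t, γ s ∈ range j := hfreq.mono fun s hs => hs.self_of_nhds
        exact hjc.closure_subset (mem_closure_of_frequently_of_tendsto h1 (hcont t ht))
      have htU : γ t ∈ U := hjU hγt
      have hRγ : R (γ t) = γ t := (hR.fixed_iff _ (hUT htU)).2 hγt
      have hps : γ t ∈ (chartAt ℝ⁷ (γ t)).source := mem_chart_source _ _
      have hps' : R (γ t) ∈ (chartAt ℝ⁷ (γ t)).source := by rw [hRγ]; exact hps
      refine hmem t ht htU (tangentBundle_ext (p := γ t) hRγ hps' ?_)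
      refine tendsto_nhds_unique_of_frequently_eq
        (continuousAt_tcoord_velocity (γ := fun s => R (γ s))
          ((hRloc t ht htU).mono fun s hs => hs.1) hps')
        (continuousAt_tcoord_velocity ((hloc t ht).mono fun s hs => hs.1) hps) ?_
      refine hfreq.mono fun s hs => ?_
      congr 1
      refine velocity_congr ?_
      filter_upwards [hs] with r hr
      exact (hR.fixed_iff _ (hR.range_subset hr)).2 hr
  exact fun t ht => (hsub ht).self_of_nhds

end Coassoc

namespace Coassoc

local notation "ℝ⁷" => EuclideanSpace ℝ (Fin 7)
local notation "ℝ⁴" => EuclideanSpace ℝ (Fin 4)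

variable {M : Type*} [TopologicalSpace M] [ChartedSpace ℝ⁷ M] [IsManifold (𝓡 7) ∞ M]
variable {S : Type*} [TopologicalSpace S] [ChartedSpace (EuclideanSpace ℝ (Fin 6)) S]
  [IsManifold (𝓡 6) ∞ S]
variable {N : Type*} [TopologicalSpace N] [ChartedSpace (EuclideanHalfSpace 4) N]

/-! ### The metric of a scaffold -/

/-- The inward normal is the vector representing the first coordinate, normalized. -/
theorem exists_isInwardNormal (φ : FormField 7 M 3) {i : N → M} {z : N}
    (hinj : Function.Injective (mfderiv (𝓡∂ 4) (𝓡 7) i z)) : ∃ n, IsInwardNormal φ i z n := by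
  let d : ℝ⁴ →L[ℝ] ℝ⁷ := mfderiv (𝓡∂ 4) (𝓡 7) i z
  let B : ℝ⁴ →L[ℝ] ℝ⁴ →L[ℝ] ℝ := (g2Bilin φ (i z) : ℝ⁷ →L[ℝ] ℝ⁷ →L[ℝ] ℝ).bilinearComp d d
  have hB : ∀ u v, B u v = g2Metric φ (i z) (mfderiv (𝓡∂ 4) (𝓡 7) i z u)
    (mfderiv (𝓡∂ 4) (𝓡 7) i z v) := fun u v => rfl
  have hpos : ∀ v, v ≠ 0 → 0 < B v v := fun v hv =>
    g2Metric_pos φ _ _ fun h => hv (hinj (h.trans (map_zero _).symm))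
  obtain ⟨e, he⟩ := exists_equiv_of_pos B hpos
  let ℓ : ℝ⁴ →L[ℝ] ℝ := EuclideanSpace.proj 0
  set n := e.symm ℓ with hn
  have hBn : ∀ u : ℝ⁴, B n u = u 0 := by
    intro u
    have : B n = ℓ := by rw [← he]; exact e.apply_symm_apply ℓ
    rw [this]; rfl
  have hn0 : n ≠ 0 := by
    intro h
    have h1 := hBn (EuclideanSpace.single 0 1)
    rw [h] at h1
    simp at h1
  have hp := hpos n hn0
  have hs : 0 < √(B n n) := Real.sqrt_pos.2 hp
  refine ⟨((√(B n n))⁻¹ • n : ℝ⁴), ?_, ?_, ?_⟩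
  · show 0 < ((√(B n n))⁻¹ • n : ℝ⁴) 0
    rw [PiLp.smul_apply, smul_eq_mul, ← hBn]
    positivity
  · rw [← hB, map_smul, map_smul, smul_apply, smul_eq_mul, smul_eq_mul, ← mul_assoc, ← mul_inv,
      Real.mul_self_sqrt hp.le, inv_mul_cancel₀ hp.ne']
  · intro w hw
    have key : ∀ w : ℝ⁴, w 0 = 0 → B ((√(B n n))⁻¹ • n) w = 0 := fun w hw => by
      rw [map_smul, smul_apply, hBn w, hw, smul_zero]
    exact key w hw

/-- Near a scaffold the metric `g(φ)` can be modified so that the scaffold becomes totally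
geodesic; the geodesics leaving `N` orthogonally at its boundary then stay in the scaffold. -/
theorem exists_metric_of_isScaffold [T2Space M] [SecondCountableTopology M]
    {φ : FormField 7 M 3} (hφ : IsPositiveForm φ) (hs : IsSmoothForm φ) {i : N → M}
    (hinj : ∀ z, Function.Injective (mfderiv (𝓡∂ 4) (𝓡 7) i z))
    (hb : ((𝓡∂ 4).boundary N).Nonempty) {j : S → M}
    (hj : Manifold.IsSmoothEmbedding (𝓡 6) (𝓡 7) ∞ j) (hjc : IsClosed (range j))
    (hS : IsScaffold φ i j) {W : Set M} (hW : IsOpen W) (hSW : range j ⊆ W) :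
    ∃ (T : Set M) (g' : Metric7 M), IsTubularNeighbourhood φ j T ∧ T ⊆ W ∧
      (∀ x ∉ T, ∀ u v, g'.inner x u v = g2Metric φ x u v) ∧ IsTotallyGeodesic g' j ∧
      ∀ z ∈ (𝓡∂ 4).boundary N, ∀ v ∈ normalSpace g' i z,
        (⟨i z, v⟩ : TangentBundle (𝓡 7) M) ∈ expDomain g' → expMap g' ⟨i z, v⟩ ∈ range j := by
  obtain ⟨n, hn, hnu, -⟩ := hS.symplectic
  have : Nonempty S := by
    obtain ⟨z, hz⟩ := hb
    obtain ⟨y, -⟩ := hS.boundary_subset z hz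
    exact ⟨y⟩
  have hjs : ContMDiff (𝓡 6) (𝓡 7) ∞ j := hj.isImmersion.contMDiff
  have hjinj : ∀ y, Function.Injective (mfderiv (𝓡 6) (𝓡 7) j y) := fun y =>
    injective_mfderiv_of_isImmersionAt (hj.isImmersion.isImmersionAt y)
  obtain ⟨T, hT, hTW⟩ := exists_isTubularNeighbourhood hφ hs hj hn hnu hW hSW
  obtain ⟨R, hR⟩ := hT.exists_isReflection
  obtain ⟨g', hg', hgS, U, hU, hjU, hUT, hiso⟩ := hR.exists_metric hφ hs hj hjc
  refine ⟨T, g', hT, hTW, hg', fun γ δ hδ hγ hv => ?_, fun z hz v hv hvd => ?_⟩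
  · have h0 : (0 : ℝ) ∈ Ioo (-δ) δ := by simpa using hδ
    have := hR.geodesic_mem_range hjs hjc hU hjU hUT hiso isOpen_Ioo isPreconnected_Ioo hγ h0 hv
    filter_upwards [isOpen_Ioo.mem_nhds h0] with t ht using this t ht
  · obtain ⟨γ, hγ⟩ := hvd
    rw [expMap_eq hγ]
    obtain ⟨⟨δ, hδ, hγ'⟩, hγv⟩ := hγ
    obtain ⟨m, hm⟩ := exists_isInwardNormal φ (hinj z)
    have hiz := hS.boundary_subset z hz
    have hgz : ∀ u w, g'.inner (i z) u w = g2Metric φ (i z) u w := by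
      have key : ∀ x, x ∈ range j → ∀ u w, g'.inner x u w = g2Metric φ x u w := by
        rintro _ ⟨y, rfl⟩; exact hgS y
      exact key _ hiz
    have hvr : velocity γ 0 ∈ range (tangentMap (𝓡 6) (𝓡 7) j) := by
      rw [hγv]
      exact mem_range_tangentMap_of_orthogonal hjinj (fun y => ⟨n y, hnu y⟩) hiz
        (hS.normal z hz m hm) hm.2.1 ((hgz _ _).symm.trans (hv m))
    exact hR.geodesic_mem_range hjs hjc hU hjU hUT hiso isOpen_Ioo isPreconnected_Ioo hγ'
      (show (0 : ℝ) ∈ Ioo (-δ) (1 + δ) by constructor <;> linarith) hvr 1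
      (by constructor <;> linarith)

end Coassoc

namespace Coassoc

/-! ### Neighbourhoods of a compact zero section -/

/-- Let `ex : X → M` be injective on the image of a compact space `N` in `Y ⊆ X`, and suppose that
near each point of that image `ex` is on `Y` a chart of the half space `H` into `M`, with `Ψ` and
`Θ` inverse parametrization and coordinates of `Y`. Then `ex` is injective on a neighbourhood `V`
in `Y`, and the image of `V` is locally the image of the half space under the charts. Properness
comes from taking `V` inside a compact set on which `ex` is injective. -/
theorem exists_domain_of_local {N X M F : Type*} [TopologicalSpace N] [CompactSpace N]
    [TopologicalSpace X] [TopologicalSpace M] [T2Space M] [TopologicalSpace F]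
    [LocallyCompactSpace F] {s : N → X} (hs : Continuous s) {Y : Set X} (hsY : ∀ z, s z ∈ Y)
    {ex : X → M} (hinj : InjOn ex (range s)) {H : Set F} (hH : IsClosed H)
    (e : N → OpenPartialHomeomorph F M) (Ψ : N → F → X) (Θ : N → X → F) (O : N → Set X)
    (hO : ∀ z, IsOpen (O z)) (hsO : ∀ z, s z ∈ O z) (hex : ∀ z, ContinuousOn ex (O z))
    (hΘ : ∀ z, ContinuousOn (Θ z) (O z)) (hΨ : ∀ z, ContinuousOn (Ψ z) (e z).source)
    (hOY : ∀ z, ∀ v ∈ O z ∩ Y, Θ z v ∈ (e z).source ∩ H ∧ Ψ z (Θ z v) = v)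
    (hHY : ∀ z, ∀ a ∈ (e z).source ∩ H, Ψ z a ∈ Y)
    (he : ∀ z, ∀ a ∈ (e z).source, e z a = ex (Ψ z a)) :
    ∃ U : Set X, IsOpen U ∧ (∀ z, s z ∈ U) ∧ InjOn ex (U ∩ Y) ∧
      ∀ v ∈ U ∩ Y, ∃ z, v ∈ O z ∧ ∀ᶠ x in 𝓝 (ex v), x ∈ (e z).target ∧
        (x ∈ ex '' (U ∩ Y) ↔ (e z).symm x ∈ H) ∧
        (x ∈ ex '' (U ∩ Y) → Ψ z ((e z).symm x) ∈ U ∩ Y ∧ ex (Ψ z ((e z).symm x)) = x) := by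
  -- local charts give local injectivity on `Y`
  have hloc : ∀ z, InjOn ex (O z ∩ Y) := by
    intro z v hv w hw hvw
    obtain ⟨h1, h2⟩ := hOY z v hv
    obtain ⟨h3, h4⟩ := hOY z w hw
    rw [← h2, ← h4, (e z).injOn h1.1 h3.1]
    rw [he z _ h1.1, he z _ h3.1, h2, h4, hvw]
  obtain ⟨U₁, hU₁, hsU₁, hU₁i⟩ : ∃ U₁ : Set X, IsOpen U₁ ∧ (∀ z, s z ∈ U₁) ∧
      InjOn ex (U₁ ∩ Y) := by
    set s' : N → Y := fun z => ⟨s z, hsY z⟩ with hs'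
    have hs'c : Continuous s' := hs.subtype_mk _
    have hOn : ∀ z, ((↑) : Y → X) ⁻¹' O z ∈ 𝓝 (s' z) := fun z =>
      ((hO z).preimage continuous_subtype_val).mem_nhds (hsO z)
    obtain ⟨t, ht, hti⟩ := Set.InjOn.exists_mem_nhdsSet (f := fun v : Y => ex v) (s := range s')
      (by
        rintro _ ⟨z, rfl⟩ _ ⟨w, rfl⟩ h
        exact Subtype.ext (hinj (mem_range_self z) (mem_range_self w) h))
      (isCompact_range hs'c)
      (by
        rintro _ ⟨z, rfl⟩
        exact ContinuousAt.comp (f := ((↑) : Y → X)) (x := s' z)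
          ((hex z).continuousAt ((hO z).mem_nhds (hsO z))) continuous_subtype_val.continuousAt)
      (by
        rintro _ ⟨z, rfl⟩
        exact ⟨_, hOn z, fun v hv w hw h => Subtype.ext (hloc z ⟨hv, v.2⟩ ⟨hw, w.2⟩ h)⟩)
    obtain ⟨t', ht', hst', htt'⟩ := mem_nhdsSet_iff_exists.1 ht
    obtain ⟨U₁, hU₁, rfl⟩ := isOpen_induced_iff.1 ht'
    refine ⟨U₁, hU₁, fun z => hst' (mem_range_self z), fun v hv w hw h => ?_⟩
    exact congrArg Subtype.val (hti (htt' (show (⟨v, hv.2⟩ : Y) ∈ _ from hv.1))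
      (htt' (show (⟨w, hw.2⟩ : Y) ∈ _ from hw.1)) h)
  -- compact pieces of `Y` inside `U₁`
  have hC : ∀ z, ∃ C : Set F, IsCompact C ∧ Θ z (s z) ∈ interior C ∧
      C ⊆ (e z).source ∩ Ψ z ⁻¹' (O z ∩ U₁) := by
    intro z
    obtain ⟨h1, h2⟩ := hOY z _ ⟨hsO z, hsY z⟩
    obtain ⟨C, hC, hC1, hC2⟩ := exists_compact_subset
      ((hΨ z).isOpen_inter_preimage (e z).open_source ((hO z).inter hU₁))
      (show Θ z (s z) ∈ (e z).source ∩ Ψ z ⁻¹' (O z ∩ U₁) from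
        ⟨h1.1, by rw [mem_preimage, h2]; exact ⟨hsO z, hsU₁ z⟩⟩)
    exact ⟨C, hC, hC1, hC2⟩
  choose C hCc hsC hCs using hC
  set B : N → Set X := fun z => O z ∩ Θ z ⁻¹' interior (C z) with hB
  have hBo : ∀ z, IsOpen (B z) := fun z =>
    (hΘ z).isOpen_inter_preimage (hO z) isOpen_interior
  obtain ⟨t, ht⟩ := (isCompact_range hs).elim_finite_subcover B hBo (by
    rintro _ ⟨z, rfl⟩
    exact mem_iUnion.2 ⟨z, hsO z, hsC z⟩)
  set U : Set X := ⋃ z ∈ t, B z with hU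
  set K : Set X := ⋃ z ∈ t, Ψ z '' (C z ∩ H) with hK
  have hKc : IsCompact K := t.isCompact_biUnion fun z _ =>
    ((hCc z).inter_right hH).image_of_continuousOn
      ((hΨ z).mono fun a ha => (hCs z ha.1).1)
  have hKU₁ : K ⊆ U₁ ∩ Y := by
    refine iUnion₂_subset fun z _ => ?_
    rintro _ ⟨a, ⟨ha, haH⟩, rfl⟩
    exact ⟨(hCs z ha).2.2, hHY z a ⟨(hCs z ha).1, haH⟩⟩
  have hKe : ContinuousOn ex K := by
    refine fun v hv => ContinuousAt.continuousWithinAt ?_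
    obtain ⟨z, -, a, ⟨ha, -⟩, rfl⟩ := mem_iUnion₂.1 hv
    exact (hex z).continuousAt ((hO z).mem_nhds (hCs z ha).2.1)
  have hUK : U ∩ Y ⊆ K := by
    rintro v ⟨hv, hvY⟩
    obtain ⟨z, hz, hvz⟩ := mem_iUnion₂.1 hv
    obtain ⟨h1, h2⟩ := hOY z v ⟨hvz.1, hvY⟩
    exact mem_iUnion₂.2 ⟨z, hz, Θ z v, ⟨interior_subset hvz.2, h1.2⟩, h2⟩
  have hUo : IsOpen U := isOpen_biUnion fun z _ => hBo z
  refine ⟨U, hUo, fun z => ht (mem_range_self z), hU₁i.mono (hUK.trans hKU₁), fun v hv => ?_⟩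
  obtain ⟨z, hz, hvz⟩ := mem_iUnion₂.1 hv.1
  refine ⟨z, hvz.1, ?_⟩
  obtain ⟨h1, h2⟩ := hOY z v ⟨hvz.1, hv.2⟩
  have hev : e z (Θ z v) = ex v := by rw [he z _ h1.1, h2]
  have htar : ex v ∈ (e z).target := by rw [← hev]; exact (e z).map_source h1.1
  have hsymm : (e z).symm (ex v) = Θ z v := by rw [← hev, (e z).left_inv h1.1]
  -- points of the image near `ex v` come from points of `V` near `v`
  have e1 : ∀ᶠ x in 𝓝 (ex v), x ∉ ex '' (K \ O z) := by
    refine ((hKc.diff (hO z)).image_of_continuousOn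
      (hKe.mono sdiff_subset)).isClosed.isOpen_compl.mem_nhds ?_
    rintro ⟨w, hw, hwv⟩
    have : w = v := hU₁i (hKU₁ hw.1) (hKU₁ (hUK hv)) hwv
    exact hw.2 (this ▸ hvz.1)
  have e2 : ∀ᶠ x in 𝓝 (ex v), Ψ z ((e z).symm x) ∈ U := by
    have h3 : ContinuousAt (fun x => Ψ z ((e z).symm x)) (ex v) :=
      ContinuousAt.comp (by
        rw [hsymm]; exact (hΨ z).continuousAt ((e z).open_source.mem_nhds h1.1))
        ((e z).continuousAt_symm htar)
    refine h3.eventually (hUo.mem_nhds ?_)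
    show Ψ z ((e z).symm (ex v)) ∈ U
    rw [hsymm, h2]; exact hv.1
  filter_upwards [e1, e2, (e z).open_target.mem_nhds htar] with x hx1 hx2 hx
  have hxs : e z ((e z).symm x) = ex (Ψ z ((e z).symm x)) := he z _ ((e z).map_target hx)
  rw [(e z).right_inv hx] at hxs
  have hiff : x ∈ ex '' (U ∩ Y) ↔ (e z).symm x ∈ H := by
    constructor
    · rintro ⟨w, hw, rfl⟩
      have hwO : w ∈ O z := by
        by_contra h
        exact hx1 ⟨w, ⟨hUK hw, h⟩, rfl⟩
      obtain ⟨h5, h6⟩ := hOY z w ⟨hwO, hw.2⟩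
      have : (e z).symm (ex w) = Θ z w := by
        rw [← (e z).left_inv h5.1, he z _ h5.1, h6]
      rw [this]; exact h5.2
    · intro h
      exact ⟨_, ⟨hx2, hHY z _ ⟨(e z).map_target hx, h⟩⟩, hxs.symm⟩
  exact ⟨hx, hiff, fun h => ⟨⟨hx2, hHY z _ ⟨(e z).map_target hx, hiff.1 h⟩⟩, hxs.symm⟩⟩

end Coassoc

namespace Coassoc

local notation "ℝ⁷" => EuclideanSpace ℝ (Fin 7)
local notation "ℝ⁴" => EuclideanSpace ℝ (Fin 4)
local notation "ℝ³" => EuclideanSpace ℝ (Fin 3)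

/-! ### Local parametrizations of the normal bundle -/

/-- A surjective linear map can be completed to an injective one by coordinates on its kernel. -/
theorem exists_complementary_map {V A C : Type*} [AddCommGroup V] [Module ℝ V]
    [FiniteDimensional ℝ V] [AddCommGroup A] [Module ℝ A]
    [AddCommGroup C] [Module ℝ C] [FiniteDimensional ℝ C] (B : V →ₗ[ℝ] A)
    (hB : Function.Surjective B)
    (hdim : Module.finrank ℝ V = Module.finrank ℝ A + Module.finrank ℝ C) :
    ∃ P : V →ₗ[ℝ] C, ∀ v, B v = 0 → P v = 0 → v = 0 := by
  have h1 := LinearMap.finrank_range_add_finrank_ker B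
  rw [LinearMap.range_eq_top.2 hB, finrank_top] at h1
  let e : LinearMap.ker B ≃ₗ[ℝ] C := LinearEquiv.ofFinrankEq _ _ (by omega)
  obtain ⟨ϖ, hϖ⟩ := LinearMap.exists_leftInverse_of_injective (LinearMap.ker B).subtype
    (LinearMap.ker B).ker_subtype
  refine ⟨e.toLinearMap ∘ₗ ϖ, fun v hv hP => ?_⟩
  have h2 : ϖ v = ⟨v, hv⟩ := DFunLike.congr_fun hϖ ⟨v, hv⟩
  have h3 : e ⟨v, hv⟩ = 0 := by rw [← h2]; exact hP
  exact congrArg Subtype.val (e.map_eq_zero_iff.1 h3)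

/-- At `(u, 0)`, a family of linear maps applied to the second variable is differentiated by
freezing the family. -/
theorem hasFDerivAt_clm_apply_snd {E V G F : Type*} [NormedAddCommGroup E] [NormedSpace ℝ E]
    [NormedAddCommGroup V] [NormedSpace ℝ V] [NormedAddCommGroup G] [NormedSpace ℝ G]
    [NormedAddCommGroup F] [NormedSpace ℝ F] {k : E → G →L[ℝ] F} {u : E}
    (hk : DifferentiableAt ℝ k u) (l : V →L[ℝ] G) :
    HasFDerivAt (fun a : E × V => k a.1 (l a.2))
      (((k u).comp l).comp (ContinuousLinearMap.snd ℝ E V)) (u, 0) := by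
  have h1 : HasFDerivAt k (fderiv ℝ k u) (u, (0 : V)).1 := hk.hasFDerivAt
  have h2 := (h1.comp (u, (0 : V)) hasFDerivAt_fst).clm_apply
    (l.hasFDerivAt.comp (u, (0 : V)) hasFDerivAt_snd)
  refine h2.congr_fderiv (ContinuousLinearMap.ext fun ⟨a, b⟩ => ?_)
  simp

variable {M : Type*} [TopologicalSpace M] [ChartedSpace ℝ⁷ M] [IsManifold (𝓡 7) ∞ M]
variable {N : Type*} [TopologicalSpace N] [ChartedSpace (EuclideanHalfSpace 4) N]
  [IsManifold (𝓡∂ 4) ∞ N]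

/-- The differential of an immersion in terms of its extension to the model space. -/
theorem exists_tcoordL_mfderiv_eq {i : N → M} {κ : OpenPartialHomeomorph N (EuclideanHalfSpace 4)}
    (hκ : κ ∈ IsManifold.maximalAtlas (𝓡∂ 4) ∞ N) {U : Set ℝ⁴} (hU : IsOpen U) {ι : ℝ⁴ → M}
    (hι : ContMDiffOn 𝓘(ℝ, ℝ⁴) (𝓡 7) ∞ ι U)
    (hi : ∀ w ∈ κ.source, κ.extend (𝓡∂ 4) w ∈ U ∧ ι (κ.extend (𝓡∂ 4) w) = i w)
    (his : ContMDiff (𝓡∂ 4) (𝓡 7) ∞ i) {p : M} {z : N} (hz : z ∈ κ.source)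
    (hp : i z ∈ (chartAt ℝ⁷ p).source)
    (hinj : Function.Injective (mfderiv (𝓡∂ 4) (𝓡 7) i z)) :
    ∃ A : ℝ⁴ →L[ℝ] ℝ⁴, Function.Surjective A ∧
      ∀ b : ℝ⁴, tcoordL (𝓡 7) p (i z) (mfderiv (𝓡∂ 4) (𝓡 7) i z b)
        = fderiv ℝ (fun u => extChartAt (𝓡 7) p (ι u)) (κ.extend (𝓡∂ 4) z) (A b) := by
  obtain ⟨hzU, hzι⟩ := hi z hz
  have hξ : MDifferentiableAt (𝓡 7) 𝓘(ℝ, ℝ⁷) (extChartAt (𝓡 7) p) (i z) :=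
    (contMDiffAt_extChartAt' (n := ∞) hp).mdifferentiableAt (by simp)
  have h1 : HasMFDerivAt (𝓡∂ 4) 𝓘(ℝ, ℝ⁷) (fun w => extChartAt (𝓡 7) p (i w)) z
      ((tcoordL (𝓡 7) p (i z)).comp (mfderiv (𝓡∂ 4) (𝓡 7) i z)) :=
    hξ.hasMFDerivAt.comp z ((his z).mdifferentiableAt (by simp)).hasMFDerivAt
  have hκd : MDifferentiableAt (𝓡∂ 4) 𝓘(ℝ, ℝ⁴) (κ.extend (𝓡∂ 4)) z :=
    ((OpenPartialHomeomorph.contMDiffOn_extend hκ).contMDiffAt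
      (κ.open_source.mem_nhds hz)).mdifferentiableAt (by simp)
  have hc : ContDiffAt ℝ ∞ (fun u => extChartAt (𝓡 7) p (ι u)) (κ.extend (𝓡∂ 4) z) := by
    refine ContMDiffAt.contDiffAt ?_
    exact ContMDiffAt.comp _ (contMDiffAt_extChartAt' (by rw [hzι]; exact hp))
      (hι.contMDiffAt (hU.mem_nhds hzU))
  have h2 : HasMFDerivAt (𝓡∂ 4) 𝓘(ℝ, ℝ⁷)
      (fun w => extChartAt (𝓡 7) p (ι (κ.extend (𝓡∂ 4) w))) z
      ((fderiv ℝ (fun u => extChartAt (𝓡 7) p (ι u)) (κ.extend (𝓡∂ 4) z)).comp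
        (mfderiv (𝓡∂ 4) 𝓘(ℝ, ℝ⁴) (κ.extend (𝓡∂ 4)) z)) :=
    HasMFDerivAt.comp (g := fun u => extChartAt (𝓡 7) p (ι u)) z
      (hc.differentiableAt (by simp)).hasFDerivAt.hasMFDerivAt hκd.hasMFDerivAt
  have h3 : (fun w => extChartAt (𝓡 7) p (i w)) =ᶠ[𝓝 z]
      fun w => extChartAt (𝓡 7) p (ι (κ.extend (𝓡∂ 4) w)) := by
    filter_upwards [κ.open_source.mem_nhds hz] with w hw
    rw [(hi w hw).2]
  have h4 := h2.congr_of_eventuallyEq h3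
  let A : ℝ⁴ →L[ℝ] ℝ⁴ := mfderiv (𝓡∂ 4) 𝓘(ℝ, ℝ⁴) (κ.extend (𝓡∂ 4)) z
  have hA : ∀ b : ℝ⁴, tcoordL (𝓡 7) p (i z) (mfderiv (𝓡∂ 4) (𝓡 7) i z b)
      = fderiv ℝ (fun u => extChartAt (𝓡 7) p (ι u)) (κ.extend (𝓡∂ 4) z) (A b) :=
    DFunLike.congr_fun (hasMFDerivAt_unique h1 h4)
  refine ⟨A, ?_, hA⟩
  refine (LinearMap.injective_iff_surjective (f := A.toLinearMap)).1
    ((injective_iff_map_eq_zero A).2 fun b hb => ?_)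
  have h5 := hA b
  rw [hb, map_zero] at h5
  have h6 := tframe_tcoordL hp (mfderiv (𝓡∂ 4) (𝓡 7) i z b)
  rw [h5, map_zero] at h6
  exact hinj (h6.symm.trans (map_zero _).symm)

set_option maxHeartbeats 1600000 in
/-- Near a point of `N`, the normal bundle is parametrized by `H × ℝ³`, where `H` is the half space
in `ℝ⁴`; the parametrization `Ψ` extends across the boundary to an open subset of `ℝ⁴ × ℝ³`, and
its composition with the exponential map is a diffeomorphism. -/
theorem exists_normalBundle_chart [T2Space M] (h : Metric7 M) {i : N → M}
    (hi : Manifold.IsSmoothEmbedding (𝓡∂ 4) (𝓡 7) ∞ i) (z₀ : N) :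
    ∃ (e : OpenPartialHomeomorph (ℝ⁴ × ℝ³) M) (Ψ : ℝ⁴ × ℝ³ → TangentBundle (𝓡 7) M)
      (Θ : TangentBundle (𝓡 7) M → ℝ⁴ × ℝ³) (O : Set (TangentBundle (𝓡 7) M)),
      IsOpen O ∧ (⟨i z₀, 0⟩ : TangentBundle (𝓡 7) M) ∈ O ∧ O ⊆ expDomain h ∧
      ContMDiffOn (𝓡 7).tangent (𝓡 7) ∞ (expMap h) O ∧
      ContMDiffOn (𝓡 7).tangent 𝓘(ℝ, ℝ⁴ × ℝ³) ∞ Θ O ∧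
      ContMDiffOn 𝓘(ℝ, ℝ⁴ × ℝ³) (𝓡 7).tangent ∞ Ψ e.source ∧
      (∀ v ∈ O ∩ normalBundle h i, Θ v ∈ e.source ∩ {a | 0 ≤ a.1 0} ∧ Ψ (Θ v) = v) ∧
      (∀ a ∈ e.source ∩ {a | 0 ≤ a.1 0}, Ψ a ∈ normalBundle h i) ∧
      (∀ a ∈ e.source, e a = expMap h (Ψ a)) ∧
      ContMDiffOn 𝓘(ℝ, ℝ⁴ × ℝ³) (𝓡 7) ∞ e e.source ∧
      ContMDiffOn (𝓡 7) 𝓘(ℝ, ℝ⁴ × ℝ³) ∞ e.symm e.target := by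
  obtain ⟨κ, U, ι, Or, r, hκ, hz₀, hU, hOr, hι, hr, hm, hri, hκi⟩ :=
    exists_extension_of_isImmersionAt (hi.isImmersion.isImmersionAt z₀)
  have his : ContMDiff (𝓡∂ 4) (𝓡 7) ∞ i := hi.isImmersion.contMDiff
  have hdi : ∀ z, Function.Injective (mfderiv (𝓡∂ 4) (𝓡 7) i z) := fun z =>
    injective_mfderiv_of_isImmersionAt (hi.isImmersion.isImmersionAt z)
  set p := i z₀ with hp
  set ξ := extChartAt (𝓡 7) p with hξ
  have hps : p ∈ (chartAt ℝ⁷ p).source := mem_chart_source _ _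
  set u₀ := κ.extend (𝓡∂ 4) z₀ with hu₀
  obtain ⟨hu₀U, hιu₀⟩ : u₀ ∈ U ∧ ι u₀ = p := hκi z₀ hz₀
  set U' := (U ∩ ι ⁻¹' (chartAt ℝ⁷ p).source) ∩ (𝓡∂ 4).symm ⁻¹' κ.target with hU'
  have hU'o : IsOpen U' := (hι.continuousOn.isOpen_inter_preimage hU
    (chartAt ℝ⁷ p).open_source).inter (κ.open_target.preimage (𝓡∂ 4).continuous_symm)
  have hu₀U' : u₀ ∈ U' := by
    refine ⟨⟨hu₀U, by rw [mem_preimage, hιu₀]; exact hps⟩, ?_⟩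
    have : (𝓡∂ 4).symm u₀ = κ z₀ := (𝓡∂ 4).left_inv _
    rw [mem_preimage, this]; exact κ.map_source hz₀
  set c : ℝ⁴ → ℝ⁷ := fun u => ξ (ι u) with hc
  have hcm : MapsTo c U' ξ.target := fun u hu => extChartAt_mem_target hu.1.2
  have hcs : ContDiffOn ℝ ∞ c U' :=
    ((contMDiffOn_extChartAt (I := 𝓡 7) (n := ∞) (x := p)).comp
      (hι.mono fun u hu => hu.1.1) fun u hu => hu.1.2).contDiffOn
  set D : ℝ⁴ → ℝ⁴ →L[ℝ] ℝ⁷ := fderiv ℝ c with hD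
  have hDs : ContDiffOn ℝ ∞ D U' := hcs.fderiv_of_isOpen hU'o (by simp)
  have hDd : ∀ u ∈ U', HasFDerivAt c (D u) u := fun u hu =>
    ((hcs.contDiffAt (hU'o.mem_nhds hu)).differentiableAt (by simp)).hasFDerivAt
  -- the left inverse `r` shows that the derivative of `c` is injective
  have hDinj : ∀ u ∈ U', Function.Injective (D u) := by
    intro u hu
    have h1 : ContDiffAt ℝ ∞ (fun y => r (ξ.symm y)) (c u) := by
      refine ContMDiffAt.contDiffAt ?_
      refine ContMDiffAt.comp (c u) (hr.contMDiffAt (hOr.mem_nhds ?_))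
        ((contMDiffOn_extChartAt_symm p).contMDiffAt
          ((isOpen_extChartAt_target p).mem_nhds (hcm hu)))
      rw [extChartAt_symm_extChartAt hu.1.2]
      exact hm hu.1.1
    have h2 : HasFDerivAt (fun u => r (ξ.symm (c u)))
        ((fderiv ℝ (fun y => r (ξ.symm y)) (c u)).comp (D u)) u :=
      (h1.differentiableAt (by simp)).hasFDerivAt.comp u (hDd u hu)
    have h3 : (fun u => r (ξ.symm (c u))) =ᶠ[𝓝 u] id := by
      filter_upwards [hU'o.mem_nhds hu] with w hw
      rw [extChartAt_symm_extChartAt hw.1.2, hri w hw.1.1]; rfl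
    have h4 := h2.unique ((hasFDerivAt_id u).congr_of_eventuallyEq h3)
    intro a b hab
    have h5 := congrArg (fderiv ℝ (fun y => r (ξ.symm y)) (c u)) hab
    exact (DFunLike.congr_fun h4 a).symm.trans (h5.trans (DFunLike.congr_fun h4 b))
  -- `B u v` is the covector `h(v, ·)` on `N`
  set B : ℝ⁴ → ℝ⁷ →L[ℝ] ℝ⁴ →L[ℝ] ℝ := fun u =>
    ((ContinuousLinearMap.compL ℝ ℝ⁴ ℝ⁷ ℝ).flip (D u)).comp (gram h p (c u)) with hB
  have hBv : ∀ u v a, B u v a = gram h p (c u) v (D u a) := fun u v a => rfl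
  have hBs : ContDiffOn ℝ ∞ B U' :=
    ((ContinuousLinearMap.contDiff _).comp_contDiffOn hDs).clm_comp
      ((contDiffOn_gram h p).comp hcs hcm)
  have hBD : ∀ u ∈ U', ∀ a, B u (D u a) = 0 → a = 0 := by
    intro u hu a ha
    by_contra h0
    have h1 : D u a ≠ 0 := fun h1 => h0 (hDinj u hu (h1.trans (map_zero _).symm))
    have h2 := gram_pos h (hcm hu) _ h1
    rw [← hBv, ha] at h2
    simp at h2
  have hdual : Module.finrank ℝ (ℝ⁴ →L[ℝ] ℝ) = 4 := by
    rw [← (LinearMap.toContinuousLinearMap : (ℝ⁴ →ₗ[ℝ] ℝ) ≃ₗ[ℝ] ℝ⁴ →L[ℝ] ℝ).finrank_eq]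
    simp
  have hBsurj : Function.Surjective (B u₀) := by
    have h1 : Function.Surjective ((B u₀ : ℝ⁷ →ₗ[ℝ] ℝ⁴ →L[ℝ] ℝ) ∘ₗ (D u₀ : ℝ⁴ →ₗ[ℝ] ℝ⁷)) :=
      (LinearMap.injective_iff_surjective_of_finrank_eq_finrank (by rw [hdual]; simp)).1
        ((injective_iff_map_eq_zero _).2 fun a ha => hBD u₀ hu₀U' a ha)
    exact fun y => (h1 y).imp' _ fun a ha => ha
  obtain ⟨P', hP'⟩ := exists_complementary_map (C := ℝ³) (B u₀ : ℝ⁷ →ₗ[ℝ] ℝ⁴ →L[ℝ] ℝ) hBsurj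
    (by rw [hdual]; simp)
  set P : ℝ⁷ →L[ℝ] ℝ³ := LinearMap.toContinuousLinearMap P' with hP
  set K : ℝ⁴ → ℝ⁷ →L[ℝ] (ℝ⁴ →L[ℝ] ℝ) × ℝ³ := fun u =>
    (ContinuousLinearMap.inl ℝ (ℝ⁴ →L[ℝ] ℝ) ℝ³).comp (B u)
      + (ContinuousLinearMap.inr ℝ (ℝ⁴ →L[ℝ] ℝ) ℝ³).comp P with hK
  have hKv : ∀ u v, K u v = (B u v, P v) := fun u v => by simp [hK]
  have hKs : ContDiffOn ℝ ∞ K U' := (contDiffOn_const.clm_comp hBs).add contDiffOn_const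
  have hKinj : Function.Injective (K u₀) := by
    refine (injective_iff_map_eq_zero _).2 fun v hv => ?_
    rw [hKv, Prod.mk_eq_zero] at hv
    exact hP' v hv.1 hv.2
  let K₀ : ℝ⁷ ≃L[ℝ] (ℝ⁴ →L[ℝ] ℝ) × ℝ³ := (LinearEquiv.ofInjectiveOfFinrankEq
    (K u₀ : ℝ⁷ →ₗ[ℝ] (ℝ⁴ →L[ℝ] ℝ) × ℝ³) hKinj
    (by rw [Module.finrank_prod, hdual]; simp)).toContinuousLinearEquiv
  have hK₀ : (K₀ : ℝ⁷ →L[ℝ] (ℝ⁴ →L[ℝ] ℝ) × ℝ³) = K u₀ := ContinuousLinearMap.ext fun v => rfl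
  set O₁ : Set ℝ⁴ := U' ∩ K ⁻¹' range ((↑) : (ℝ⁷ ≃L[ℝ] (ℝ⁴ →L[ℝ] ℝ) × ℝ³) → _) with hO₁
  have hO₁o : IsOpen O₁ := hKs.continuousOn.isOpen_inter_preimage hU'o
    ContinuousLinearEquiv.isOpen
  have hu₀O₁ : u₀ ∈ O₁ := ⟨hu₀U', K₀, hK₀⟩
  set Ki : ℝ⁴ → (ℝ⁴ →L[ℝ] ℝ) × ℝ³ →L[ℝ] ℝ⁷ := fun u => (K u).inverse with hKi
  have hKis : ContDiffOn ℝ ∞ Ki O₁ := by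
    rintro u ⟨hu, k, hk⟩
    have h1 : ContDiffAt ℝ ∞ ContinuousLinearMap.inverse (K u) := by
      rw [← hk]; exact contDiffAt_map_inverse k
    exact (h1.comp u (hKs.contDiffAt (hU'o.mem_nhds hu))).contDiffWithinAt
  have hKKi : ∀ u ∈ O₁, ∀ x, K u (Ki u x) = x := by
    rintro u ⟨hu, k, hk⟩ x
    simp only [hKi]
    rw [← hk, ContinuousLinearMap.inverse_equiv]
    exact k.apply_symm_apply x
  have hKiK : ∀ u ∈ O₁, ∀ v, Ki u (K u v) = v := by
    rintro u ⟨hu, k, hk⟩ v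
    simp only [hKi]
    rw [← hk, ContinuousLinearMap.inverse_equiv]
    exact k.symm_apply_apply v
  set w₁ : ℝ⁴ × ℝ³ → ℝ⁷ := fun a => Ki a.1 (0, a.2) with hw₁
  have hw₁s : ContDiffOn ℝ ∞ w₁ (O₁ ×ˢ univ) :=
    (hKis.comp contDiffOn_fst fun a ha => ha.1).clm_apply
      (contDiffOn_const.prodMk contDiffOn_snd)
  set Ψ : ℝ⁴ × ℝ³ → TangentBundle (𝓡 7) M := fun a =>
    ⟨ι a.1, tframe (𝓡 7) p (ι a.1) (w₁ a)⟩ with hΨ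
  have hΨs : ContMDiffOn 𝓘(ℝ, ℝ⁴ × ℝ³) (𝓡 7).tangent ∞ Ψ (O₁ ×ˢ univ) := fun a ha =>
    contMDiffWithinAt_tframe ha.1.1.1.2
      ((hι.comp contDiff_fst.contMDiff.contMDiffOn
        (fun a (ha : a ∈ O₁ ×ˢ univ) => ha.1.1.1.1)) a ha) (hw₁s.contMDiffOn a ha)
  have hΨt : ∀ a ∈ O₁ ×ˢ (univ : Set ℝ³), tcoord (𝓡 7) p (Ψ a) = w₁ a := fun a ha =>
    tcoordL_tframe (I := 𝓡 7) ha.1.1.1.2 _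
  have hw₁0 : w₁ (u₀, 0) = 0 := map_zero (Ki u₀)
  have hΨ0 : Ψ (u₀, 0) = ⟨p, 0⟩ := by
    have : ∀ x : M, x = p → (⟨x, tframe (𝓡 7) p x (w₁ (u₀, 0))⟩ : TangentBundle (𝓡 7) M)
        = ⟨p, 0⟩ := by
      rintro x rfl
      rw [hw₁0, map_zero]
    exact this _ hιu₀
  set L₀ : ℝ⁴ × ℝ³ →L[ℝ] ℝ⁷ := (D u₀).comp (ContinuousLinearMap.fst ℝ ℝ⁴ ℝ³) +
    ((Ki u₀).comp (ContinuousLinearMap.inr ℝ (ℝ⁴ →L[ℝ] ℝ) ℝ³)).comp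
      (ContinuousLinearMap.snd ℝ ℝ⁴ ℝ³) with hL₀
  have hL₀v : ∀ a b, L₀ (a, b) = D u₀ a + Ki u₀ (0, b) := fun a b => rfl
  have hL₀inj : Function.Injective L₀ := by
    refine (injective_iff_map_eq_zero _).2 fun ⟨a, b⟩ hab => ?_
    rw [hL₀v] at hab
    have h1 : K u₀ (D u₀ a + Ki u₀ (0, b)) = 0 := by rw [hab, map_zero]
    rw [map_add, hKKi u₀ hu₀O₁, hKv, Prod.mk_add_mk, add_zero, Prod.mk_eq_zero] at h1
    have h2 := hBD u₀ hu₀U' a h1.1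
    have h3 := h1.2
    rw [h2, map_zero, map_zero, zero_add] at h3
    rw [h2, h3]; rfl
  let L : (ℝ⁴ × ℝ³) ≃L[ℝ] ℝ⁷ := (LinearEquiv.ofInjectiveOfFinrankEq (L₀ : ℝ⁴ × ℝ³ →ₗ[ℝ] ℝ⁷)
    hL₀inj (by simp)).toContinuousLinearEquiv
  have hL : (L : ℝ⁴ × ℝ³ →L[ℝ] ℝ⁷) = L₀ := ContinuousLinearMap.ext fun v => rfl
  have hder : HasFDerivAt (fun a => ξ (Ψ a).1 + tcoord (𝓡 7) p (Ψ a))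
      (L : ℝ⁴ × ℝ³ →L[ℝ] ℝ⁷) (u₀, 0) := by
    have e1 : HasFDerivAt (fun a : ℝ⁴ × ℝ³ => c a.1)
        ((D u₀).comp (ContinuousLinearMap.fst ℝ ℝ⁴ ℝ³)) (u₀, 0) := by
      have a1 : HasFDerivAt c (D u₀) (u₀, (0 : ℝ³)).1 := hDd u₀ hu₀U'
      exact a1.comp (u₀, (0 : ℝ³)) hasFDerivAt_fst
    have e2 : HasFDerivAt w₁ (((Ki u₀).comp (ContinuousLinearMap.inr ℝ (ℝ⁴ →L[ℝ] ℝ) ℝ³)).comp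
        (ContinuousLinearMap.snd ℝ ℝ⁴ ℝ³)) (u₀, 0) :=
      hasFDerivAt_clm_apply_snd
        ((hKis.contDiffAt (hO₁o.mem_nhds hu₀O₁)).differentiableAt (by simp))
        (ContinuousLinearMap.inr ℝ (ℝ⁴ →L[ℝ] ℝ) ℝ³)
    have e4 := e1.add e2
    rw [hL]
    refine e4.congr_of_eventuallyEq ?_
    filter_upwards [(hO₁o.prod isOpen_univ).mem_nhds
      (show (u₀, (0 : ℝ³)) ∈ O₁ ×ˢ univ from ⟨hu₀O₁, mem_univ _⟩)] with a ha
    rw [hΨt a ha]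
    rfl
  obtain ⟨e, Q, hQ, hpQ, hQd, hQe, hae, hes, hmap, heq, hesm, hesym⟩ :=
    exists_openPartialHomeomorph_expMap h (hO₁o.prod isOpen_univ)
      (show (u₀, (0 : ℝ³)) ∈ O₁ ×ˢ univ from ⟨hu₀O₁, mem_univ _⟩) hΨs hΨ0 L hder
  -- coordinates on the normal bundle
  set Θ : TangentBundle (𝓡 7) M → ℝ⁴ × ℝ³ := fun v => (r v.1, P (tcoord (𝓡 7) p v)) with hΘ
  obtain ⟨O₂, hO₂, hO₂κ⟩ := hi.isEmbedding.isInducing.isOpen_iff.1 κ.open_source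
  set Ω : Set (TangentBundle (𝓡 7) M) :=
    TotalSpace.proj ⁻¹' ((Or ∩ (chartAt ℝ⁷ p).source) ∩ O₂) with hΩ
  have hΩo : IsOpen Ω := ((hOr.inter (chartAt ℝ⁷ p).open_source).inter hO₂).preimage
    (FiberBundle.continuous_proj _ _)
  have hΘs : ContMDiffOn (𝓡 7).tangent 𝓘(ℝ, ℝ⁴ × ℝ³) ∞ Θ Ω := by
    refine ContMDiffOn.prodMk_space ?_ ?_
    · exact hr.comp (contMDiff_proj _).contMDiffOn fun v hv => hv.1.1
    · exact (ContinuousLinearMap.contMDiff P).comp_contMDiffOn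
        ((contMDiffOn_tcoord p).mono fun v hv => hv.1.2)
  have hΘ0 : Θ ⟨p, 0⟩ = (u₀, 0) := by
    refine Prod.ext ?_ ?_
    · show r p = u₀
      rw [← hιu₀, hri u₀ hu₀U]
    · have : tcoord (𝓡 7) p ⟨p, 0⟩ = 0 := map_zero (tcoordL (𝓡 7) p p)
      show P (tcoord (𝓡 7) p ⟨p, 0⟩) = 0
      rw [this, map_zero]
  have hpΩ : (⟨p, 0⟩ : TangentBundle (𝓡 7) M) ∈ Ω := by
    refine ⟨⟨?_, hps⟩, ?_⟩
    · show p ∈ Or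
      rw [← hιu₀]; exact hm hu₀U
    · show z₀ ∈ i ⁻¹' O₂
      rw [hO₂κ]; exact hz₀
  refine ⟨e, Ψ, Θ, (Ω ∩ Θ ⁻¹' e.source) ∩ Q,
    (hΘs.continuousOn.isOpen_inter_preimage hΩo e.open_source).inter hQ,
    ⟨⟨hpΩ, by rw [mem_preimage, hΘ0]; exact hae⟩, hpQ⟩, fun v hv => hQd hv.2,
    hQe.mono inter_subset_right, hΘs.mono fun v hv => hv.1.1, hΨs.mono hes, ?_, ?_, heq, hesm,
    hesym⟩
  · rintro v ⟨⟨⟨hvΩ, hve⟩, -⟩, z, v, hvn, rfl⟩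
    have hz : z ∈ κ.source := by rw [← hO₂κ]; exact hvΩ.2
    have hzp : i z ∈ (chartAt ℝ⁷ p).source := hvΩ.1.2
    obtain ⟨huU, hιu⟩ := hκi z hz
    set u := κ.extend (𝓡∂ 4) z with hu
    have hru : r (i z) = u := by rw [← hιu, hri u huU]
    have hΘv : Θ ⟨i z, v⟩ = (u, P (tcoordL (𝓡 7) p (i z) v)) := Prod.ext hru rfl
    rw [mem_preimage, hΘv] at hve
    have huO₁ : u ∈ O₁ := (hes hve).1
    rw [hΘv]
    refine ⟨⟨hve, ?_⟩, ?_⟩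
    · have : u ∈ range (𝓡∂ 4) := mem_range_self _
      rw [range_modelWithCornersEuclideanHalfSpace] at this
      exact this
    -- the covector of a normal vector vanishes, so that it is determined by its image under `P`
    · have hB0 : B u (tcoordL (𝓡 7) p (i z) v) = 0 := by
        obtain ⟨A, hAs, hA⟩ := exists_tcoordL_mfderiv_eq hκ hU hι hκi his hz hzp (hdi z)
        refine ContinuousLinearMap.ext fun a => ?_
        obtain ⟨b, rfl⟩ := hAs a
        have h2 := hvn b
        rw [inner_eq_gram h hzp] at h2
        have h3 : c u = ξ (i z) := by rw [← hιu]
        rw [hBv, ← hA b, h3]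
        exact h2
      have hKu : K u (tcoordL (𝓡 7) p (i z) v) = (0, P (tcoordL (𝓡 7) p (i z) v)) := by
        rw [hKv, hB0]
      have hw : w₁ (u, P (tcoordL (𝓡 7) p (i z) v)) = tcoordL (𝓡 7) p (i z) v := by
        simp only [hw₁]
        rw [← hKu, hKiK u huO₁]
      have key : ∀ x : M, x = i z → (⟨x, tframe (𝓡 7) p x (tcoordL (𝓡 7) p (i z) v)⟩ :
          TangentBundle (𝓡 7) M) = ⟨i z, v⟩ := by
        rintro x rfl
        rw [tframe_tcoordL hzp]
      simp only [hΨ]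
      rw [hw]
      exact key _ hιu
  · rintro ⟨u, w⟩ ⟨hue, hu0⟩
    have huO₁ : u ∈ O₁ := (hes hue).1
    set z := κ.symm ((𝓡∂ 4).symm u) with hz'
    have hz : z ∈ κ.source := κ.map_target huO₁.1.2
    have huz : κ.extend (𝓡∂ 4) z = u := by
      show (𝓡∂ 4) (κ (κ.symm ((𝓡∂ 4).symm u))) = u
      rw [κ.right_inv huO₁.1.2]
      refine (𝓡∂ 4).right_inv ?_
      rw [range_modelWithCornersEuclideanHalfSpace]
      exact hu0
    have hιz : ι u = i z := by rw [← huz]; exact (hκi z hz).2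
    have hzp : i z ∈ (chartAt ℝ⁷ p).source := by rw [← hιz]; exact huO₁.1.1.2
    refine ⟨z, tframe (𝓡 7) p (i z) (w₁ (u, w)), fun b => ?_, ?_⟩
    · obtain ⟨A, -, hA⟩ := exists_tcoordL_mfderiv_eq hκ hU hι hκi his hz hzp (hdi z)
      rw [inner_eq_gram h hzp, tcoordL_tframe hzp, hA b, huz, ← hιz]
      have h1 := congrArg Prod.fst (hKKi u huO₁ (0, w))
      rw [hKv] at h1
      exact DFunLike.congr_fun h1 _
    · have key : ∀ x : M, x = i z → (⟨x, tframe (𝓡 7) p x (w₁ (u, w))⟩ :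
          TangentBundle (𝓡 7) M) = ⟨i z, tframe (𝓡 7) p (i z) (w₁ (u, w))⟩ := by
        rintro x rfl; rfl
      exact key _ hιz

end Coassoc

namespace Coassoc

local notation "ℝ⁷" => EuclideanSpace ℝ (Fin 7)
local notation "ℝ⁴" => EuclideanSpace ℝ (Fin 4)
local notation "ℝ³" => EuclideanSpace ℝ (Fin 3)

/-! ### The exponential map near the zero section of the normal bundle -/

theorem finAddEquivProd_symm_apply_zero (a : ℝ⁴ × ℝ³) :
    ((EuclideanSpace.finAddEquivProd (𝕜 := ℝ) (n := 4) (m := 3)).symm a : ℝ⁷) 0 = a.1 0 := by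
  obtain ⟨x, rfl⟩ := (EuclideanSpace.finAddEquivProd (𝕜 := ℝ) (n := 4) (m := 3)).surjective a
  rw [ContinuousLinearEquiv.symm_apply_apply]
  rfl

variable {M : Type*} [TopologicalSpace M] [ChartedSpace ℝ⁷ M] [IsManifold (𝓡 7) ∞ M]

/-- A subset which is locally a half space in smooth parametrizations of `M` is a domain with
boundary. -/
theorem isDomainWithBoundary_of_local {T : Set M}
    (hT : ∀ x ∈ T, ∃ e : OpenPartialHomeomorph (ℝ⁴ × ℝ³) M,
      ContMDiffOn 𝓘(ℝ, ℝ⁴ × ℝ³) (𝓡 7) ∞ e e.source ∧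
      ContMDiffOn (𝓡 7) 𝓘(ℝ, ℝ⁴ × ℝ³) ∞ e.symm e.target ∧
      ∀ᶠ x' in 𝓝 x, x' ∈ e.target ∧ (x' ∈ T ↔ 0 ≤ (e.symm x').1 0)) :
    IsDomainWithBoundary T := by
  intro x hx
  obtain ⟨e, he, he', hev⟩ := hT x hx
  obtain ⟨G, hG, hGo, hxG⟩ := eventually_nhds_iff.1 hev
  let L : (ℝ⁴ × ℝ³) ≃L[ℝ] ℝ⁷ := (EuclideanSpace.finAddEquivProd (𝕜 := ℝ) (n := 4) (m := 3)).symm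
  have hL0 : ∀ a, L a 0 = a.1 0 := finAddEquivProd_symm_apply_zero
  have hLs : ContMDiff 𝓘(ℝ, ℝ⁴ × ℝ³) 𝓘(ℝ, ℝ⁷) ∞ L := L.contDiff.contMDiff
  have hLs' : ContMDiff 𝓘(ℝ, ℝ⁷) 𝓘(ℝ, ℝ⁴ × ℝ³) ∞ L.symm := L.symm.contDiff.contMDiff
  set κ : OpenPartialHomeomorph M ℝ⁷ :=
    (e.symm.transHomeomorph L.toHomeomorph).restrOpen G hGo with hκ
  have hκs : κ.source = e.target ∩ G := rfl
  have hsub : κ.source ⊆ e.target := hκs ▸ inter_subset_left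
  refine ⟨κ, OpenPartialHomeomorph.mem_maximalAtlas_of_contMDiffOn _ ?_ ?_, ?_, ?_⟩
  · exact hLs.comp_contMDiffOn (he'.mono hsub)
  · have h1 : ∀ y ∈ κ.target, L.symm y ∈ e.source := by
      intro y hy
      have h2 := κ.map_target hy
      have h3 := κ.right_inv hy
      have h4 : L (e.symm (κ.symm y)) = y := h3
      rw [← h4, ContinuousLinearEquiv.symm_apply_apply]
      exact e.map_target (hsub h2)
    exact he.comp (hLs'.contMDiffOn) h1
  · exact ⟨(hG x hxG).1, hxG⟩
  · intro x' hx'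
    have h1 : (κ x') 0 = (e.symm x').1 0 := hL0 _
    rw [h1]
    exact (hG x' hx'.2).2

variable {N : Type*} [TopologicalSpace N] [ChartedSpace (EuclideanHalfSpace 4) N]
  [IsManifold (𝓡∂ 4) ∞ N]

/-- The exponential map is a diffeomorphism from a neighbourhood of the zero section of the normal
bundle of a compact submanifold with boundary onto a domain with boundary. -/
theorem exists_normal_domain [T2Space M] [CompactSpace N] [Nonempty N] (h : Metric7 M) {i : N → M}
    (hi : Manifold.IsSmoothEmbedding (𝓡∂ 4) (𝓡 7) ∞ i) :
    ∃ (V : Set (TangentBundle (𝓡 7) M)) (T : Set M), IsOpenIn V (normalBundle h i) ∧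
      (∀ z, (⟨i z, 0⟩ : TangentBundle (𝓡 7) M) ∈ V) ∧ IsDomainWithBoundary T ∧ range i ⊆ T ∧
      V ⊆ expDomain h ∧ IsDiffeoOnto (𝓡 7).tangent (𝓡 7) (expMap h) V T := by
  choose e Ψ Θ O hO hzO hOd hOe hΘ hΨ hOY hHY heΨ hes hei using
    fun z₀ => exists_normalBundle_chart h hi z₀
  have hzero : Continuous fun z => (⟨i z, 0⟩ : TangentBundle (𝓡 7) M) :=
    (Bundle.contMDiff_zeroSection (n := ∞) (IB := 𝓡 7) ℝ
      (TangentSpace (𝓡 7) : M → Type _)).continuous.comp hi.isEmbedding.continuous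
  have hH : IsClosed {a : ℝ⁴ × ℝ³ | 0 ≤ a.1 0} :=
    isClosed_le continuous_const ((EuclideanSpace.proj (𝕜 := ℝ) (0 : Fin 4)).continuous.comp
      continuous_fst)
  obtain ⟨U, hU, hzU, hUi, hUloc⟩ := exists_domain_of_local hzero (Y := normalBundle h i)
    (fun z => ⟨z, 0, fun u => by rw [map_zero]; rfl, rfl⟩) (ex := expMap h)
    (by
      rintro _ ⟨z, rfl⟩ _ ⟨w, rfl⟩ hzw
      simp only [expMap_zero] at hzw
      rw [hi.isEmbedding.injective hzw])
    hH e Ψ Θ O hO hzO (fun z => (hOe z).continuousOn) (fun z => (hΘ z).continuousOn)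
    (fun z => (hΨ z).continuousOn) hOY hHY heΨ
  have : Nonempty (TangentBundle (𝓡 7) M) := ⟨⟨i (Classical.arbitrary N), 0⟩⟩
  set V := U ∩ normalBundle h i with hV
  set g : M → TangentBundle (𝓡 7) M := Function.invFunOn (expMap h) V with hg
  have hgm : ∀ x ∈ expMap h '' V, g x ∈ V ∧ expMap h (g x) = x := fun x hx =>
    ⟨Function.invFunOn_mem hx, Function.invFunOn_eq hx⟩
  have hzV : ∀ z, (⟨i z, 0⟩ : TangentBundle (𝓡 7) M) ∈ V := fun z =>
    ⟨hzU z, z, 0, fun u => by rw [map_zero]; rfl, rfl⟩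
  refine ⟨V, expMap h '' V, ⟨U, hU, rfl⟩, hzV, ?_, ?_, ?_, mapsTo_image _ _, ?_, g,
    fun x hx => (hgm x hx).1, ⟨fun v hv => ?_, fun x hx => (hgm x hx).2⟩, ?_⟩
  · refine isDomainWithBoundary_of_local ?_
    rintro _ ⟨v, hv, rfl⟩
    obtain ⟨z, -, hz⟩ := hUloc v hv
    exact ⟨e z, hes z, hei z, hz.mono fun x hx => ⟨hx.1, hx.2.1⟩⟩
  · rintro _ ⟨z, rfl⟩
    exact ⟨_, hzV z, expMap_zero h (i z)⟩
  · intro v hv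
    obtain ⟨z, hz, -⟩ := hUloc v hv
    exact hOd z hz
  · intro v hv
    obtain ⟨z, hz, -⟩ := hUloc v hv
    exact ((hOe z).contMDiffAt ((hO z).mem_nhds hz)).contMDiffWithinAt
  · exact hUi (hgm _ ⟨v, hv, rfl⟩).1 hv (hgm _ ⟨v, hv, rfl⟩).2
  -- near each point the inverse is `Ψ ∘ e.symm`
  · rintro _ ⟨v, hv, rfl⟩
    obtain ⟨z, hz, hev⟩ := hUloc v hv
    have htar : expMap h v ∈ (e z).target := hev.self_of_nhds.1
    have h1 : ContMDiffAt (𝓡 7) (𝓡 7).tangent ∞ (fun x => Ψ z ((e z).symm x)) (expMap h v) :=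
      ContMDiffAt.comp _ ((hΨ z).contMDiffAt
        ((e z).open_source.mem_nhds ((e z).map_target htar)))
        ((hei z).contMDiffAt ((e z).open_target.mem_nhds htar))
    have h2 : ∀ x ∈ expMap h '' V, (x ∈ expMap h '' V → Ψ z ((e z).symm x) ∈ V ∧
        expMap h (Ψ z ((e z).symm x)) = x) → g x = Ψ z ((e z).symm x) := fun x hx hx' =>
      hUi (hgm x hx).1 (hx' hx).1 ((hgm x hx).2.trans (hx' hx).2.symm)
    refine h1.contMDiffWithinAt.congr_of_eventuallyEq ?_
      (h2 _ ⟨v, hv, rfl⟩ hev.self_of_nhds.2.2)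
    filter_upwards [mem_nhdsWithin_of_mem_nhds hev, self_mem_nhdsWithin] with x hx hxV
    exact h2 x hxV hx.2.2

end Coassoc

namespace Coassoc

local notation "ℝ⁷" => EuclideanSpace ℝ (Fin 7)
local notation "ℝ⁴" => EuclideanSpace ℝ (Fin 4)

/-! ### Normal vectors and self-dual 2-forms -/

variable {M : Type*} [TopologicalSpace M] [ChartedSpace ℝ⁷ M]
variable {N : Type*} [TopologicalSpace N] [ChartedSpace (EuclideanHalfSpace 4) N]

section Fibre

/-- `jmath` as a linear map of the model spaces. -/
noncomputable def jmathLin (φ : FormField 7 M 3) (i : N → M) (z : N) :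
    ℝ⁷ →ₗ[ℝ] ℝ⁴ →L[ℝ] ℝ⁴ →L[ℝ] ℝ where
  toFun v := jmath φ i z v
  map_add' v w := by
    refine ContinuousLinearMap.ext fun a => ContinuousLinearMap.ext fun b => ?_
    refine (jmath_apply φ i z _ a b).trans (Eq.trans ?_
      (congrArg₂ (fun s t : ℝ => s + t) (jmath_apply φ i z v a b).symm
        (jmath_apply φ i z w a b).symm))
    exact (φ (i z)).toMultilinearMap.cons_add _ v w
  map_smul' c v := by
    refine ContinuousLinearMap.ext fun a => ContinuousLinearMap.ext fun b => ?_
    refine (jmath_apply φ i z _ a b).trans (Eq.trans ?_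
      (congrArg (fun t : ℝ => c • t) (jmath_apply φ i z v a b).symm))
    exact (φ (i z)).toMultilinearMap.cons_smul _ c v

/-- The differential of `i`, read in a `G₂`-frame. -/
noncomputable def frameMap (φ : FormField 7 M 3) (i : N → M) (z : N) : ℝ⁴ →L[ℝ] ℝ⁷ :=
  (g2Frame φ (i z) : TangentSpace (𝓡 7) (i z) →L[ℝ] ℝ⁷).comp (mfderiv (𝓡∂ 4) (𝓡 7) i z)

variable {φ : FormField 7 M 3} {i : N → M}

theorem modelPhi_frameMap [IsManifold (𝓡 7) ∞ M] (hφ : IsPositiveForm φ) (hN : IsCoassociative φ i)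
    (z : N) (u v w : ℝ⁴) :
    modelPhi ![frameMap φ i z u, frameMap φ i z v, frameMap φ i z w] = 0 := by
  have h1 := DFunLike.congr_fun (hN z) ![u, v, w]
  have h2 := isG2Frame_g2Frame hφ (i z) fun a => mfderiv (𝓡∂ 4) (𝓡 7) i z (![u, v, w] a)
  refine Eq.trans ?_ (h2.symm.trans h1)
  congr 1
  funext a
  fin_cases a <;> rfl

theorem jmath_eq_modelPhi [IsManifold (𝓡 7) ∞ M] (hφ : IsPositiveForm φ) (z : N)
    (v : TangentSpace (𝓡 7) (i z)) (u w : ℝ⁴) :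
    jmath φ i z v u w = modelPhi ![g2Frame φ (i z) v, frameMap φ i z u, frameMap φ i z w] := by
  refine (jmath_apply φ i z v u w).trans ((isG2Frame_g2Frame hφ (i z) _).trans ?_)
  congr 1
  funext a
  fin_cases a <;> rfl

variable [IsManifold (𝓡 7) ∞ M]

theorem frameMap_injective {z : N} (hinj : Function.Injective (mfderiv (𝓡∂ 4) (𝓡 7) i z)) :
    Function.Injective (frameMap φ i z) := (g2Frame φ (i z)).injective.comp hinj

theorem isOrientedOrthonormal_iff [IsManifold (𝓡∂ 4) ∞ N] {z : N}
    {e : Fin 4 → TangentSpace (𝓡∂ 4) z} :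
    IsOrientedOrthonormal φ i z e ↔ IsPositiveFrame (frameMap φ i z) e := Iff.rfl

theorem jmath_mem_selfDualSpace [IsManifold (𝓡∂ 4) ∞ N] (hφ : IsPositiveForm φ)
    (hN : IsCoassociative φ i) (z : N) (v : TangentSpace (𝓡 7) (i z)) :
    jmath φ i z v ∈ selfDualSpace φ i z := by
  refine ⟨fun u => ?_, fun e he => ?_⟩
  · rw [jmath_apply]
    exact (φ (i z)).map_eq_zero_of_eq _ (i := 1) (j := 2) rfl (by decide)
  · refine (jmath_eq_modelPhi hφ z v (e 0) (e 1)).trans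
      (Eq.trans ?_ (jmath_eq_modelPhi hφ z v (e 2) (e 3)).symm)
    rw [modelPhi_eq_inner_cross, modelPhi_eq_inner_cross, inner_cross_rotate,
      inner_cross_rotate (g2Frame φ (i z) v)]
    exact congrArg (fun x : ℝ⁷ => inner ℝ x (g2Frame φ (i z) v))
      (((isOrientedOrthonormal_iff.1 he).isCoassociativeFrame
        (modelPhi_frameMap hφ hN z)).cross_eq he.2)

/-- On a coassociative submanifold, `v ↦ (v ⌟ φ)|_N` has kernel the tangent space of `N` and image
the self-dual forms, so it is an isomorphism on every complement of the tangent space. -/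
theorem bijOn_jmath [IsManifold (𝓡∂ 4) ∞ N] (hφ : IsPositiveForm φ) (hN : IsCoassociative φ i)
    (h : Metric7 M) {z : N} (hinj : Function.Injective (mfderiv (𝓡∂ 4) (𝓡 7) i z)) :
    BijOn (jmath φ i z) (normalSpace h i z) (selfDualSpace φ i z) := by
  have hT := modelPhi_frameMap hφ hN z
  have hTi := frameMap_injective (φ := φ) hinj
  let d : ℝ⁴ →L[ℝ] ℝ⁷ := mfderiv (𝓡∂ 4) (𝓡 7) i z
  let G : ℝ⁷ →L[ℝ] ℝ⁷ →L[ℝ] ℝ := h.inner (i z)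
  have hG : ∀ v : ℝ⁷, v ≠ 0 → 0 < G v v := h.pos (i z)
  let ι : ℝ⁷ ≃L[ℝ] ℝ⁷ := g2Frame φ (i z)
  have hιd : ∀ u, ι (d u) = frameMap φ i z u := fun u => rfl
  have hj : ∀ (v : ℝ⁷) (u w : ℝ⁴), jmathLin φ i z v u w
      = modelPhi ![ι v, frameMap φ i z u, frameMap φ i z w] := fun v u w =>
    jmath_eq_modelPhi hφ z v u w
  have hn : ∀ v : ℝ⁷, v ∈ normalSpace h i z ↔ ∀ u, G v (d u) = 0 := fun v => Iff.rfl
  have hInj : ∀ v w : ℝ⁷, (∀ u, G v (d u) = 0) → (∀ u, G w (d u) = 0) →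
      jmathLin φ i z v = jmathLin φ i z w → v = w := by
    intro v w hv hw hvw
    have h0 : jmathLin φ i z (v - w) = 0 := by rw [map_sub, hvw, sub_self]
    obtain ⟨u, hu⟩ := mem_range_of_contraction_eq_zero hTi hT (v := ι (v - w)) fun a b => by
      rw [← hj, h0]; rfl
    have hu' : d u = v - w := ι.injective hu
    by_contra hne
    refine (hG (v - w) (sub_ne_zero.2 hne)).ne' ?_
    have h3 : G v (v - w) = 0 := by rw [← hu']; exact hv u
    have h4 : G w (v - w) = 0 := by rw [← hu']; exact hw u
    have h5 : G (v - w) = G v - G w := map_sub G v w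
    rw [h5, sub_apply, h3, h4, sub_zero]
  have hSurj : ∀ α : ℝ⁴ →L[ℝ] ℝ⁴ →L[ℝ] ℝ, (∀ u, α u u = 0) →
      (∀ e, IsPositiveFrame (frameMap φ i z) e → α (e 0) (e 1) = α (e 2) (e 3)) →
      ∃ v : ℝ⁷, (∀ u, G v (d u) = 0) ∧ jmathLin φ i z v = α := by
    intro α halt hα
    obtain ⟨v₀, hv₀⟩ := exists_contraction_eq hTi hT α halt hα
    have hjv₁ : jmathLin φ i z (ι.symm v₀) = α :=
      ContinuousLinearMap.ext fun u => ContinuousLinearMap.ext fun w => by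
        rw [hj, ← hv₀, ι.apply_symm_apply]
    -- subtract the orthogonal projection to the tangent space
    obtain ⟨e, he⟩ := exists_equiv_of_pos (G.bilinearComp d d) fun u hu =>
      hG (d u) fun h0 => hu (hinj (h0.trans (map_zero _).symm))
    have hu₀ : ∀ u, G (d (e.symm ((G (ι.symm v₀)).comp d))) (d u) = G (ι.symm v₀) (d u) := by
      intro u
      have h1 := e.apply_symm_apply ((G (ι.symm v₀)).comp d)
      have h2 : G.bilinearComp d d (e.symm ((G (ι.symm v₀)).comp d)) = (G (ι.symm v₀)).comp d := by
        rw [← he]; exact h1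
      exact DFunLike.congr_fun h2 u
    refine ⟨ι.symm v₀ - d (e.symm ((G (ι.symm v₀)).comp d)), fun u => ?_, ?_⟩
    · rw [map_sub, sub_apply, hu₀, sub_self]
    · have h1 : ∀ u, jmathLin φ i z (d u) = 0 := fun u =>
        ContinuousLinearMap.ext fun a => ContinuousLinearMap.ext fun b =>
          (hj (d u) a b).trans (hT u a b)
      rw [map_sub, hjv₁, h1]
      exact sub_zero α
  exact ⟨fun v _ => jmath_mem_selfDualSpace hφ hN z v, fun v hv w hw hvw => hInj v w hv hw hvw,
    fun α hα => hSurj α hα.1 hα.2⟩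

end Fibre

end Coassoc

namespace Coassoc

local notation "ℝ⁷" => EuclideanSpace ℝ (Fin 7)
local notation "ℝ⁴" => EuclideanSpace ℝ (Fin 4)

variable {M : Type*} [TopologicalSpace M] [ChartedSpace ℝ⁷ M] [IsManifold (𝓡 7) ∞ M]
variable {N : Type*} [TopologicalSpace N] [ChartedSpace (EuclideanHalfSpace 4) N]
  [IsManifold (𝓡∂ 4) ∞ N]

/-! ### The inverse of the contraction map -/

theorem mem_normalSpace_of_mem_normalBundle {h : Metric7 M} {i : N → M}
    (hi : Function.Injective i) {z : N} {v : TangentSpace (𝓡 7) (i z)}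
    (hv : (⟨i z, v⟩ : TangentBundle (𝓡 7) M) ∈ normalBundle h i) : v ∈ normalSpace h i z := by
  obtain ⟨w, u, hu, hwu⟩ := hv
  obtain rfl : z = w := hi (congrArg TotalSpace.proj hwu)
  have h1 : v = u := by simpa using hwu
  rw [h1]; exact hu

/-- The normal vector with prescribed contraction with `φ`. The value is meaningful only on the
bundle of self-dual forms, where `jmath` has an inverse. -/
noncomputable def normalLift (φ : FormField 7 M 3) (h : Metric7 M) (i : N → M)
    (q : BilinBundle N) : TangentBundle (𝓡 7) M :=
  ⟨i q.1, Function.invFunOn (jmath φ i q.1) (normalSpace h i q.1) q.2⟩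

theorem normalLift_jmath {φ : FormField 7 M 3} {h : Metric7 M} {i : N → M} {z : N}
    (hb : BijOn (jmath φ i z) (normalSpace h i z) (selfDualSpace φ i z))
    {v : TangentSpace (𝓡 7) (i z)} (hv : v ∈ normalSpace h i z) :
    normalLift φ h i ⟨z, jmath φ i z v⟩ = ⟨i z, v⟩ := by
  have h1 : Function.invFunOn (jmath φ i z) (normalSpace h i z) (jmath φ i z v) = v :=
    hb.injOn (Function.invFunOn_mem ⟨v, hv, rfl⟩) hv (Function.invFunOn_eq ⟨v, hv, rfl⟩)
  simp only [normalLift, h1]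

theorem exists_normalLift_eq {φ : FormField 7 M 3} {h : Metric7 M} {i : N → M}
    (hb : ∀ z, BijOn (jmath φ i z) (normalSpace h i z) (selfDualSpace φ i z))
    {q : BilinBundle N} (hq : q ∈ selfDualBundle φ i) :
    ∃ v ∈ normalSpace h i q.1, jmath φ i q.1 v = q.2 ∧ normalLift φ h i q = ⟨i q.1, v⟩ := by
  obtain ⟨v, hv, hvq⟩ := (hb q.1).surjOn hq
  refine ⟨v, hv, hvq, ?_⟩
  rw [← normalLift_jmath (hb q.1) hv, hvq]

theorem contMDiffAt_mfderiv_tframe {i : N → M} (his : ContMDiff (𝓡∂ 4) (𝓡 7) ∞ i) (z₀ : N)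
    (u : ℝ⁴) : ContMDiffAt (𝓡∂ 4) (𝓡 7).tangent ∞ (fun z => (⟨i z,
      mfderiv (𝓡∂ 4) (𝓡 7) i z (tframe (𝓡∂ 4) z₀ z u)⟩ : TangentBundle (𝓡 7) M)) z₀ := by
  have h1 : ContMDiffAt (𝓡∂ 4) (𝓡∂ 4).tangent ∞
      (fun z => (⟨z, tframe (𝓡∂ 4) z₀ z u⟩ : TangentBundle (𝓡∂ 4) N)) z₀ :=
    contMDiffWithinAt_tframe (mem_chart_source _ z₀) contMDiffWithinAt_id contMDiffWithinAt_const
  exact (his.contMDiff_tangentMap (m := ∞) (by simp)).contMDiffAt.comp z₀ h1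

/-- Contractions of smooth vector fields with `φ` and with the tangent frames of `N` are smooth. -/
theorem contMDiffWithinAt_jmath_tframe {EA HA A : Type*} [NormedAddCommGroup EA] [NormedSpace ℝ EA]
    [TopologicalSpace HA] {IA : ModelWithCorners ℝ EA HA} [TopologicalSpace A] [ChartedSpace HA A]
    {φ : FormField 7 M 3} (hs : IsSmoothForm φ) {i : N → M} (his : ContMDiff (𝓡∂ 4) (𝓡 7) ∞ i)
    {k : A → N} {v : ∀ a, TangentSpace (𝓡 7) (i (k a))} {s : Set A} {a : A}
    (hk : ContMDiffWithinAt IA (𝓡∂ 4) ∞ k s a)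
    (hv : ContMDiffWithinAt IA (𝓡 7).tangent ∞
      (fun a => (⟨i (k a), v a⟩ : TangentBundle (𝓡 7) M)) s a) (u w : ℝ⁴) :
    ContMDiffWithinAt IA 𝓘(ℝ, ℝ) ∞ (fun b => jmath φ i (k b) (v b)
      (tframe (𝓡∂ 4) (k a) (k b) u) (tframe (𝓡∂ 4) (k a) (k b) w)) s a := by
  have h1 : ∀ u : ℝ⁴, ContMDiffWithinAt IA (𝓡 7).tangent ∞ (fun b => (⟨i (k b),
      mfderiv (𝓡∂ 4) (𝓡 7) i (k b) (tframe (𝓡∂ 4) (k a) (k b) u)⟩ : TangentBundle (𝓡 7) M)) s a :=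
    fun u => (contMDiffAt_mfderiv_tframe his (k a) u).comp_contMDiffWithinAt a hk
  have h2 := hs.contMDiffWithinAt_apply (his.contMDiffAt.comp_contMDiffWithinAt a hk)
    (v := fun c b => (![v b, mfderiv (𝓡∂ 4) (𝓡 7) i (k b) (tframe (𝓡∂ 4) (k a) (k b) u),
      mfderiv (𝓡∂ 4) (𝓡 7) i (k b) (tframe (𝓡∂ 4) (k a) (k b) w)] :
        Fin 3 → TangentSpace (𝓡 7) (i (k b))) c) (by
      intro c
      fin_cases c
      · exact hv
      · exact h1 u
      · exact h1 w)
  exact h2.congr (fun b _ => jmath_apply φ i (k b) _ _ _) (jmath_apply φ i (k a) _ _ _)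

section Lift

variable (φ : FormField 7 M 3) (h : Metric7 M) (i : N → M) (z₀ : N)

/-- The coordinates of a tangent vector of `M` at a point of `N` by its products with the tangent
frame of `N` and its contractions with `φ` and this frame. -/
noncomputable def normalCoord (z : N) : ℝ⁷ →L[ℝ] (Fin 4 → ℝ) × (Fin 4 → Fin 4 → ℝ) :=
  let d : ℝ⁴ →L[ℝ] ℝ⁷ := mfderiv (𝓡∂ 4) (𝓡 7) i z
  let f : ℝ⁷ →L[ℝ] ℝ⁷ := tframe (𝓡 7) (i z₀) (i z)
  let b : Fin 4 → ℝ⁴ := fun a => tframe (𝓡∂ 4) z₀ z (EuclideanSpace.single a 1)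
  let G : ℝ⁷ →L[ℝ] ℝ⁷ →L[ℝ] ℝ := h.inner (i z)
  LinearMap.toContinuousLinearMap
    { toFun := fun x => (fun a => G (f x) (d (b a)), fun a c => jmathLin φ i z (f x) (b a) (b c))
      map_add' := fun x y => by
        refine Prod.ext (funext fun a => ?_) (funext fun a => funext fun c => ?_)
        · simp only [map_add, add_apply, Prod.fst_add, Pi.add_apply]
        · simp only [map_add, add_apply, Prod.snd_add, Pi.add_apply]
      map_smul' := fun t x => by
        refine Prod.ext (funext fun a => ?_) (funext fun a => funext fun c => ?_)
        · simp only [map_smul, smul_apply, Prod.smul_fst, Pi.smul_apply, RingHom.id_apply]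
        · simp only [map_smul, smul_apply, Prod.smul_snd, Pi.smul_apply, RingHom.id_apply] }

theorem normalCoord_apply (z : N) (x : ℝ⁷) : normalCoord φ h i z₀ z x
    = (fun a => h.inner (i z) (tframe (𝓡 7) (i z₀) (i z) x)
        (mfderiv (𝓡∂ 4) (𝓡 7) i z (tframe (𝓡∂ 4) z₀ z (EuclideanSpace.single a 1))),
      fun a c => jmath φ i z (tframe (𝓡 7) (i z₀) (i z) x)
        (tframe (𝓡∂ 4) z₀ z (EuclideanSpace.single a 1))
        (tframe (𝓡∂ 4) z₀ z (EuclideanSpace.single c 1))) := rfl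

variable {φ h i}

theorem contMDiffAt_normalCoord (hs : IsSmoothForm φ) (his : ContMDiff (𝓡∂ 4) (𝓡 7) ∞ i) :
    ContMDiffAt (𝓡∂ 4) 𝓘(ℝ, ℝ⁷ →L[ℝ] (Fin 4 → ℝ) × (Fin 4 → Fin 4 → ℝ)) ∞
      (normalCoord φ h i z₀) z₀ := by
  refine contMDiffWithinAt_of_apply fun x => ?_
  have hx : ContMDiffWithinAt (𝓡∂ 4) (𝓡 7).tangent ∞
      (fun z => (⟨i z, tframe (𝓡 7) (i z₀) (i z) x⟩ : TangentBundle (𝓡 7) M)) univ z₀ :=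
    contMDiffWithinAt_tframe (mem_chart_source _ _) his.contMDiffAt contMDiffWithinAt_const
  simp only [normalCoord_apply]
  refine ContMDiffWithinAt.prodMk_space ?_ ?_
  · refine contMDiffWithinAt_pi_space.2 fun a => ?_
    exact metric7_contMDiffWithinAt h hx (contMDiffAt_mfderiv_tframe his z₀ _)
  · refine contMDiffWithinAt_pi_space.2 fun a => contMDiffWithinAt_pi_space.2 fun c => ?_
    exact contMDiffWithinAt_jmath_tframe hs his (k := fun z => z) contMDiffWithinAt_id hx _ _

theorem eq_zero_of_apply_tframe {z : N} {l : ℝ⁴ →L[ℝ] ℝ} {b : Fin 4 → ℝ⁴}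
    (hb : ∀ a, b a = tframe (𝓡∂ 4) z z (EuclideanSpace.single a 1)) (hl : ∀ a, l (b a) = 0) :
    l = 0 := by
  let f : ℝ⁴ →L[ℝ] ℝ⁴ := tframe (𝓡∂ 4) z z
  have h1 : l.comp f = 0 := by
    refine ContinuousLinearMap.coe_injective ((EuclideanSpace.basisFun (Fin 4) ℝ).toBasis.ext
      fun a => ?_)
    have h2 : l (f (EuclideanSpace.single a 1)) = 0 := by rw [← hl a, hb a]; rfl
    simpa using h2
  refine ContinuousLinearMap.ext fun u => ?_
  have h3 := tframe_tcoordL (I := 𝓡∂ 4) (mem_chart_source _ z) u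
  have h4 : l (f (tcoordL (𝓡∂ 4) z z u)) = 0 := DFunLike.congr_fun h1 _
  have h5 : f (tcoordL (𝓡∂ 4) z z u) = u := h3
  rw [h5] at h4
  rw [h4]; rfl

/-- A vector is normal to `N` and annihilated by the contraction with `φ` only if it vanishes; so
the linear equations collected in `normalCoord` determine a normal vector. -/
theorem injective_normalCoord
    (hb : BijOn (jmath φ i z₀) (normalSpace h i z₀) (selfDualSpace φ i z₀)) :
    Function.Injective (normalCoord φ h i z₀ z₀) := by
  refine (injective_iff_map_eq_zero _).2 fun x hx => ?_
  let v : ℝ⁷ := tframe (𝓡 7) (i z₀) (i z₀) x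
  let d : ℝ⁴ →L[ℝ] ℝ⁷ := mfderiv (𝓡∂ 4) (𝓡 7) i z₀
  let G : ℝ⁷ →L[ℝ] ℝ⁷ →L[ℝ] ℝ := h.inner (i z₀)
  let b : Fin 4 → ℝ⁴ := fun a => tframe (𝓡∂ 4) z₀ z₀ (EuclideanSpace.single a 1)
  have h1 : ∀ a, G v (d (b a)) = 0 := fun a => congrFun (congrArg Prod.fst hx) a
  have h2 : ∀ a c, jmathLin φ i z₀ v (b a) (b c) = 0 := fun a c =>
    congrFun (congrFun (congrArg Prod.snd hx) a) c
  have h3 : (G v).comp d = 0 := eq_zero_of_apply_tframe (fun a => rfl) h1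
  have h4 : ∀ a, jmathLin φ i z₀ v (b a) = 0 := fun a =>
    eq_zero_of_apply_tframe (fun a => rfl) (h2 a)
  have h5 : ∀ w, (jmathLin φ i z₀ v).flip w = 0 := fun w =>
    eq_zero_of_apply_tframe (b := b) (fun a => rfl) fun a => by
      rw [ContinuousLinearMap.flip_apply, h4 a]; rfl
  have h6 : jmathLin φ i z₀ v = 0 :=
    ContinuousLinearMap.ext fun a => ContinuousLinearMap.ext fun c =>
      DFunLike.congr_fun (h5 c) a
  have h0 : ∀ u, G 0 (d u) = 0 := fun u => by rw [map_zero]; rfl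
  have h7 : v = 0 := hb.injOn (show v ∈ normalSpace h i z₀ from fun u => DFunLike.congr_fun h3 u)
    (show (0 : ℝ⁷) ∈ normalSpace h i z₀ from h0) (h6.trans (map_zero (jmathLin φ i z₀)).symm)
  have h8 := tcoordL_tframe (I := 𝓡 7) (mem_chart_source ℝ⁷ (i z₀)) x
  rw [← h8]
  exact (congrArg (tcoordL (𝓡 7) (i z₀) (i z₀)) h7).trans (map_zero _)

set_option maxHeartbeats 1600000 in
/-- The normal vector with a given contraction depends smoothly on the contraction. With a left
inverse `Q` of `normalCoord` at `z₀`, the maps `Q ∘ normalCoord z` are invertible for `z` near `z₀`,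
and applying their inverses solves the linear equations for the normal vector. -/
theorem contMDiffOn_normalLift (hs : IsSmoothForm φ) (his : ContMDiff (𝓡∂ 4) (𝓡 7) ∞ i)
    (hb : ∀ z, BijOn (jmath φ i z) (normalSpace h i z) (selfDualSpace φ i z)) :
    ContMDiffOn bilinModel (𝓡 7).tangent ∞ (normalLift φ h i) (selfDualBundle φ i) := by
  intro q₀ hq₀
  set z₀ := q₀.1 with hz₀
  set p := i z₀ with hp
  obtain ⟨Q', hQ'⟩ := LinearMap.exists_leftInverse_of_injective
    (normalCoord φ h i z₀ z₀ : ℝ⁷ →ₗ[ℝ] (Fin 4 → ℝ) × (Fin 4 → Fin 4 → ℝ))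
    (LinearMap.ker_eq_bot.2 (injective_normalCoord z₀ (hb z₀)))
  let Q : (Fin 4 → ℝ) × (Fin 4 → Fin 4 → ℝ) →L[ℝ] ℝ⁷ := LinearMap.toContinuousLinearMap Q'
  set A : N → ℝ⁷ →L[ℝ] ℝ⁷ := fun z => Q.comp (normalCoord φ h i z₀ z) with hA
  have hA₀ : A z₀ = (ContinuousLinearEquiv.refl ℝ ℝ⁷ : ℝ⁷ →L[ℝ] ℝ⁷) :=
    ContinuousLinearMap.ext fun x => DFunLike.congr_fun hQ' x
  have hAs : ContMDiffAt (𝓡∂ 4) 𝓘(ℝ, ℝ⁷ →L[ℝ] ℝ⁷) ∞ A z₀ :=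
    contMDiffAt_const.clm_comp (contMDiffAt_normalCoord z₀ hs his)
  have hAi : ContMDiffAt (𝓡∂ 4) 𝓘(ℝ, ℝ⁷ →L[ℝ] ℝ⁷) ∞ (fun z => (A z).inverse) z₀ := by
    have h1 : ContDiffAt ℝ ∞ ContinuousLinearMap.inverse (A z₀) := by
      rw [hA₀]; exact contDiffAt_map_inverse _
    exact h1.contMDiffAt.comp z₀ hAs
  have hproj : ContMDiff bilinModel (𝓡∂ 4) ∞ (TotalSpace.proj : BilinBundle N → N) :=
    Bundle.contMDiff_proj _
  have hpc : ContinuousAt (TotalSpace.proj : BilinBundle N → N) q₀ := hproj.continuous.continuousAt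
  -- the coordinates of the forms in the frame of `N` are smooth
  have hcoord : ∀ u w : ℝ⁴, ContMDiffAt bilinModel 𝓘(ℝ, ℝ) ∞
      (fun q : BilinBundle N => q.2 (tframe (𝓡∂ 4) z₀ q.1 u) (tframe (𝓡∂ 4) z₀ q.1 w)) q₀ :=
    ((contMDiffWithinAt_bilinBundle_iff (I := 𝓡∂ 4) (fun q : BilinBundle N => q)
      (s := univ) (a := q₀)).1 contMDiffWithinAt_id).2
  set c : BilinBundle N → (Fin 4 → ℝ) × (Fin 4 → Fin 4 → ℝ) := fun q => (0, fun a b =>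
    q.2 (tframe (𝓡∂ 4) z₀ q.1 (EuclideanSpace.single a 1))
      (tframe (𝓡∂ 4) z₀ q.1 (EuclideanSpace.single b 1))) with hc
  have hcs : ContMDiffAt bilinModel 𝓘(ℝ, (Fin 4 → ℝ) × (Fin 4 → Fin 4 → ℝ)) ∞ c q₀ :=
    contMDiffAt_const.prodMk_space (contMDiffAt_pi_space.2 fun a => contMDiffAt_pi_space.2 fun b =>
      hcoord _ _)
  have hx : ContMDiffAt bilinModel 𝓘(ℝ, ℝ⁷) ∞ (fun q => (A q.1).inverse (Q (c q))) q₀ :=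
    (ContMDiffAt.comp q₀ hAi hproj.contMDiffAt).clm_apply
      ((ContinuousLinearMap.contMDiff Q).contMDiffAt.comp q₀ hcs)
  have hF : ContMDiffAt bilinModel (𝓡 7).tangent ∞ (fun q : BilinBundle N =>
      (⟨i q.1, tframe (𝓡 7) p (i q.1) ((A q.1).inverse (Q (c q)))⟩ : TangentBundle (𝓡 7) M)) q₀ :=
    contMDiffWithinAt_tframe (mem_chart_source _ p) (his.contMDiffAt.comp q₀ hproj.contMDiffAt) hx
  have hp1 : ∀ᶠ q : BilinBundle N in 𝓝 q₀, i q.1 ∈ (chartAt ℝ⁷ p).source :=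
    (ContinuousAt.comp his.continuous.continuousAt hpc).eventually
      ((chartAt ℝ⁷ p).open_source.mem_nhds (mem_chart_source _ p))
  have hA1 : ∀ᶠ q : BilinBundle N in 𝓝 q₀,
      A q.1 ∈ range ((↑) : (ℝ⁷ ≃L[ℝ] ℝ⁷) → ℝ⁷ →L[ℝ] ℝ⁷) :=
    (ContinuousAt.comp (g := A) hAs.continuousAt hpc).eventually
      (ContinuousLinearEquiv.isOpen.mem_nhds ⟨_, hA₀.symm⟩)
  have key : ∀ q ∈ selfDualBundle φ i, i q.1 ∈ (chartAt ℝ⁷ p).source →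
      A q.1 ∈ range ((↑) : (ℝ⁷ ≃L[ℝ] ℝ⁷) → ℝ⁷ →L[ℝ] ℝ⁷) → normalLift φ h i q
        = ⟨i q.1, tframe (𝓡 7) p (i q.1) ((A q.1).inverse (Q (c q)))⟩ := by
    rintro q hq hqp ⟨a, ha⟩
    obtain ⟨v, hv, hvq, hvl⟩ := exists_normalLift_eq hb hq
    have h1 : normalCoord φ h i z₀ q.1 (tcoordL (𝓡 7) p (i q.1) v) = c q := by
      have h2 : tframe (𝓡 7) p (i q.1) (tcoordL (𝓡 7) p (i q.1) v) = v := tframe_tcoordL hqp v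
      rw [normalCoord_apply, h2, hc, hvq]
      exact Prod.ext (funext fun a => hv _) rfl
    have h3 : (A q.1).inverse (Q (c q)) = tcoordL (𝓡 7) p (i q.1) v := by
      rw [← h1]
      show (A q.1).inverse (A q.1 (tcoordL (𝓡 7) p (i q.1) v)) = _
      rw [← ha, ContinuousLinearMap.inverse_equiv]
      exact a.symm_apply_apply _
    rw [hvl, h3, tframe_tcoordL hqp v]
  refine hF.contMDiffWithinAt.congr_of_eventuallyEq ?_
    (key q₀ hq₀ hp1.self_of_nhds hA1.self_of_nhds)
  filter_upwards [mem_nhdsWithin_of_mem_nhds hp1, mem_nhdsWithin_of_mem_nhds hA1,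
    self_mem_nhdsWithin] with q h1 h2 hq using key q hq h1 h2

end Lift

end Coassoc

namespace Coassoc

local notation "ℝ⁷" => EuclideanSpace ℝ (Fin 7)
local notation "ℝ⁴" => EuclideanSpace ℝ (Fin 4)

variable {M : Type*} [TopologicalSpace M] [ChartedSpace ℝ⁷ M] [IsManifold (𝓡 7) ∞ M]
variable {N : Type*} [TopologicalSpace N] [ChartedSpace (EuclideanHalfSpace 4) N]
  [IsManifold (𝓡∂ 4) ∞ N]

/-! ### The contraction map on the normal bundle -/

/-- The inverse of a smooth embedding is smooth on the image. -/
theorem contMDiffOn_invFun [Nonempty N] {i : N → M}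
    (hi : Manifold.IsSmoothEmbedding (𝓡∂ 4) (𝓡 7) ∞ i) :
    ContMDiffOn (𝓡 7) (𝓡∂ 4) ∞ (Function.invFun i) (range i) := by
  have hinv : ∀ z, Function.invFun i (i z) = z :=
    Function.leftInverse_invFun hi.isEmbedding.injective
  rintro _ ⟨z, rfl⟩
  obtain ⟨κ, U, ι, O, r, hκ, hz, hU, hO, hι, hr, hm, hri, hκf⟩ :=
    exists_extension_of_isImmersionAt (hi.isImmersion.isImmersionAt z)
  obtain ⟨O', hO', hO'κ⟩ := hi.isEmbedding.isInducing.isOpen_iff.1 κ.open_source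
  have hri' : ∀ w ∈ κ.source, r (i w) = κ.extend (𝓡∂ 4) w := fun w hw => by
    rw [← (hκf w hw).2, hri _ (hκf w hw).1]
  have hmem : ∀ w, i w ∈ O' → w ∈ κ.source := fun w hw => by rw [← hO'κ]; exact hw
  have hzO : i z ∈ O := (hκf z hz).2 ▸ hm (hκf z hz).1
  have hzO' : i z ∈ O' := by rw [← hO'κ] at hz; exact hz
  have h1 : ContMDiffOn (𝓡 7) (𝓡∂ 4) ∞ (fun x => (κ.extend (𝓡∂ 4)).symm (r x))
      (range i ∩ (O ∩ O')) := by
    refine (contMDiffOn_extend_symm hκ).comp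
      (hr.mono fun x hx => hx.2.1) ?_
    rintro _ ⟨⟨w, rfl⟩, -, hw⟩
    exact ⟨κ w, κ.map_source (hmem w hw), (hri' w (hmem w hw)).symm⟩
  have h2 : ∀ x ∈ range i ∩ (O ∩ O'), Function.invFun i x = (κ.extend (𝓡∂ 4)).symm (r x) := by
    rintro _ ⟨⟨w, rfl⟩, -, hw⟩
    rw [hinv, hri' w (hmem w hw), OpenPartialHomeomorph.extend_left_inv _ (hmem w hw)]
  exact (h1.congr h2 (i z) ⟨⟨z, rfl⟩, hzO, hzO'⟩).mono_of_mem_nhdsWithin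
    (inter_mem_nhdsWithin _ ((hO.inter hO').mem_nhds ⟨hzO, hzO'⟩))

/-- The contraction with `φ`, as a map from the normal bundle to the bundle of bilinear forms. The
base point in `N` is recovered by `Function.invFun i`, which is meaningful only over the image of
the embedding `i`. -/
noncomputable def contraction [Nonempty N] (φ : FormField 7 M 3) (i : N → M)
    (p : TangentBundle (𝓡 7) M) : BilinBundle N :=
  ⟨Function.invFun i p.1, jmathLin φ i (Function.invFun i p.1) p.2⟩

theorem contraction_mk [Nonempty N] {φ : FormField 7 M 3} {i : N → M} (hi : Function.Injective i)
    (z : N) (v : TangentSpace (𝓡 7) (i z)) :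
    contraction φ i ⟨i z, v⟩ = ⟨z, jmath φ i z v⟩ := by
  have h1 : ∀ z', z' = z → (⟨z', jmathLin φ i z' v⟩ : BilinBundle N) = ⟨z, jmath φ i z v⟩ := by
    rintro _ rfl; rfl
  exact h1 _ (Function.leftInverse_invFun hi z)

set_option maxHeartbeats 1600000 in
/-- Smoothness on the normal bundle, in the sense of the ambient tangent bundle, holds because the
inverse of an embedding is locally the restriction of a smooth map of the ambient manifold. -/
theorem contMDiffOn_contraction [Nonempty N] {φ : FormField 7 M 3} (hs : IsSmoothForm φ) {i : N → M}
    (hi : Manifold.IsSmoothEmbedding (𝓡∂ 4) (𝓡 7) ∞ i) (h : Metric7 M) :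
    ContMDiffOn (𝓡 7).tangent bilinModel ∞ (contraction φ i) (normalBundle h i) := by
  rintro p₀ hp₀
  have hinv : ∀ z, Function.invFun i (i z) = z :=
    Function.leftInverse_invFun hi.isEmbedding.injective
  have hproj : ContMDiff (𝓡 7).tangent (𝓡 7) ∞ (TotalSpace.proj : TangentBundle (𝓡 7) M → M) :=
    Bundle.contMDiff_proj _
  have hmaps : MapsTo (TotalSpace.proj : TangentBundle (𝓡 7) M → M) (normalBundle h i)
      (range i) := by
    rintro _ ⟨z, v, hv, rfl⟩
    exact ⟨z, rfl⟩
  have hk : ContMDiffWithinAt (𝓡 7).tangent (𝓡∂ 4) ∞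
      (fun p : TangentBundle (𝓡 7) M => Function.invFun i p.1) (normalBundle h i) p₀ :=
    (contMDiffOn_invFun hi).comp hproj.contMDiffOn hmaps p₀ hp₀
  have hid : ∀ p ∈ normalBundle h i,
      (⟨i (Function.invFun i p.1), p.2⟩ : TangentBundle (𝓡 7) M) = p := by
    rintro _ ⟨z, v, hv, rfl⟩
    have h1 : ∀ z', z' = z → (⟨i z', v⟩ : TangentBundle (𝓡 7) M) = ⟨i z, v⟩ := by
      rintro _ rfl; rfl
    exact h1 _ (hinv z)
  have hv : ContMDiffWithinAt (𝓡 7).tangent (𝓡 7).tangent ∞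
      (fun p : TangentBundle (𝓡 7) M =>
        (⟨i (Function.invFun i p.1), p.2⟩ : TangentBundle (𝓡 7) M)) (normalBundle h i) p₀ :=
    contMDiffWithinAt_id.congr hid (hid p₀ hp₀)
  exact (contMDiffWithinAt_bilinBundle_iff (I := 𝓡∂ 4) (contraction φ i)).2 ⟨hk, fun u w =>
    contMDiffWithinAt_jmath_tframe hs hi.isImmersion.contMDiff hk hv u w⟩

end Coassoc

namespace Coassoc

local notation "ℝ⁷" => EuclideanSpace ℝ (Fin 7)
local notation "ℝ⁴" => EuclideanSpace ℝ (Fin 4)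

variable {M : Type*} [TopologicalSpace M] [ChartedSpace ℝ⁷ M] [IsManifold (𝓡 7) ∞ M]
variable {N : Type*} [TopologicalSpace N] [ChartedSpace (EuclideanHalfSpace 4) N]
  [IsManifold (𝓡∂ 4) ∞ N]
variable {φ : FormField 7 M 3} {h : Metric7 M} {i : N → M} {V : Set (TangentBundle (𝓡 7) M)}

/-! ### Diffeomorphisms of self-dual 2-forms and their sections -/

theorem mem_jmathImage_iff
    (hb : ∀ z, BijOn (jmath φ i z) (normalSpace h i z) (selfDualSpace φ i z))
    (hi : Function.Injective i) (hV : V ⊆ normalBundle h i) {q : BilinBundle N} :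
    q ∈ jmathImage φ i V ↔ q ∈ selfDualBundle φ i ∧ normalLift φ h i q ∈ V := by
  constructor
  · rintro ⟨v, hv, hq⟩
    have hvn := mem_normalSpace_of_mem_normalBundle hi (hV hv)
    have hq' : q = ⟨q.1, jmath φ i q.1 v⟩ := by rw [← hq]
    refine ⟨?_, ?_⟩
    · show q.2 ∈ selfDualSpace φ i q.1
      rw [hq]; exact (hb q.1).mapsTo hvn
    · rw [hq', normalLift_jmath (hb q.1) hvn]; exact hv
  · rintro ⟨hq, hqV⟩
    obtain ⟨v, hv, hvq, hvl⟩ := exists_normalLift_eq hb hq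
    exact ⟨v, hvl ▸ hqV, hvq.symm⟩

theorem isOpenIn_jmathImage (hs : IsSmoothForm φ) (his : ContMDiff (𝓡∂ 4) (𝓡 7) ∞ i)
    (hb : ∀ z, BijOn (jmath φ i z) (normalSpace h i z) (selfDualSpace φ i z))
    (hi : Function.Injective i) (hV : IsOpenIn V (normalBundle h i)) :
    IsOpenIn (jmathImage φ i V) (selfDualBundle φ i) := by
  obtain ⟨U, hU, hVU⟩ := hV
  have hVn : V ⊆ normalBundle h i := hVU ▸ inter_subset_right
  obtain ⟨O, hO, hOU⟩ := continuousOn_iff'.1 (contMDiffOn_normalLift hs his hb).continuousOn U hU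
  refine ⟨O, hO, ?_⟩
  rw [← hOU]
  ext q
  rw [mem_jmathImage_iff hb hi hVn]
  refine ⟨fun hq => ⟨?_, hq.1⟩, fun hq => ⟨hq.2, ?_⟩⟩
  · have := hq.2
    rw [hVU] at this
    exact this.1
  · obtain ⟨v, hv, -, hvl⟩ := exists_normalLift_eq hb hq.2
    rw [hVU]
    exact ⟨hq.1, q.1, v, hv, hvl⟩

/-- A diffeomorphism from a part of the normal bundle becomes one from the corresponding self-dual
forms, since `normalLift` and `contraction` are smooth and inverse to each other. -/
theorem isDiffeoOnto_comp_normalLift [Nonempty N] (hs : IsSmoothForm φ)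
    (hi : Manifold.IsSmoothEmbedding (𝓡∂ 4) (𝓡 7) ∞ i)
    (hb : ∀ z, BijOn (jmath φ i z) (normalSpace h i z) (selfDualSpace φ i z))
    (hV : V ⊆ normalBundle h i) {e : TangentBundle (𝓡 7) M → M} {T : Set M}
    (he : IsDiffeoOnto (𝓡 7).tangent (𝓡 7) e V T) :
    IsDiffeoOnto bilinModel (𝓡 7) (fun q => e (normalLift φ h i q)) (jmathImage φ i V) T := by
  have hinj := hi.isEmbedding.injective
  have hiff := fun q : BilinBundle N => mem_jmathImage_iff (q := q) hb hinj hV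
  obtain ⟨hm, hes, g, hgm, hg, hgs⟩ := he
  have hl1 : ∀ p ∈ V, normalLift φ h i (contraction φ i p) = p := by
    intro p hp
    obtain ⟨z, v, hv, rfl⟩ := hV hp
    rw [contraction_mk hinj, normalLift_jmath (hb z) hv]
  have hl2 : ∀ q ∈ selfDualBundle φ i, contraction φ i (normalLift φ h i q) = q := by
    intro q hq
    obtain ⟨v, hv, hvq, hvl⟩ := exists_normalLift_eq hb hq
    rw [hvl, contraction_mk hinj, hvq]
  have hc : MapsTo (contraction φ i) V (jmathImage φ i V) := by
    intro p hp
    refine (hiff _).2 ⟨?_, by rw [hl1 p hp]; exact hp⟩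
    obtain ⟨z, v, hv, rfl⟩ := hV hp
    rw [contraction_mk hinj]
    exact (hb z).mapsTo hv
  refine ⟨fun q hq => hm ((hiff q).1 hq).2, ?_, fun x => contraction φ i (g x), fun x hx =>
    hc (hgm hx), ⟨fun q hq => ?_, fun x hx => ?_⟩, ?_⟩
  · exact hes.comp ((contMDiffOn_normalLift hs hi.isImmersion.contMDiff hb).mono fun q hq =>
      ((hiff q).1 hq).1) fun q hq => ((hiff q).1 hq).2
  · show contraction φ i (g (e (normalLift φ h i q))) = q
    rw [hg.1 ((hiff q).1 hq).2, hl2 q ((hiff q).1 hq).1]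
  · show e (normalLift φ h i (contraction φ i (g x))) = x
    rw [hl1 _ (hgm hx), hg.2 hx]
  · exact ((contMDiffOn_contraction hs hi h).mono hV).comp hgs hgm

/-- A diffeomorphism from a set of bilinear forms on `N` onto a subset of `M` carries sections of
this set to embeddings: the inverse diffeomorphism, followed by the bundle projection, is a smooth
left inverse. -/
theorem IsDiffeoOnto.isEmbeddingMap_section [T2Space M] [CompactSpace N] {δ : BilinBundle N → M}
    {U : Set (BilinBundle N)} {T : Set M} (hδ : IsDiffeoOnto bilinModel (𝓡 7) δ U T)
    {σ : N → BilinBundle N} (hσ : ContMDiff (𝓡∂ 4) bilinModel ∞ σ) (hσp : ∀ z, (σ z).1 = z)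
    (hσU : ∀ z, σ z ∈ U) : IsEmbeddingMap (𝓡∂ 4) (𝓡 7) fun z => δ (σ z) := by
  obtain ⟨hm, hδs, g, hgm, hg, hgs⟩ := hδ
  have hs : ContMDiff (𝓡∂ 4) (𝓡 7) ∞ fun z => δ (σ z) := hδs.comp_contMDiff hσ hσU
  have hinv : ∀ z, (g (δ (σ z))).1 = z := fun z => by rw [hg.1 (hσU z), hσp]
  have hr : ContMDiffOn (𝓡 7) (𝓡∂ 4) ∞ (fun x => (g x).1) T :=
    (Bundle.contMDiff_proj _ : ContMDiff bilinModel (𝓡∂ 4) ∞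
      (TotalSpace.proj : BilinBundle N → N)).comp_contMDiffOn hgs
  refine ⟨hs, (hs.continuous.isClosedEmbedding fun z w hzw => ?_).isEmbedding, fun z => ?_⟩
  · rw [← hinv z, ← hinv w]
    exact congrArg (fun x => (g x).1) hzw
  · have h1 := ((hs z).mdifferentiableAt (by simp)).hasMFDerivAt
    have h2 := ((hr _ (hm (hσU z))).mdifferentiableWithinAt (by simp)).hasMFDerivWithinAt
    have h3 := HasMFDerivWithinAt.comp z h2 h1.hasMFDerivWithinAt
      (s := univ) fun w _ => hm (hσU w)
    have h4 := (hasMFDerivAt_id (I := 𝓡∂ 4) z).congr_of_eventuallyEq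
      (f₁ := (fun x => (g x).1) ∘ fun w => δ (σ w)) (.of_forall hinv)
    have h5 := hasMFDerivAt_unique (hasMFDerivWithinAt_univ.1 h3) h4
    exact Function.LeftInverse.injective fun u => DFunLike.congr_fun h5 u

end Coassoc

theorem mainTheorem6
    {M : Type*} [TopologicalSpace M] [ChartedSpace (EuclideanSpace ℝ (Fin 7)) M]
    [IsManifold (𝓡 7) ∞ M] [T2Space M] [SecondCountableTopology M]
    {N : Type*} [TopologicalSpace N] [ChartedSpace (EuclideanHalfSpace 4) N]
    [IsManifold (𝓡∂ 4) ∞ N] [CompactSpace N]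
    {S : Type*} [TopologicalSpace S] [ChartedSpace (EuclideanSpace ℝ (Fin 6)) S]
    [IsManifold (𝓡 6) ∞ S]
    (φ : Coassoc.FormField 7 M 3) (hφ : Coassoc.IsClosedG2Structure φ)
    (i : N → M) (hi : Manifold.IsSmoothEmbedding (𝓡∂ 4) (𝓡 7) ∞ i)
    (hN : Coassoc.IsCoassociative φ i) (hb : ((𝓡∂ 4).boundary N).Nonempty)
    (j : S → M) (hj : Manifold.IsSmoothEmbedding (𝓡 6) (𝓡 7) ∞ j) (hjc : IsClosed (Set.range j))
    (hS : Coassoc.IsScaffold φ i j)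
    (W : Set M) (hW : IsOpen W) (hSW : Set.range j ⊆ W) :
    ∃ (TS : Set M) (gHat : Coassoc.Metric7 M),
      Coassoc.IsTubularNeighbourhood φ j TS ∧ TS ⊆ W ∧
      (∀ x ∉ TS, ∀ u v : TangentSpace (𝓡 7) x, gHat.inner x u v = Coassoc.g2Metric φ x u v) ∧
      Coassoc.IsTotallyGeodesic gHat j ∧
      -- the map `v ↦ (v ⌟ φ)|_N` is an isomorphism of the `gHat`-normal bundle with `Λ²₊ T^*N`
      (∀ z : N, Set.BijOn (Coassoc.jmath φ i z) (Coassoc.normalSpace gHat i z)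
        (Coassoc.selfDualSpace φ i z)) ∧
      ∃ (V : Set (TangentBundle (𝓡 7) M)) (TN : Set M),
        Coassoc.IsOpenIn V (Coassoc.normalBundle gHat i) ∧
        (∀ z : N, (⟨i z, 0⟩ : TangentBundle (𝓡 7) M) ∈ V) ∧
        Coassoc.IsDomainWithBoundary TN ∧ Set.range i ⊆ TN ∧
        V ⊆ Coassoc.expDomain gHat ∧
        Coassoc.IsDiffeoOnto (𝓡 7).tangent (𝓡 7) (Coassoc.expMap gHat) V TN ∧
        (∀ v : ∀ z : N, TangentSpace (𝓡 7) (i z),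
          ContMDiff (𝓡∂ 4) (𝓡 7).tangent ∞
            (fun z => (⟨i z, v z⟩ : TangentBundle (𝓡 7) M)) →
          (∀ z : N, (⟨i z, v z⟩ : TangentBundle (𝓡 7) M) ∈ V) →
          ∀ z ∈ (𝓡∂ 4).boundary N, Coassoc.expMap gHat ⟨i z, v z⟩ ∈ Set.range j) ∧
        -- the corresponding statements for self-dual 2-forms
        Coassoc.IsOpenIn (Coassoc.jmathImage φ i V) (Coassoc.selfDualBundle φ i) ∧
        (∀ z : N, (⟨z, 0⟩ : Coassoc.BilinBundle N) ∈ Coassoc.jmathImage φ i V) ∧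
        ∃ δ : Coassoc.BilinBundle N → M,
          (∀ (z : N) (v : TangentSpace (𝓡 7) (i z)), (⟨i z, v⟩ : TangentBundle (𝓡 7) M) ∈ V →
            δ ⟨z, Coassoc.jmath φ i z v⟩ = Coassoc.expMap gHat ⟨i z, v⟩) ∧
          Coassoc.IsDiffeoOnto Coassoc.bilinModel (𝓡 7) δ (Coassoc.jmathImage φ i V) TN ∧
          ∀ α : ∀ z : N, TangentSpace (𝓡∂ 4) z →L[ℝ] TangentSpace (𝓡∂ 4) z →L[ℝ] ℝ,
            ContMDiff (𝓡∂ 4) Coassoc.bilinModel ∞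
              (fun z => (⟨z, α z⟩ : Coassoc.BilinBundle N)) →
            (∀ z : N, (⟨z, α z⟩ : Coassoc.BilinBundle N) ∈ Coassoc.jmathImage φ i V) →
            (∀ z ∈ (𝓡∂ 4).boundary N, δ ⟨z, α z⟩ ∈ Set.range j) ∧
            (∀ z : N, δ ⟨z, α z⟩ ∈ TN) ∧
            Coassoc.IsEmbeddingMap (𝓡∂ 4) (𝓡 7) (fun z => δ ⟨z, α z⟩) := by
  have hinj : ∀ z, Function.Injective (mfderiv (𝓡∂ 4) (𝓡 7) i z) := fun z =>
    Coassoc.injective_mfderiv_of_isImmersionAt (hi.isImmersion.isImmersionAt z)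
  have hii := hi.isEmbedding.injective
  have : Nonempty N := hb.to_type
  obtain ⟨TS, gHat, hTS, hTW, hg, hgS, hexp⟩ :=
    Coassoc.exists_metric_of_isScaffold hφ.positive hφ.smooth hinj hb hj hjc hS hW hSW
  have hbij := fun z => Coassoc.bijOn_jmath hφ.positive hN gHat (hinj z)
  obtain ⟨V, TN, hV, hV0, hTN, hNT, hVe, hd⟩ := Coassoc.exists_normal_domain gHat hi
  have hVn : V ⊆ Coassoc.normalBundle gHat i := by
    obtain ⟨U, -, rfl⟩ := hV
    exact inter_subset_right
  have hmem : ∀ z (v : TangentSpace (𝓡 7) (i z)), (⟨i z, v⟩ : TangentBundle (𝓡 7) M) ∈ V →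
      v ∈ Coassoc.normalSpace gHat i z := fun z v hv =>
    Coassoc.mem_normalSpace_of_mem_normalBundle hii (hVn hv)
  have hδ : ∀ z (v : TangentSpace (𝓡 7) (i z)), (⟨i z, v⟩ : TangentBundle (𝓡 7) M) ∈ V →
      Coassoc.expMap gHat (Coassoc.normalLift φ gHat i ⟨z, Coassoc.jmath φ i z v⟩)
        = Coassoc.expMap gHat ⟨i z, v⟩ := fun z v hv => by
    rw [Coassoc.normalLift_jmath (hbij z) (hmem z v hv)]
  have hD := Coassoc.isDiffeoOnto_comp_normalLift hφ.smooth hi hbij hVn hd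
  refine ⟨TS, gHat, hTS, hTW, hg, hgS, hbij, V, TN, hV, hV0, hTN, hNT, hVe, hd,
    fun v _ hv z hz => hexp z hz (v z) (hmem z _ (hv z)) (hVe (hv z)),
    Coassoc.isOpenIn_jmathImage hφ.smooth hi.isImmersion.contMDiff hbij hii hV,
    fun z => ⟨0, hV0 z, (map_zero (Coassoc.jmathLin φ i z)).symm⟩,
    fun q => Coassoc.expMap gHat (Coassoc.normalLift φ gHat i q), hδ, hD,
    fun α hα hαV => ⟨fun z hz => ?_, fun z => hD.1 (hαV z),
      hD.isEmbeddingMap_section hα (fun _ => rfl) hαV⟩⟩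
  obtain ⟨v, hv, hαv⟩ := hαV z
  have h1 : α z = Coassoc.jmath φ i z v := hαv
  beta_reduce
  rw [h1, hδ z v hv]
  exact hexp z hz v (hmem z v hv) (hVe hv)
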